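/- Let $0<\alpha\le 2$, $|\theta|\le\min\{\alpha,2-\alpha\}$, $0<\beta\le 1$, and put $\psi_\alpha^\theta(\kappa)=|\kappa|^\alpha e^{i(\operatorname{sign}\kappa)\theta\pi/2}$. The Riesz–Feller derivative ${}_xD^\alpha_\theta$ is the operator with Fourier symbol $-\psi_\alpha^\theta$ (convention $\widehat f(\kappa)=\int e^{i\kappa x}f(x)\,dx$), and for $m-1<b\le m$, $m\in\mathbb N$, the Caputo derivative is ${}_tD_*^b f(t)=\frac1{\Gamma(m-b)}\int_0^t f^{(m)}(\tau)(t-\tau)^{m-b-1}d\tau$ if $b<m$, and $f^{(m)}(t)$ if $b=m$. For an order $b\in(0,2]$ in time, the Green function $G_{\alpha,b}^\theta(\cdot\,;t)$, $t>0$, is the family of finite measures on $\mathbb R$ which solves ${}_xD_\theta^\alpha u={}_tD_*^b u$ for $t>0$ with $u(\cdot,0^+)=\delta$ and, if $b>1$, also $\partial_tu(\cdot,0^+)=0$. (The equation and the initial conditions are understood on the Fourier side: for every $\kappa$ the function $f=\widehat u(\kappa,\cdot)$ is $C^m$ on $(0,\infty)$ with $f^{(m)}$ integrable on $(0,T]$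 for all $T>0$, it satisfies ${}_tD_*^b f=-\psi_\alpha^\theta(\kappa) f$ on $(0,\infty)$, $f(0^+)=1$ and, if $b>1$, $f'(0^+)=0$.) When this measure has a nonnegative density that is continuous on $\mathbb R\setminus\{0\}$, this density is denoted by the same symbol. Let $L_\alpha^\theta$ be the strictly stable law, $\widehat{L_\alpha^\theta}=e^{-\psi_\alpha^\theta}$, with $L_\alpha^\theta(x;t)=t^{-1/\alpha}L_\alpha^\theta(x/t^{1/\alpha})$ (so that $\widehat{L_\alpha^\theta}(\kappa;t)=e^{-t\psi_\alpha^\theta(\kappa)}$). For $0<\nu<1$ let $M_\nu(z)=\sum_{n\ge0}\frac{(-z)^n}{n!\,\Gamma(-\nu n+1-\nu)}$ (with $1/\Gamma=0$ at the poles of $\Gamma$) and $M_\nu(\tau;t)=t^{-\nu}M_\nu(\tau/t^\nu)$; for $\nu=1$, $M_1(\tau;t)=\delta(\tau-t)$. Then the Green functions $G_{\alpha,\beta}^\theta$, $G_{\alpha,1}^\theta=L_\alpha^\theta(\cdot\,;\cdot)$ and $G_{2,2\beta}^0$ exist, and $K_{\alpha,\beta}^\theta(x;t):=G_{\alpha,\beta}^\theta(x;t)$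 satisfies, for every $t>0$, $$K_{\alpha,\beta}^\theta(x;t)=\int_0^\infty L_\alpha^\theta(x;\tau)\,M_\beta(\tau;t)\,d\tau=2\int_0^\infty G_{\alpha,1}^\theta(x;\tau)\,G_{2,2\beta}^0(\tau;t)\,d\tau ,$$ in the following sense. (a) In all cases these are identities between measures in $x$: for every Borel set $A\subseteq\mathbb R$, $G_{\alpha,\beta}^\theta(A;t)=\int_{(0,\infty)}L_\alpha^\theta(A;\tau)\,M_\beta(d\tau;t)=2\int_{(0,\infty)}G_{\alpha,1}^\theta(A;\tau)\,G_{2,2\beta}^0(d\tau;t)$. (b) If $|\theta|<1$, then $G_{\alpha,1}^\theta$ has the density $L_\alpha^\theta(x;t)$; if $\beta<1$, then $G_{2,2\beta}^0$ has the density $\tfrac12M_\beta(|x|;t)$; if $|\theta|<1$ and $\beta<1$, then $G_{\alpha,\beta}^\theta$ has a nonnegative density, continuous on $\mathbb R\setminus\{0\}$, and the displayed identities hold for all $x\ne0$, with absolutely convergent integrals. -/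

import Mathlib

open MeasureTheory Set Filter Topology

noncomputable section

/-- The Feller symbol `ψ_α^θ(κ) = |κ|^α exp(i sign(κ) θ π / 2)`. The Riesz–Feller derivative of order
`α` and skewness `θ` is the Fourier multiplier with symbol `-ψ_α^θ`, for the convention
`f̂(κ) = ∫ exp(iκx) f(x) dx`. -/
def fellerSymbol (α θ κ : ℝ) : ℂ :=
  ((|κ| ^ α : ℝ) : ℂ) * Complex.exp (Complex.I * ((Real.sign κ * θ * Real.pi / 2 : ℝ) : ℂ))

/-- The Caputo derivative of order `β > 0` (with `m - 1 < β ≤ m`):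
`f^{(m)}(t)` if `β = m`, and `Γ(m-β)⁻¹ ∫₀ᵗ f^{(m)}(τ) (t-τ)^{m-β-1} dτ` otherwise. -/
def caputoDeriv (β : ℝ) (f : ℝ → ℂ) (t : ℝ) : ℂ :=
  if β = (⌈β⌉₊ : ℝ) then iteratedDeriv ⌈β⌉₊ f t
  else ((Real.Gamma ((⌈β⌉₊ : ℝ) - β))⁻¹ : ℝ) •
    ∫ τ in (0 : ℝ)..t, ((t - τ) ^ ((⌈β⌉₊ : ℝ) - β - 1) : ℝ) • iteratedDeriv ⌈β⌉₊ f τ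

/-- The Fourier transform `κ ↦ ∫ exp(iκx) G_t(dx)` of a family of measures, as a function of `κ`
and `t`. -/
def fourierIn (G : ℝ → Measure ℝ) (κ t : ℝ) : ℂ :=
  ∫ x, Complex.exp (Complex.I * (κ : ℂ) * (x : ℂ)) ∂(G t)

/-- `G = (G_t)_{t > 0}` is the (first) Green function of the space-time fractional diffusion
equation `ₓD_θ^α u = ₜD_*^β u`: a family of finite measures on the line (densities are treated
in `IsGreenDensity`) which solves the equation for `t > 0`, the space derivative being taken
through its Fourier symbol, with `u(·, 0⁺) = δ` and, if `β > 1`, `u_t(·, 0⁺) = 0`. The values of `G`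
at `t ≤ 0` are irrelevant. The two regularity fields give the Caputo derivative a meaning. -/
structure IsGreenFunction (α β θ : ℝ) (G : ℝ → Measure ℝ) : Prop where
  finite : ∀ t, 0 < t → IsFiniteMeasure (G t)
  smooth : ∀ κ, ContDiffOn ℝ (⌈β⌉₊ : ℕ) (fourierIn G κ) (Ioi 0)
  integrable : ∀ κ T, 0 < T →
    IntegrableOn (iteratedDeriv ⌈β⌉₊ (fourierIn G κ)) (Ioc 0 T)
  equation : ∀ κ t, 0 < t →
    -fellerSymbol α θ κ * fourierIn G κ t = caputoDeriv β (fourierIn G κ) t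
  initial : ∀ κ, Tendsto (fourierIn G κ) (𝓝[>] 0) (𝓝 1)
  initial_deriv : 1 < β → ∀ κ, Tendsto (deriv (fourierIn G κ)) (𝓝[>] 0) (𝓝 0)

/-- `K(x;t)` is the Green function in the form of a probability density in `x`, in its version
that is continuous off the origin (where the density may be infinite). -/
structure IsGreenDensity (α β θ : ℝ) (K : ℝ → ℝ → ℝ) : Prop where
  nonneg : ∀ t, 0 < t → ∀ x, 0 ≤ K x t
  continuousOn : ∀ t, 0 < t → ContinuousOn (fun x => K x t) {0}ᶜ
  isGreen : IsGreenFunction α β θ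
    (fun t => (volume : Measure ℝ).withDensity (fun x => ENNReal.ofReal (K x t)))

/-- The strictly stable density `L_α^θ(x)`, the inverse Fourier transform of `exp(-ψ_α^θ)`. -/
def stableDensity (α θ x : ℝ) : ℝ :=
  (1 / (2 * Real.pi)) *
    (∫ κ : ℝ, Complex.exp (-(Complex.I * (κ : ℂ) * (x : ℂ))) *
      Complex.exp (-fellerSymbol α θ κ)).re

/-- `L_α^θ(x;t) = t^{-1/α} L_α^θ(x / t^{1/α})`. -/
def stableDensityAt (α θ x t : ℝ) : ℝ :=
  t ^ (-1 / α) * stableDensity α θ (x / t ^ (1 / α))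

/-- The M-Wright function `M_ν(z) = ∑ₙ (-z)ⁿ / (n! Γ(-νn + 1 - ν))`, `0 < ν < 1`; a term whose Gamma
factor sits at a pole is zero (`Real.Gamma` is `0` there). -/
def mWright (ν z : ℝ) : ℝ :=
  ∑' n : ℕ, (-z) ^ n / ((n.factorial : ℝ) * Real.Gamma (-ν * n + (1 - ν)))

/-- `M_ν(x;t) = t^{-ν} M_ν(x / t^ν)`. -/
def mWrightAt (ν x t : ℝ) : ℝ :=
  t ^ (-ν) * mWright ν (x / t ^ ν)

/-- The directing law `M_ν(τ;t) dτ` on `(0,∞)` for `0 < ν ≤ 1`; for `ν = 1` one has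
`M_1(r) = δ(r - 1)`, hence `M_1(τ;t) dτ = δ_t(dτ)`. -/
def mWrightLaw (ν t : ℝ) : Measure ℝ :=
  if ν = 1 then Measure.dirac t
  else ((volume : Measure ℝ).restrict (Ioi 0)).withDensity
    (fun τ => ENNReal.ofReal (mWrightAt ν τ t))

end

/-! Everything is read off on the Fourier side, where the equation becomes, for each κ, a scalar
Caputo equation with l = ψ(κ). Its only solution is the Mittag-Leffler function E_b(-l t^b). A
finite measure is determined by its Fourier transform, so a Green function is unique
(`IsGreenFunction.eq_of_pos`), and a family of finite measures is a Green function as soon as its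
transform is Mittag-Leffler (`isGreenFunction_of_fourierIn`).

Subordination is then one Laplace transform: ∫ exp(-lτ) M_β(dτ;t) = E_β(-l t^β)
(`integral_exp_mWrightLaw`). With l = ψ(κ) it says that mixing the stable laws, of transform
exp(-τψ), over τ yields the Green function of order β. With l = ±iκ, and E_β(iκ t^β) + E_β(-iκ t^β)
= 2 E_{2β}(-κ² t^{2β}), it says that the even symmetrization of M_β(·;t) is the Green function for
(2, 2β, 0). On (0,∞) the latter is half of M_β(·;t), whence the factor 2 in the second formula.

Two facts about stable laws have to be built. First, exp(-ψ) is the transform of a positive measure.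
For α ≠ 1, 2 the symbol splits into two extremal symbols with nonnegative weights, and each extremal
exponential is a limit of powers of series in exp(iyk) with nonnegative coefficients, made from the
binomial expansion of (1-w)^a; α = 1 and α = 2 follow by a limit in α
(`fourierPos_exp_neg_fellerSymbol`). The exception |θ| = 1, which forces α = 1, is a point mass.

Second, for 0 < ν < 1 the function M_ν is the one-sided stable density of skewness -ν in the
variable r = x^{-ν} (`mWright_eq_stableDensity`), by comparison of power series. This gives M_ν ≥ 0.
The stable density has Laplace transform exp(-s^ν) (`laplace_oneSided`), hence explicit negative
moments, hence M_ν has moments n!/Γ(νn+1), which sum to the Mittag-Leffler series.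

For the pointwise statements, |x| L(x) is bounded, so |L(x;τ)| ≤ C/|x| uniformly in τ. The
subordination integral therefore converges absolutely and is continuous off the origin; Tonelli and
uniqueness identify it with the Green density. -/

open scoped FourierTransform ComplexOrder

/-! ### Positive trigonometric sums and their limits -/

/-- Finite sums `∑ cⱼ exp(i yⱼ v)` with nonnegative coefficients. -/
inductive PosTrig : (ℝ → ℂ) → Prop
  | exp (c y : ℝ) (hc : 0 ≤ c) :
      PosTrig (fun v => (c : ℂ) * Complex.exp (Complex.I * ((y * v : ℝ) : ℂ)))
  | add {f g : ℝ → ℂ} : PosTrig f → PosTrig g → PosTrig (fun v => f v + g v)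

namespace PosTrig

theorem const (c : ℝ) (hc : 0 ≤ c) : PosTrig (fun _ => (c : ℂ)) := by
  simpa using PosTrig.exp c 0 hc

theorem mul {f g : ℝ → ℂ} (hf : PosTrig f) (hg : PosTrig g) :
    PosTrig (fun v => f v * g v) := by
  induction hf with
  | exp c y hc =>
    induction hg with
    | exp d z hd =>
      convert PosTrig.exp (c * d) (y + z) (mul_nonneg hc hd) using 2 with v
      rw [mul_mul_mul_comm, ← Complex.exp_add]
      push_cast
      ring_nf
    | add _ _ h1 h2 =>
      convert PosTrig.add h1 h2 using 2 with v
      ring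
  | add _ _ h1 h2 =>
    convert PosTrig.add h1 h2 using 2 with v
    ring

theorem comp_mul {f : ℝ → ℂ} (hf : PosTrig f) (a : ℝ) : PosTrig (fun v => f (a * v)) := by
  induction hf with
  | exp c y hc =>
    convert PosTrig.exp c (y * a) hc using 6
    ring
  | add _ _ h1 h2 => exact PosTrig.add h1 h2

theorem sum {ι : Type*} (s : Finset ι) (f : ι → ℝ → ℂ) (hf : ∀ i ∈ s, PosTrig (f i)) :
    PosTrig (fun v => ∑ i ∈ s, f i v) := by
  classical
  induction s using Finset.induction_on with
  | empty => simpa using PosTrig.const 0 le_rfl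
  | insert a s ha ih =>
    simp only [Finset.sum_insert ha]
    exact PosTrig.add (hf a (by simp)) (ih fun i hi => hf i (by simp [hi]))

theorem continuous {f : ℝ → ℂ} (hf : PosTrig f) : Continuous f := by
  induction hf with
  | exp c y hc => fun_prop
  | add _ _ h1 h2 => exact h1.add h2

theorem norm_le {f : ℝ → ℂ} (hf : PosTrig f) (v : ℝ) : ‖f v‖ ≤ (f 0).re := by
  induction hf with
  | exp c y hc =>
    rw [norm_mul, mul_comm Complex.I, Complex.norm_exp_ofReal_mul_I]
    simp [abs_of_nonneg hc]
  | add _ _ h1 h2 => exact (norm_add_le _ _).trans (by simpa using add_le_add h1 h2)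

end PosTrig

/-- Pointwise limits of sequences in `PosTrig`. -/
def LimPosTrig (f : ℝ → ℂ) : Prop :=
  ∃ p : ℕ → ℝ → ℂ, (∀ n, PosTrig (p n)) ∧ ∀ v, Tendsto (fun n => p n v) atTop (𝓝 (f v))

namespace LimPosTrig

theorem of_posTrig {f : ℝ → ℂ} (hf : PosTrig f) : LimPosTrig f :=
  ⟨fun _ => f, fun _ => hf, fun _ => tendsto_const_nhds⟩

theorem mul {f g : ℝ → ℂ} (hf : LimPosTrig f) (hg : LimPosTrig g) :
    LimPosTrig (fun v => f v * g v) := by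
  obtain ⟨p, hp, hpf⟩ := hf
  obtain ⟨q, hq, hqg⟩ := hg
  exact ⟨fun n v => p n v * q n v, fun n => (hp n).mul (hq n), fun v => (hpf v).mul (hqg v)⟩

theorem pow {f : ℝ → ℂ} (hf : LimPosTrig f) (n : ℕ) : LimPosTrig (fun v => f v ^ n) := by
  induction n with
  | zero => simpa using of_posTrig (PosTrig.const 1 zero_le_one)
  | succ n ih => simpa only [pow_succ] using ih.mul hf

theorem comp_mul {f : ℝ → ℂ} (hf : LimPosTrig f) (a : ℝ) : LimPosTrig (fun v => f (a * v)) := by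
  obtain ⟨p, hp, hpf⟩ := hf
  exact ⟨fun n v => p n (a * v), fun n => (hp n).comp_mul a, fun v => hpf _⟩

theorem of_hasSum {f : ℝ → ℂ} {c y : ℕ → ℝ} (hc : ∀ n, 0 ≤ c n)
    (hf : ∀ v, HasSum (fun n => (c n : ℂ) * Complex.exp (Complex.I * ((y n * v : ℝ) : ℂ))) (f v)) :
    LimPosTrig f :=
  ⟨fun N v => ∑ n ∈ Finset.range N,
      (c n : ℂ) * Complex.exp (Complex.I * ((y n * v : ℝ) : ℂ)),
    fun _ => PosTrig.sum _ _ fun n _ => PosTrig.exp (c n) (y n) (hc n),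
    fun v => (hf v).tendsto_sum_nat⟩

theorem norm_le {f : ℝ → ℂ} (hf : LimPosTrig f) (v : ℝ) : ‖f v‖ ≤ (f 0).re := by
  obtain ⟨p, hp, hpf⟩ := hf
  exact le_of_tendsto_of_tendsto' (hpf v).norm
    ((Complex.continuous_re.tendsto _).comp (hpf 0)) fun n => (hp n).norm_le v

theorem measurable {f : ℝ → ℂ} (hf : LimPosTrig f) : Measurable f := by
  obtain ⟨p, hp, hpf⟩ := hf
  exact measurable_of_tendsto_metrizable (fun n => (hp n).continuous.measurable)
    (tendsto_pi_nhds.2 hpf)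

end LimPosTrig

/-! ### Positivity of Gaussian-regularized Fourier transforms -/

/-- The Fourier transforms of all Gaussian regularizations of `f` are nonnegative. -/
def FourierPos (f : ℝ → ℂ) : Prop :=
  ∀ ε : ℝ, 0 < ε → ∀ x : ℝ,
    0 ≤ 𝓕 (fun v : ℝ => Complex.exp (-Real.pi * ε * v ^ 2) * f v) x

theorem integrable_gaussian_pi {ε : ℝ} (hε : 0 < ε) :
    Integrable (fun v : ℝ => Complex.exp (-Real.pi * ε * v ^ 2)) := by
  have := integrable_cexp_neg_mul_sq (b := (Real.pi * ε : ℂ)) (by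
    rw [← Complex.ofReal_mul, Complex.ofReal_re]; positivity)
  simpa using this

theorem fourier_gaussian_pi_nonneg {ε : ℝ} (hε : 0 < ε) (x : ℝ) :
    0 ≤ 𝓕 (fun v : ℝ => Complex.exp (-Real.pi * ε * v ^ 2)) x := by
  rw [fourier_gaussian_pi (b := (ε : ℂ)) (by simpa using hε)]
  have h1 : (1 / (ε : ℂ) ^ (1 / 2 : ℂ)) = ((1 / ε ^ (1 / 2 : ℝ) : ℝ) : ℂ) := by
    push_cast [Complex.ofReal_cpow hε.le]; rfl
  have h2 : Complex.exp (-Real.pi / ε * x ^ 2) = ((Real.exp (-Real.pi / ε * x ^ 2) : ℝ) : ℂ) := by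
    push_cast; rfl
  dsimp only
  rw [h1, h2, ← Complex.ofReal_mul]
  exact Complex.zero_le_real.2 (by positivity)

namespace FourierPos

/-- Multiplying by exp(iyv) translates the transform of the Gaussian by y/(2π), so the result is a
nonnegative combination of translated Gaussians. -/
theorem of_posTrig {f : ℝ → ℂ} (hf : PosTrig f) : FourierPos f := by
  intro ε hε x
  induction hf generalizing x with
  | exp c y hc =>
    have : 𝓕 (fun v : ℝ => Complex.exp (-Real.pi * ε * v ^ 2) *
        ((c : ℂ) * Complex.exp (Complex.I * ((y * v : ℝ) : ℂ)))) x =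
        c * 𝓕 (fun v : ℝ => Complex.exp (-Real.pi * ε * v ^ 2)) (x - y / (2 * Real.pi)) := by
      rw [Real.fourier_real_eq_integral_exp_smul, Real.fourier_real_eq_integral_exp_smul,
        ← integral_const_mul]
      congr 1
      ext v
      simp only [smul_eq_mul]
      have : Complex.exp (((-2 * Real.pi * v * (x - y / (2 * Real.pi)) : ℝ) : ℂ) * Complex.I) =
          Complex.exp (((-2 * Real.pi * v * x : ℝ) : ℂ) * Complex.I) *
          Complex.exp (Complex.I * ((y * v : ℝ) : ℂ)) := by
        rw [← Complex.exp_add]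
        congr 1
        push_cast
        field_simp
        ring
      rw [this]
      ring
    rw [this]
    exact mul_nonneg (Complex.zero_le_real.2 hc) (fourier_gaussian_pi_nonneg hε _)
  | @add f g hf hg h1 h2 =>
    have key : ∀ {f : ℝ → ℂ}, PosTrig f →
        Integrable (fun v : ℝ => Complex.exp (-Real.pi * ε * v ^ 2) * f v) := fun hf =>
      (integrable_gaussian_pi hε).mul_bdd hf.continuous.aestronglyMeasurable
        (Filter.Eventually.of_forall fun v => hf.norm_le v)
    have : (fun v : ℝ => Complex.exp (-Real.pi * ε * v ^ 2) * (f v + g v)) =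
        (fun v : ℝ => Complex.exp (-Real.pi * ε * v ^ 2) * f v) +
        (fun v : ℝ => Complex.exp (-Real.pi * ε * v ^ 2) * g v) := by
      ext v; simp [mul_add]
    rw [this, Real.fourier_eq, Pi.add_def]
    have h : 𝓕 ((fun v : ℝ => Complex.exp (-Real.pi * ε * v ^ 2) * f v) +
        (fun v : ℝ => Complex.exp (-Real.pi * ε * v ^ 2) * g v)) x = _ + _ :=
      congrFun (VectorFourier.fourierIntegral_add (L := innerₗ ℝ) Real.continuous_fourierChar
        continuous_inner (key hf) (key hg)) x
    exact (add_nonneg (h1 x) (h2 x)).trans_eq h.symm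

/-- The Gaussian factor supplies the dominating function, so bounded pointwise convergence suffices
and no integrability of `f` is needed. -/
theorem of_tendsto {f : ℝ → ℂ} {p : ℕ → ℝ → ℂ} {C : ℝ} (hp : ∀ᶠ n in atTop, FourierPos (p n))
    (hm : ∀ n, Measurable (p n)) (hC : ∀ᶠ n in atTop, ∀ v, ‖p n v‖ ≤ C)
    (hpf : ∀ v, Tendsto (fun n => p n v) atTop (𝓝 (f v))) : FourierPos f := by
  intro ε hε x
  have lim : Tendsto (fun n => 𝓕 (fun v : ℝ => Complex.exp (-Real.pi * ε * v ^ 2) * p n v) x)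
      atTop (𝓝 (𝓕 (fun v : ℝ => Complex.exp (-Real.pi * ε * v ^ 2) * f v) x)) := by
    simp only [Real.fourier_real_eq_integral_exp_smul]
    refine tendsto_integral_filter_of_dominated_convergence
      (fun v => ‖Complex.exp (-Real.pi * ε * v ^ 2)‖ * C) ?_ ?_ ?_ ?_
    · refine Filter.Eventually.of_forall fun n => ?_
      refine Measurable.aestronglyMeasurable ?_
      have := hm n
      fun_prop
    · filter_upwards [hC] with n hn
      refine Filter.Eventually.of_forall fun v => ?_
      rw [norm_smul, Complex.norm_exp_ofReal_mul_I, one_mul, norm_mul]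
      gcongr
      exact hn v
    · exact (integrable_gaussian_pi hε).norm.mul_const C
    · exact Filter.Eventually.of_forall fun v => ((hpf v).const_mul _).const_smul _
  exact ge_of_tendsto lim (hp.mono fun n hn => hn ε hε x)

/-- A positive trigonometric sum is largest at 0, so convergence at that single point bounds the
approximants uniformly. -/
theorem of_limPosTrig {f : ℝ → ℂ} (hf : LimPosTrig f) : FourierPos f := by
  obtain ⟨p, hp, hpf⟩ := hf
  refine of_tendsto (C := (f 0).re + 1) (Filter.Eventually.of_forall fun n => of_posTrig (hp n))
    (fun n => (hp n).continuous.measurable) ?_ hpf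
  filter_upwards [((Complex.continuous_re.tendsto _).comp (hpf 0)).eventually
    (gt_mem_nhds (lt_add_one _))] with n hn v
  exact ((hp n).norm_le v).trans hn.le

theorem of_tendsto_limPosTrig {f : ℝ → ℂ} {p : ℕ → ℝ → ℂ} (hp : ∀ᶠ n in atTop, LimPosTrig (p n))
    (hpf : ∀ v, Tendsto (fun n => p n v) atTop (𝓝 (f v))) : FourierPos f := by
  obtain ⟨N, hN⟩ := eventually_atTop.1 hp
  have hpf' : ∀ v, Tendsto (fun n => p (n + N) v) atTop (𝓝 (f v)) := fun v =>
    (tendsto_add_atTop_iff_nat N).2 (hpf v)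
  refine of_tendsto (p := fun n => p (n + N)) (C := (f 0).re + 1)
    (Filter.Eventually.of_forall fun n => of_limPosTrig (hN _ (by omega)))
    (fun n => (hN _ (by omega)).measurable) ?_ hpf'
  filter_upwards [((Complex.continuous_re.tendsto _).comp (hpf' 0)).eventually
    (gt_mem_nhds (lt_add_one _))] with n hn v
  exact ((hN _ (by omega)).norm_le v).trans hn.le

end FourierPos

/-! ### Positivity and integrability of the Fourier transform -/

section Inversion

variable {f : ℝ → ℂ}

theorem FourierPos.fourier_nonneg (hf : FourierPos f) (hi : Integrable f) (x : ℝ) :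
    0 ≤ 𝓕 f x := by
  have lim : Tendsto
      (fun n : ℕ => 𝓕 (fun v : ℝ => Complex.exp (-Real.pi * ((1 / ((n : ℝ) + 1) : ℝ) : ℂ) * v ^ 2)
        * f v) x) atTop (𝓝 (𝓕 f x)) := by
    simp only [Real.fourier_real_eq_integral_exp_smul]
    refine tendsto_integral_of_dominated_convergence (fun v => ‖f v‖) ?_ hi.norm ?_ ?_
    · intro n
      have := hi.1
      have h1 : Continuous fun v : ℝ =>
          Complex.exp (((-2 * Real.pi * v * x : ℝ) : ℂ) * Complex.I) := by fun_prop
      have h2 : Continuous fun v : ℝ =>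
          Complex.exp (-Real.pi * ((1 / ((n : ℝ) + 1) : ℝ) : ℂ) * v ^ 2) := by fun_prop
      exact h1.aestronglyMeasurable.smul (h2.aestronglyMeasurable.mul this)
    · intro n
      refine Filter.Eventually.of_forall fun v => ?_
      rw [norm_smul, Complex.norm_exp_ofReal_mul_I, one_mul, norm_mul]
      refine mul_le_of_le_one_left (norm_nonneg _) ?_
      rw [Complex.norm_exp, ← Complex.ofReal_neg, ← Complex.ofReal_mul, ← Complex.ofReal_pow,
        ← Complex.ofReal_mul, Complex.ofReal_re, Real.exp_le_one_iff]
      have := Real.pi_pos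
      have : 0 ≤ Real.pi * (1 / ((n : ℝ) + 1)) * v ^ 2 := by positivity
      linarith
    · refine Filter.Eventually.of_forall fun v => Tendsto.const_smul ?_ _
      have h0 : Tendsto (fun n : ℕ => ((1 / ((n : ℝ) + 1) : ℝ) : ℂ)) atTop (𝓝 ((0 : ℝ) : ℂ)) :=
        (Complex.continuous_ofReal.tendsto _).comp tendsto_one_div_add_atTop_nhds_zero_nat
      have h1 := ((Complex.continuous_exp.tendsto _).comp
        ((h0.const_mul (-(Real.pi : ℂ))).mul_const ((v : ℂ) ^ 2))).mul_const (f v)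
      simpa using h1
  exact ge_of_tendsto' lim fun n => hf _ (by positivity) x

/-- Pairing the transform of `f` with a Gaussian and moving the transform to the Gaussian gives at
most ∫ ĝ = 1, because |f| ≤ 1. Since the transform of `f` is nonnegative, this pairing is an L¹
norm, and Fatou removes the Gaussian. Integrability is what makes Fourier inversion available. -/
theorem FourierPos.integrable_fourier (hf : FourierPos f) (hi : Integrable f)
    (hC : ∀ v, ‖f v‖ ≤ 1) : Integrable (𝓕 f) := by
  have hcont : Continuous (𝓕 f) :=
    VectorFourier.fourierIntegral_continuous (L := innerₗ ℝ) Real.continuous_fourierChar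
      continuous_inner hi
  have hpos := hf.fourier_nonneg hi
  have hbound : ∀ ε : ℝ, 0 < ε →
      ∫⁻ x : ℝ, ‖𝓕 f x * Complex.exp (-Real.pi * ε * x ^ 2)‖ₑ ≤ 1 := by
    intro ε hε
    have hg := integrable_gaussian_pi hε
    have hgr : ∀ x : ℝ, Complex.exp (-Real.pi * ε * x ^ 2) =
        ((Real.exp (-Real.pi * ε * x ^ 2) : ℝ) : ℂ) := fun x => by push_cast; rfl
    have hnn : ∀ x : ℝ, 𝓕 f x * Complex.exp (-Real.pi * ε * x ^ 2) =
        ((‖𝓕 f x * Complex.exp (-Real.pi * ε * x ^ 2)‖ : ℝ) : ℂ) := by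
      intro x
      rw [norm_mul, hgr, Complex.norm_real, Real.norm_of_nonneg (Real.exp_pos _).le,
        Complex.ofReal_mul, ← Complex.eq_coe_norm_of_nonneg (hpos x)]
    have hint : Integrable (fun x : ℝ => 𝓕 f x * Complex.exp (-Real.pi * ε * x ^ 2)) := by
      refine hg.bdd_mul (c := ∫ v, ‖f v‖) hcont.aestronglyMeasurable
        (Filter.Eventually.of_forall fun x => ?_)
      exact VectorFourier.norm_fourierIntegral_le_integral_norm _ _ _ _ _
    have hflip : ∫ x : ℝ, 𝓕 f x * Complex.exp (-Real.pi * ε * x ^ 2) =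
        ∫ v : ℝ, f v * 𝓕 (fun x : ℝ => Complex.exp (-Real.pi * ε * x ^ 2)) v := by
      have := VectorFourier.integral_fourierIntegral_smul_eq_flip (L := innerₗ ℝ)
        Real.continuous_fourierChar continuous_inner hi hg
      simpa using! this
    have hgauss : ∀ v : ℝ, ‖𝓕 (fun x : ℝ => Complex.exp (-Real.pi * ε * x ^ 2)) v‖ =
        1 / ε ^ (1 / 2 : ℝ) * Real.exp (-(Real.pi / ε) * v ^ 2) := by
      intro v
      rw [fourier_gaussian_pi (b := (ε : ℂ)) (by simpa using hε)]
      dsimp only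
      have h1 : (ε : ℂ) ^ (1 / 2 : ℂ) = ((ε ^ (1 / 2 : ℝ) : ℝ) : ℂ) := by
        push_cast [Complex.ofReal_cpow hε.le]; rfl
      have h2 : Complex.exp (-Real.pi / ε * v ^ 2) =
          ((Real.exp (-(Real.pi / ε) * v ^ 2) : ℝ) : ℂ) := by
        push_cast; congr 1; ring
      rw [h1, h2, norm_mul, norm_div, Complex.norm_real, Complex.norm_real, norm_one,
        Real.norm_of_nonneg (Real.exp_pos _).le, Real.norm_of_nonneg (by positivity)]
    have hIg : ∫ v : ℝ, 1 / ε ^ (1 / 2 : ℝ) * Real.exp (-(Real.pi / ε) * v ^ 2) = 1 := by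
      rw [integral_const_mul, integral_gaussian, div_div_cancel₀ Real.pi_ne_zero,
        Real.sqrt_eq_rpow, one_div, inv_mul_cancel₀ (by positivity)]
    have hle : ∫ x : ℝ, ‖𝓕 f x * Complex.exp (-Real.pi * ε * x ^ 2)‖ ≤ 1 := by
      have : ((∫ x : ℝ, ‖𝓕 f x * Complex.exp (-Real.pi * ε * x ^ 2)‖ : ℝ) : ℂ) =
          ∫ v : ℝ, f v * 𝓕 (fun x : ℝ => Complex.exp (-Real.pi * ε * x ^ 2)) v := by
        rw [← hflip, ← integral_complex_ofReal]
        exact integral_congr_ae (Filter.Eventually.of_forall fun x => (hnn x).symm)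
      calc ∫ x : ℝ, ‖𝓕 f x * Complex.exp (-Real.pi * ε * x ^ 2)‖
          ≤ ‖((∫ x : ℝ, ‖𝓕 f x * Complex.exp (-Real.pi * ε * x ^ 2)‖ : ℝ) : ℂ)‖ := by
            rw [Complex.norm_real]; exact Real.le_norm_self _
        _ ≤ ∫ v : ℝ, 1 / ε ^ (1 / 2 : ℝ) * Real.exp (-(Real.pi / ε) * v ^ 2) := by
            rw [this]
            refine norm_integral_le_of_norm_le ?_ (Filter.Eventually.of_forall fun v => ?_)
            · exact (integrable_exp_neg_mul_sq (by positivity)).const_mul _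
            · rw [norm_mul, hgauss]
              exact mul_le_of_le_one_left (by positivity) (hC v)
        _ = 1 := hIg
    rw [← ofReal_integral_norm_eq_lintegral_enorm hint]
    simpa using ENNReal.ofReal_le_ofReal hle
  refine ⟨hcont.aestronglyMeasurable, ?_⟩
  rw [HasFiniteIntegral]
  refine lt_of_le_of_lt ?_ ENNReal.one_lt_top
  have hlim : ∀ x : ℝ, Tendsto (fun n : ℕ =>
      ‖𝓕 f x * Complex.exp (-Real.pi * ((1 / ((n : ℝ) + 1) : ℝ) : ℂ) * x ^ 2)‖ₑ) atTop
      (𝓝 ‖𝓕 f x‖ₑ) := by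
    intro x
    have h0 : Tendsto (fun n : ℕ => ((1 / ((n : ℝ) + 1) : ℝ) : ℂ)) atTop (𝓝 ((0 : ℝ) : ℂ)) :=
      (Complex.continuous_ofReal.tendsto _).comp tendsto_one_div_add_atTop_nhds_zero_nat
    have h1 := ((Complex.continuous_exp.tendsto _).comp
      ((h0.const_mul (-(Real.pi : ℂ))).mul_const ((x : ℂ) ^ 2))).const_mul (𝓕 f x)
    refine (continuous_enorm.tendsto _).comp ?_
    simpa using h1
  calc ∫⁻ x, ‖𝓕 f x‖ₑ
      = ∫⁻ x : ℝ, liminf (fun n : ℕ =>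
          ‖𝓕 f x * Complex.exp (-Real.pi * ((1 / ((n : ℝ) + 1) : ℝ) : ℂ) * x ^ 2)‖ₑ) atTop := by
        congr 1; ext x; exact (hlim x).liminf_eq.symm
    _ ≤ liminf (fun n : ℕ => ∫⁻ x : ℝ,
          ‖𝓕 f x * Complex.exp (-Real.pi * ((1 / ((n : ℝ) + 1) : ℝ) : ℂ) * x ^ 2)‖ₑ) atTop :=
        lintegral_liminf_le fun n => by
          have := hcont.measurable
          fun_prop
    _ ≤ liminf (fun _ : ℕ => (1 : ENNReal)) atTop :=
        liminf_le_liminf (Filter.Eventually.of_forall fun n => hbound _ (by positivity))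
    _ = 1 := by simp

end Inversion

/-! ### Binomial series and the approximation of extremal stable laws -/

/-- Coefficients of `(1 - w) ^ a`. -/
noncomputable def oneSubCoeff (a : ℝ) (n : ℕ) : ℝ := (-1) ^ n * Ring.choose a n

theorem oneSubCoeff_zero (a : ℝ) : oneSubCoeff a 0 = 1 := by simp [oneSubCoeff]

theorem oneSubCoeff_succ (a : ℝ) (n : ℕ) :
    oneSubCoeff a (n + 1) = oneSubCoeff a n * ((n - a) / (n + 1)) := by
  have h : Ring.choose a (n + 1) * (n + 1) = Ring.choose a n * (a - n) := by
    rw [Ring.choose_eq_smul, Ring.choose_eq_smul, descPochhammer_succ_right,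
      Polynomial.smeval_mul, Nat.factorial_succ]
    simp only [Polynomial.smeval_sub, Polynomial.smeval_X, Polynomial.smeval_natCast,
      smul_eq_mul, pow_one, pow_zero, nsmul_eq_mul, mul_one]
    have : (n.factorial : ℝ) ≠ 0 := by positivity
    push_cast
    field_simp
  have h' : Ring.choose a (n + 1) = Ring.choose a n * (a - n) / (n + 1) := by
    field_simp; linarith
  rw [oneSubCoeff, oneSubCoeff, h', pow_succ]
  field_simp
  ring

theorem hasSum_oneSubCoeff (a : ℝ) {w : ℂ} (hw : ‖w‖ < 1) :
    HasSum (fun n => (oneSubCoeff a n : ℂ) * w ^ n) ((1 - w) ^ (a : ℂ)) := by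
  have h := (Complex.one_add_cpow_hasFPowerSeriesOnBall_zero (a := (a : ℂ))).hasSum
    (y := -w) (by
      rw [Metric.mem_eball, edist_zero_right, enorm_neg, ← ofReal_norm, ← ENNReal.ofReal_one]
      exact (ENNReal.ofReal_lt_ofReal_iff one_pos).2 hw)
  rw [zero_add, ← sub_eq_add_neg] at h
  convert! h using 2 with n
  simp only [binomialSeries_apply, List.ofFn_const, List.prod_replicate, smul_eq_mul]
  rw [oneSubCoeff, neg_pow w n]
  push_cast
  ring

theorem oneSubCoeff_one (a : ℝ) : oneSubCoeff a 1 = -a := by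
  rw [oneSubCoeff_succ, oneSubCoeff_zero]; simp

theorem oneSubCoeff_succ_nonpos {a : ℝ} (h0 : 0 < a) (h1 : a < 1) (n : ℕ) :
    oneSubCoeff a (n + 1) ≤ 0 := by
  induction n with
  | zero => rw [zero_add, oneSubCoeff_one]; linarith
  | succ n ih =>
    rw [oneSubCoeff_succ]
    refine mul_nonpos_of_nonpos_of_nonneg ih (div_nonneg ?_ (by positivity))
    push_cast
    have : (0 : ℝ) ≤ n := n.cast_nonneg
    linarith

theorem oneSubCoeff_add_two_nonneg {a : ℝ} (h1 : 1 < a) (h2 : a < 2) (n : ℕ) :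
    0 ≤ oneSubCoeff a (n + 2) := by
  induction n with
  | zero =>
    rw [zero_add, oneSubCoeff_succ, oneSubCoeff_one]
    have : 0 < a * (a - 1) := mul_pos (by linarith) (by linarith)
    push_cast
    linarith
  | succ n ih =>
    rw [oneSubCoeff_succ]
    refine mul_nonneg ih (div_nonneg ?_ (by positivity))
    push_cast
    have : (0 : ℝ) ≤ n := n.cast_nonneg
    linarith

theorem norm_ofReal_mul_exp_I {r : ℝ} (hr : 0 ≤ r) (k : ℝ) :
    ‖(r : ℂ) * Complex.exp (Complex.I * k)‖ = r := by
  rw [norm_mul, mul_comm Complex.I, Complex.norm_exp_ofReal_mul_I, Complex.norm_real,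
    Real.norm_of_nonneg hr, mul_one]

/-- For 0 < a < 1 all coefficients of (1-w)^a after the constant 1 are nonpositive: 1-(1-w)^a
generates the Sibuya distribution. -/
theorem limPosTrig_sibuya {a r : ℝ} (h0 : 0 < a) (h1 : a < 1) (hr0 : 0 ≤ r) (hr1 : r < 1) :
    LimPosTrig (fun k : ℝ => 1 - (1 - (r : ℂ) * Complex.exp (Complex.I * k)) ^ (a : ℂ)) := by
  refine LimPosTrig.of_hasSum (c := fun n => -oneSubCoeff a (n + 1) * r ^ (n + 1))
    (y := fun n => (n : ℝ) + 1)
    (fun n => mul_nonneg (neg_nonneg.2 (oneSubCoeff_succ_nonpos h0 h1 n)) (by positivity))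
    fun k => ?_
  have h := hasSum_oneSubCoeff a (w := (r : ℂ) * Complex.exp (Complex.I * k))
    (by rwa [norm_ofReal_mul_exp_I hr0])
  have h' := ((hasSum_nat_add_iff' 1).2 h).neg
  simp only [Finset.sum_range_one, pow_zero, mul_one, oneSubCoeff_zero, Complex.ofReal_one,
    neg_sub] at h'
  convert! h' using 2 with n
  rw [mul_pow, ← Complex.exp_nat_mul]
  push_cast
  ring_nf

/-- For 1 < a < 2 the only negative coefficient of (1-w)^a is -a, at w. After division by a w it
becomes the constant -1, which the added 1 cancels; the steps start at -1. -/
theorem limPosTrig_sibuya' {a r : ℝ} (h1 : 1 < a) (h2 : a < 2) (hr0 : 0 < r) (hr1 : r < 1) :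
    LimPosTrig (fun k : ℝ => 1 + (1 - (r : ℂ) * Complex.exp (Complex.I * k)) ^ (a : ℂ) *
      Complex.exp (-(Complex.I * k)) / (a * r)) := by
  have ha : (a : ℂ) ≠ 0 := by exact_mod_cast (by linarith : a ≠ 0)
  have hr : (r : ℂ) ≠ 0 := by exact_mod_cast hr0.ne'
  refine LimPosTrig.of_hasSum
    (c := fun n => if n = 1 then 0 else oneSubCoeff a n * r ^ n / (a * r))
    (y := fun n => (n : ℝ) - 1) (fun n => ?_) fun k => ?_
  · rcases n with _ | _ | n
    · simp only [zero_ne_one, if_false, oneSubCoeff_zero]; positivity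
    · simp
    · have := oneSubCoeff_add_two_nonneg h1 h2 n
      simp only [Nat.reduceEqDiff, Nat.add_eq_right, Nat.add_eq_zero_iff]
      split_ifs <;> positivity
  have h := hasSum_oneSubCoeff a (w := (r : ℂ) * Complex.exp (Complex.I * k))
    (by rwa [norm_ofReal_mul_exp_I hr0.le])
  have h' := (h.mul_right (Complex.exp (-(Complex.I * k)))).div_const ((a : ℂ) * r)
  have h3 := (hasSum_ite_eq (1 : ℕ) (1 : ℂ)).add h'
  have hexp : ∀ n : ℕ, Complex.exp (Complex.I * k) ^ n * Complex.exp (-(Complex.I * k)) =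
      Complex.exp (Complex.I * ((((n : ℝ) - 1) * k : ℝ) : ℂ)) := by
    intro n
    rw [← Complex.exp_nat_mul, ← Complex.exp_add]
    push_cast
    ring_nf
  convert! h3 using 2 with n
  rw [mul_pow, mul_assoc, mul_assoc, hexp]
  by_cases hn : n = 1
  · subst hn
    simp only [if_true, oneSubCoeff_one]
    push_cast
    field_simp
    simp
  · simp only [hn, if_false]
    push_cast
    ring

/-- `n^{1/a} (1 - (1 - n^{-2/a}) exp(i k n^{-1/a})) → -i k`. -/
theorem tendsto_scaled_one_sub {e : ℕ → ℝ} (he : Tendsto e atTop (𝓝 0)) (he0 : ∀ n, e n ≠ 0)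
    (k : ℝ) :
    Tendsto (fun n => ((e n : ℂ))⁻¹ *
        (1 - ((1 - e n ^ 2 : ℝ) : ℂ) * Complex.exp (Complex.I * ((e n * k : ℝ) : ℂ)))) atTop
      (𝓝 (-(Complex.I * k))) := by
  have hd : HasDerivAt (fun t : ℝ => Complex.exp (Complex.I * ((t * k : ℝ) : ℂ)))
      (Complex.I * k) 0 := by
    have h1 : HasDerivAt (fun t : ℝ => Complex.I * ((t * k : ℝ) : ℂ)) (Complex.I * k) 0 := by
      have h := ((hasDerivAt_id (0 : ℝ)).mul_const k).ofReal_comp.const_mul Complex.I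
      simpa using h
    simpa using h1.cexp
  have h2 := (hd.tendsto_slope_zero).comp
    (tendsto_nhdsWithin_iff.2 ⟨he, Filter.Eventually.of_forall he0⟩)
  have h3 : Tendsto (fun n => (e n : ℂ) * Complex.exp (Complex.I * ((e n * k : ℝ) : ℂ))) atTop
      (𝓝 0) := by
    have : Continuous fun t : ℝ => (t : ℂ) * Complex.exp (Complex.I * ((t * k : ℝ) : ℂ)) := by
      fun_prop
    simpa [Function.comp_def] using (this.tendsto 0).comp he
  have h4 := h3.sub h2
  rw [zero_sub] at h4
  refine h4.congr fun n => ?_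
  have : (e n : ℂ) ≠ 0 := by exact_mod_cast he0 n
  simp only [Function.comp, zero_add, zero_mul, Complex.ofReal_zero, mul_zero, Complex.exp_zero,
    Complex.real_smul]
  push_cast
  field_simp
  ring

theorem Complex.ofReal_mul_cpow {r : ℝ} (hr : 0 < r) (z w : ℂ) :
    ((r : ℂ) * z) ^ w = (r : ℂ) ^ w * z ^ w := by
  have hr' : (r : ℂ) ≠ 0 := by exact_mod_cast hr.ne'
  rcases eq_or_ne z 0 with rfl | hz
  · rcases eq_or_ne w 0 with rfl | hw <;> simp [*]
  · rw [Complex.cpow_def_of_ne_zero (mul_ne_zero hr' hz), Complex.cpow_def_of_ne_zero hr',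
      Complex.cpow_def_of_ne_zero hz, Complex.log_ofReal_mul hr hz, ← Complex.exp_add,
      Complex.ofReal_log hr.le, add_mul]

/-- Identifies the scaling of the limit theorem: n independent steps require the space scale
n^{-1/a}. -/
theorem natCast_mul_cpow {a : ℝ} (ha : 0 < a) {n : ℕ} (hn : 0 < n) (z : ℂ) :
    (n : ℂ) * z ^ (a : ℂ) = ((((n : ℝ) ^ (-(1 / a)) : ℝ) : ℂ)⁻¹ * z) ^ (a : ℂ) := by
  have hn' : (0 : ℝ) < n := by exact_mod_cast hn
  rw [← Complex.ofReal_inv, ← Real.rpow_neg hn'.le, neg_neg,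
    Complex.ofReal_mul_cpow (by positivity), ← Complex.ofReal_cpow (by positivity),
    ← Real.rpow_mul hn'.le, one_div_mul_cancel ha.ne', Real.rpow_one, Complex.ofReal_natCast]

/-- `n^{-1/a}` (shifted to avoid `n = 0`). -/
theorem tendsto_rpow_neg_one_div {a : ℝ} (ha : 0 < a) :
    Tendsto (fun n : ℕ => ((n + 2 : ℕ) : ℝ) ^ (-(1 / a))) atTop (𝓝 0) :=
  ((tendsto_rpow_neg_atTop (one_div_pos.2 ha)).comp tendsto_natCast_atTop_atTop).comp
    (tendsto_add_atTop_nat 2)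

theorem tendsto_natCast_mul_cpow {a : ℝ} (ha : 0 < a) (k : ℝ) :
    Tendsto (fun n : ℕ => ((n + 2 : ℕ) : ℂ) *
      (1 - ((1 - (((n + 2 : ℕ) : ℝ) ^ (-(1 / a))) ^ 2 : ℝ) : ℂ) *
        Complex.exp (Complex.I * (((((n + 2 : ℕ) : ℝ) ^ (-(1 / a))) * k : ℝ) : ℂ))) ^ (a : ℂ))
      atTop (𝓝 ((-(Complex.I * k)) ^ (a : ℂ))) := by
  have h := tendsto_scaled_one_sub (tendsto_rpow_neg_one_div ha) (fun n => by positivity) k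
  have hc : ContinuousAt (fun z : ℂ => z ^ (a : ℂ)) (-(Complex.I * k)) := by
    refine (Complex.continuousAt_cpow_const_of_re_pos ?_ (by simpa using ha))
    left; simp
  refine (hc.tendsto.comp h).congr fun n => ?_
  rw [Function.comp, natCast_mul_cpow ha (by omega)]

/-- With ε = (n+2)^{-1/a}, the radius 1-ε² stays inside the disc of convergence, while the error it
causes, of order ε², vanishes after division by ε. The shift by 2 makes ε < 1 also for n = 0. -/
theorem rpow_neg_one_div_sq_mem {a : ℝ} (ha : 0 < a) (n : ℕ) :
    0 < 1 - (((n + 2 : ℕ) : ℝ) ^ (-(1 / a))) ^ 2 ∧ 1 - (((n + 2 : ℕ) : ℝ) ^ (-(1 / a))) ^ 2 < 1 := by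
  have h1 : (0 : ℝ) < ((n + 2 : ℕ) : ℝ) ^ (-(1 / a)) := by positivity
  have h2 : ((n + 2 : ℕ) : ℝ) ^ (-(1 / a)) < 1 :=
    Real.rpow_lt_one_of_one_lt_of_neg (by push_cast; linarith [n.cast_nonneg (α := ℝ)])
      (by simpa using ha)
  constructor <;> nlinarith

theorem tendsto_one_add_pow_exp_shift {g : ℕ → ℂ} {t : ℂ}
    (hg : Tendsto (fun n : ℕ => ((n + 2 : ℕ) : ℂ) * g n) atTop (𝓝 t)) :
    Tendsto (fun n => (1 + g n) ^ (n + 2)) atTop (𝓝 (Complex.exp t)) := by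
  have h : Tendsto (fun n : ℕ => (n : ℂ) * g (n - 2)) atTop (𝓝 t) := by
    refine (tendsto_add_atTop_iff_nat 2).1 ?_
    simpa using hg
  have := (tendsto_add_atTop_iff_nat 2).2 (Complex.tendsto_one_add_pow_exp_of_tendsto h)
  simpa using this

/-- Limits of nonnegative trigonometric polynomials approximating the spectrally one-sided
stable law of index `a`. -/
theorem exists_limPosTrig_stable {a : ℝ} (h0 : 0 < a) (h2 : a < 2) (h1 : a ≠ 1) :
    ∃ p : ℕ → ℝ → ℂ, (∀ n, LimPosTrig (p n)) ∧ ∀ k : ℝ, Tendsto (fun n => p n k) atTop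
      (𝓝 (Complex.exp ((if a < 1 then -1 else 1 / (a : ℂ)) * (-(Complex.I * k)) ^ (a : ℂ)))) := by
  rcases lt_or_gt_of_ne h1 with h1 | h1
  · refine ⟨fun n k => (1 - (1 - ((1 - (((n + 2 : ℕ) : ℝ) ^ (-(1 / a))) ^ 2 : ℝ) : ℂ) *
        Complex.exp (Complex.I * (((((n + 2 : ℕ) : ℝ) ^ (-(1 / a))) * k : ℝ) : ℂ))) ^ (a : ℂ)) ^
        (n + 2), fun n => ?_, fun k => ?_⟩
    · have := rpow_neg_one_div_sq_mem h0 n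
      exact ((limPosTrig_sibuya h0 h1 this.1.le this.2).comp_mul _).pow _
    · simp only [h1, if_true, neg_mul, one_mul]
      simp only [sub_eq_add_neg (1 : ℂ) (_ ^ (a : ℂ))]
      refine tendsto_one_add_pow_exp_shift ?_
      simpa only [mul_neg] using (tendsto_natCast_mul_cpow h0 k).neg
  · refine ⟨fun n k => (1 + (1 - ((1 - (((n + 2 : ℕ) : ℝ) ^ (-(1 / a))) ^ 2 : ℝ) : ℂ) *
        Complex.exp (Complex.I * (((((n + 2 : ℕ) : ℝ) ^ (-(1 / a))) * k : ℝ) : ℂ))) ^ (a : ℂ) *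
        Complex.exp (-(Complex.I * (((((n + 2 : ℕ) : ℝ) ^ (-(1 / a))) * k : ℝ) : ℂ))) /
        (a * ((1 - (((n + 2 : ℕ) : ℝ) ^ (-(1 / a))) ^ 2 : ℝ) : ℂ))) ^ (n + 2),
        fun n => ?_, fun k => ?_⟩
    · have := rpow_neg_one_div_sq_mem h0 n
      exact ((limPosTrig_sibuya' h1 h2 this.1 this.2).comp_mul _).pow _
    · simp only [not_lt.2 h1.le, if_false]
      refine tendsto_one_add_pow_exp_shift ?_
      have he := tendsto_rpow_neg_one_div h0
      have ha : (a : ℂ) ≠ 0 := by exact_mod_cast h0.ne'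
      have hl : ContinuousAt (fun t : ℝ => Complex.exp (-(Complex.I * ((t * k : ℝ) : ℂ))) /
          (a * ((1 - t ^ 2 : ℝ) : ℂ))) 0 := by
        refine ContinuousAt.div (by fun_prop) (by fun_prop) ?_
        simpa using ha
      have := (tendsto_natCast_mul_cpow h0 k).mul (hl.tendsto.comp he)
      simp only [zero_mul, Complex.ofReal_zero, mul_zero, neg_zero, Complex.exp_zero, ne_eq,
        OfNat.ofNat_ne_zero, not_false_eq_true, zero_pow, sub_zero, Complex.ofReal_one,
        mul_one] at this
      rw [mul_comm] at this
      refine this.congr fun n => ?_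
      simp only [Function.comp]
      ring

/-! ### The Feller symbol and the positivity of exp(-ψ) -/

theorem neg_I_mul_cpow {a : ℝ} (ha : 0 < a) (k : ℝ) :
    (-(Complex.I * k)) ^ (a : ℂ) = fellerSymbol a (-a) k := by
  rw [fellerSymbol]
  rcases lt_trichotomy k 0 with h | rfl | h
  · have : (-(Complex.I * k)) = ((-k : ℝ) : ℂ) * Complex.I := by push_cast; ring
    rw [this, Complex.ofReal_mul_cpow (by linarith), ← Complex.ofReal_cpow (by linarith),
      Real.sign_of_neg h, abs_of_neg h, Complex.cpow_def_of_ne_zero Complex.I_ne_zero,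
      Complex.log_I]
    congr 2
    push_cast
    ring
  · simp [ha.ne']
  · have : (-(Complex.I * k)) = ((k : ℝ) : ℂ) * (-Complex.I) := by ring
    rw [this, Complex.ofReal_mul_cpow h, ← Complex.ofReal_cpow h.le,
      Real.sign_of_pos h, abs_of_pos h,
      Complex.cpow_def_of_ne_zero (neg_ne_zero.2 Complex.I_ne_zero), Complex.log_neg_I]
    congr 2
    push_cast
    ring

theorem fellerSymbol_mul {s : ℝ} (hs : 0 < s) (α θ k : ℝ) :
    fellerSymbol α θ (s * k) = ((s ^ α : ℝ) : ℂ) * fellerSymbol α θ k := by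
  have : Real.sign (s * k) = Real.sign k := by
    rcases lt_trichotomy k 0 with h | rfl | h
    · rw [Real.sign_of_neg h, Real.sign_of_neg (mul_neg_of_pos_of_neg hs h)]
    · simp
    · rw [Real.sign_of_pos h, Real.sign_of_pos (mul_pos hs h)]
  rw [fellerSymbol, fellerSymbol, this, abs_mul, Real.mul_rpow (abs_nonneg _) (abs_nonneg _),
    abs_of_pos hs]
  push_cast
  ring

theorem fellerSymbol_neg (α θ k : ℝ) : fellerSymbol α θ (-k) = fellerSymbol α (-θ) k := by
  rw [fellerSymbol, fellerSymbol, abs_neg, Real.sign_neg]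
  ring_nf

theorem fellerSymbol_of_pos {k : ℝ} (hk : 0 < k) (α θ : ℝ) :
    fellerSymbol α θ k =
      ((k ^ α : ℝ) : ℂ) * Complex.exp (Complex.I * ((θ * Real.pi / 2 : ℝ) : ℂ)) := by
  rw [fellerSymbol, abs_of_pos hk, Real.sign_of_pos hk, one_mul]

theorem fellerSymbol_zero {α : ℝ} (hα : α ≠ 0) (θ : ℝ) : fellerSymbol α θ 0 = 0 := by
  simp [fellerSymbol, hα]

/-- Every admissible symbol is a nonnegative combination of the two extremal ones. -/
theorem fellerSymbol_eq_add {α : ℝ} (hα : 0 < α) (θ : ℝ) {a : ℝ} (ha : Real.sin (a * Real.pi) ≠ 0)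
    (k : ℝ) :
    fellerSymbol α θ k =
      ((Real.sin ((a - θ) * Real.pi / 2) / Real.sin (a * Real.pi) : ℝ) : ℂ) *
        fellerSymbol α (-a) k +
      ((Real.sin ((a + θ) * Real.pi / 2) / Real.sin (a * Real.pi) : ℝ) : ℂ) *
        fellerSymbol α a k := by
  have key : ∀ θ : ℝ, Complex.exp (Complex.I * ((θ * Real.pi / 2 : ℝ) : ℂ)) =
      ((Real.sin ((a - θ) * Real.pi / 2) / Real.sin (a * Real.pi) : ℝ) : ℂ) *
        Complex.exp (Complex.I * ((-a * Real.pi / 2 : ℝ) : ℂ)) +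
      ((Real.sin ((a + θ) * Real.pi / 2) / Real.sin (a * Real.pi) : ℝ) : ℂ) *
        Complex.exp (Complex.I * ((a * Real.pi / 2 : ℝ) : ℂ)) := by
    intro θ
    have h1 : (a - θ) * Real.pi / 2 = a * Real.pi / 2 - θ * Real.pi / 2 := by ring
    have h2 : (a + θ) * Real.pi / 2 = a * Real.pi / 2 + θ * Real.pi / 2 := by ring
    have h3 : a * Real.pi = 2 * (a * Real.pi / 2) := by ring
    have h4 : -a * Real.pi / 2 = -(a * Real.pi / 2) := by ring
    have hs : Real.sin (a * Real.pi / 2) ≠ 0 := fun h => by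
      rw [h3, Real.sin_two_mul, h] at ha; simp at ha
    have hc : Real.cos (a * Real.pi / 2) ≠ 0 := fun h => by
      rw [h3, Real.sin_two_mul, h] at ha; simp at ha
    rw [h3, Real.sin_two_mul, h1, h2, h4, Real.sin_sub, Real.sin_add]
    generalize a * Real.pi / 2 = A at *
    generalize θ * Real.pi / 2 = T at *
    simp only [mul_comm Complex.I]
    apply Complex.ext
    · simp only [Complex.exp_ofReal_mul_I_re, Complex.add_re, Complex.re_ofReal_mul, Real.cos_neg]
      field_simp
      ring
    · simp only [Complex.exp_ofReal_mul_I_im, Complex.add_im, Complex.im_ofReal_mul, Real.sin_neg]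
      field_simp
      ring
  rcases lt_trichotomy k 0 with h | rfl | h
  · obtain ⟨m, rfl⟩ : ∃ m, k = -m := ⟨-k, by ring⟩
    have hm : 0 < m := by linarith
    rw [fellerSymbol_neg, fellerSymbol_neg, fellerSymbol_neg, neg_neg,
      fellerSymbol_of_pos hm, fellerSymbol_of_pos hm,
      fellerSymbol_of_pos hm, key (-θ), sub_neg_eq_add, ← sub_eq_add_neg]
    ring
  · simp [fellerSymbol_zero hα.ne']
  · rw [fellerSymbol_of_pos h, fellerSymbol_of_pos h, fellerSymbol_of_pos h, key θ]
    ring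

/-- The factor -1 is a phase shift by ±π, that is, a change of skewness by 2. For α > 1 the binomial
limit is exp of a positive multiple of (-ik)^α, and this is how it acquires the admissible extremal
skewness 2-α. -/
theorem neg_fellerSymbol_neg {α : ℝ} (hα : 0 < α) (k : ℝ) :
    -fellerSymbol α (-α) k = fellerSymbol α (2 - α) k := by
  have key : ∀ s : ℝ, s = 1 ∨ s = -1 →
      -Complex.exp (Complex.I * ((s * -α * Real.pi / 2 : ℝ) : ℂ)) =
      Complex.exp (Complex.I * ((s * (2 - α) * Real.pi / 2 : ℝ) : ℂ)) := by
    rintro s (rfl | rfl)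
    · rw [← Complex.exp_sub_pi_mul_I, ← Complex.exp_periodic]
      congr 1; push_cast; ring
    · rw [← Complex.exp_sub_pi_mul_I]
      congr 1; push_cast; ring
  rcases eq_or_ne k 0 with rfl | hk
  · simp [fellerSymbol_zero hα.ne']
  · rw [fellerSymbol, fellerSymbol, ← mul_neg, key]
    rcases lt_or_gt_of_ne hk with h | h
    · exact .inr (Real.sign_of_neg h)
    · exact .inl (Real.sign_of_pos h)

/-- By homogeneity of the symbol a weight c is a dilation of k: by c^{1/a} if a < 1, and by
(ac)^{1/a} if a > 1, where the factor 1/a of the limit has to be compensated. -/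
theorem exists_limPosTrig_extremal {a : ℝ} (h0 : 0 < a) (h2 : a < 2) (h1 : a ≠ 1) {c : ℝ}
    (hc : 0 ≤ c) :
    ∃ p : ℕ → ℝ → ℂ, (∀ n, LimPosTrig (p n)) ∧ ∀ k : ℝ, Tendsto (fun n => p n k) atTop
      (𝓝 (Complex.exp (-(c * fellerSymbol a (if a < 1 then -a else 2 - a) k)))) := by
  rcases hc.eq_or_lt with rfl | hc
  · refine ⟨fun _ _ => 1, fun _ => ?_, fun k => ?_⟩
    · simpa using LimPosTrig.of_posTrig (PosTrig.const 1 zero_le_one)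
    · simp
  obtain ⟨p, hp, hpl⟩ := exists_limPosTrig_stable h0 h2 h1
  rcases lt_or_gt_of_ne h1 with h1 | h1
  · refine ⟨fun n k => p n (c ^ (1 / a) * k), fun n => (hp n).comp_mul _, fun k => ?_⟩
    have h := hpl (c ^ (1 / a) * k)
    rw [neg_I_mul_cpow h0, fellerSymbol_mul (by positivity), ← Real.rpow_mul hc.le,
      one_div_mul_cancel h0.ne', Real.rpow_one] at h
    simpa [h1] using h
  · refine ⟨fun n k => p n ((a * c) ^ (1 / a) * k), fun n => (hp n).comp_mul _, fun k => ?_⟩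
    have h := hpl ((a * c) ^ (1 / a) * k)
    rw [neg_I_mul_cpow h0, fellerSymbol_mul (by positivity), ← Real.rpow_mul (by positivity),
      one_div_mul_cancel h0.ne', Real.rpow_one] at h
    simp only [not_lt.2 h1.le, if_false] at h ⊢
    rw [← neg_fellerSymbol_neg h0]
    have ha : (a : ℂ) ≠ 0 := by exact_mod_cast h0.ne'
    convert! h using 3
    push_cast
    field_simp

theorem fourierPos_exp_neg_fellerSymbol_of_ne {α θ : ℝ} (h0 : 0 < α) (h2 : α < 2) (h1 : α ≠ 1)
    (hθ : |θ| ≤ min α (2 - α)) (s : ℝ) :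
    FourierPos (fun k => Complex.exp (-fellerSymbol α θ (s * k))) := by
  set a := min α (2 - α) with ha
  have ha0 : 0 < a := lt_min h0 (by linarith)
  have ha1 : a < 1 := by
    rcases lt_or_gt_of_ne h1 with h | h
    · exact (min_le_left _ _).trans_lt h
    · exact (min_le_right _ _).trans_lt (by linarith)
  obtain ⟨hθ1, hθ2⟩ := abs_le.1 hθ
  have hpi := Real.pi_pos
  have hs : 0 < Real.sin (a * Real.pi) :=
    Real.sin_pos_of_pos_of_lt_pi (by positivity) (by nlinarith)
  -- Admissibility |θ| ≤ a puts both angles (a ∓ θ)π/2 in [0, aπ], inside [0, π].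
  have hc1 : 0 ≤ Real.sin ((a - θ) * Real.pi / 2) / Real.sin (a * Real.pi) :=
    div_nonneg (Real.sin_nonneg_of_nonneg_of_le_pi
      (by have := mul_nonneg (sub_nonneg.2 hθ2) hpi.le; linarith) (by nlinarith)) hs.le
  have hc2 : 0 ≤ Real.sin ((a + θ) * Real.pi / 2) / Real.sin (a * Real.pi) :=
    div_nonneg (Real.sin_nonneg_of_nonneg_of_le_pi
      (by have := mul_nonneg (by linarith : 0 ≤ a + θ) hpi.le; linarith) (by nlinarith)) hs.le
  set c1 := Real.sin ((a - θ) * Real.pi / 2) / Real.sin (a * Real.pi)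
  set c2 := Real.sin ((a + θ) * Real.pi / 2) / Real.sin (a * Real.pi)
  have hdec : ∀ k, fellerSymbol α θ k = c1 * fellerSymbol α (-a) k + c2 * fellerSymbol α a k :=
    fellerSymbol_eq_add h0 θ hs.ne'
  rcases lt_or_gt_of_ne h1 with h | h
  · have haα : a = α := min_eq_left (by linarith)
    obtain ⟨p, hp, hpl⟩ := exists_limPosTrig_extremal h0 h2 h1 hc1
    obtain ⟨q, hq, hql⟩ := exists_limPosTrig_extremal h0 h2 h1 hc2
    simp only [h, if_true] at hpl hql
    refine FourierPos.of_tendsto_limPosTrig (p := fun n k => p n (s * k) * q n (-s * k))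
      (Eventually.of_forall fun n => ((hp n).comp_mul _).mul ((hq n).comp_mul _)) fun k => ?_
    have h3 := (hpl (s * k)).mul (hql (-s * k))
    rw [← Complex.exp_add, neg_mul, fellerSymbol_neg, neg_neg, ← neg_add] at h3
    rw [hdec, haα]
    simpa only [neg_mul] using h3
  · have haα : a = 2 - α := min_eq_right (by linarith)
    -- For α > 1 the unreflected approximant has skewness 2-α = a instead of -a, so the two weights
    -- exchange roles.
    obtain ⟨p, hp, hpl⟩ := exists_limPosTrig_extremal h0 h2 h1 hc2
    obtain ⟨q, hq, hql⟩ := exists_limPosTrig_extremal h0 h2 h1 hc1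
    simp only [not_lt.2 h.le, if_false] at hpl hql
    refine FourierPos.of_tendsto_limPosTrig (p := fun n k => p n (s * k) * q n (-s * k))
      (Eventually.of_forall fun n => ((hp n).comp_mul _).mul ((hq n).comp_mul _)) fun k => ?_
    have h3 := (hpl (s * k)).mul (hql (-s * k))
    rw [← Complex.exp_add, neg_mul, fellerSymbol_neg, ← neg_add, add_comm] at h3
    rw [hdec, haα]
    simpa only [neg_mul] using h3

theorem continuous_fellerSymbol {α : ℝ} (hα : 0 < α) (θ : ℝ) : Continuous (fellerSymbol α θ) := by
  rw [continuous_iff_continuousAt]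
  intro k
  have h1 : Continuous fun k : ℝ => ((|k| ^ α : ℝ) : ℂ) :=
    Complex.continuous_ofReal.comp (continuous_abs.rpow_const fun _ => .inr hα.le)
  rcases eq_or_ne k 0 with rfl | hk
  · have hb : ∀ k, ‖fellerSymbol α θ k‖ = |k| ^ α := by
      intro k
      rw [fellerSymbol, norm_mul, mul_comm Complex.I, Complex.norm_exp_ofReal_mul_I, mul_one,
        Complex.norm_real, Real.norm_of_nonneg (by positivity)]
    rw [ContinuousAt, fellerSymbol_zero hα.ne', tendsto_zero_iff_norm_tendsto_zero]
    simp only [hb]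
    have : Continuous fun k : ℝ => |k| ^ α := continuous_abs.rpow_const fun _ => .inr hα.le
    simpa [hα.ne'] using this.tendsto 0
  · rcases lt_or_gt_of_ne hk with h | h
    · have : fellerSymbol α θ =ᶠ[𝓝 k] fun k => ((|k| ^ α : ℝ) : ℂ) *
          Complex.exp (Complex.I * ((-1 * θ * Real.pi / 2 : ℝ) : ℂ)) := by
        filter_upwards [gt_mem_nhds h] with x hx
        rw [fellerSymbol, Real.sign_of_neg hx]
      exact (h1.mul continuous_const).continuousAt.congr this.symm
    · have : fellerSymbol α θ =ᶠ[𝓝 k] fun k => ((|k| ^ α : ℝ) : ℂ) *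
          Complex.exp (Complex.I * ((1 * θ * Real.pi / 2 : ℝ) : ℂ)) := by
        filter_upwards [lt_mem_nhds h] with x hx
        rw [fellerSymbol, Real.sign_of_pos hx]
      exact (h1.mul continuous_const).continuousAt.congr this.symm

theorem re_fellerSymbol {α : ℝ} (hα : α ≠ 0) (θ k : ℝ) :
    (fellerSymbol α θ k).re = |k| ^ α * Real.cos (θ * Real.pi / 2) := by
  rcases lt_trichotomy k 0 with h | rfl | h
  · rw [fellerSymbol, Real.sign_of_neg h, mul_comm Complex.I, Complex.re_ofReal_mul,
      Complex.exp_ofReal_mul_I_re, ← Real.cos_neg]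
    ring_nf
  · simp [fellerSymbol_zero hα, hα]
  · rw [fellerSymbol, Real.sign_of_pos h, mul_comm Complex.I, Complex.re_ofReal_mul,
      Complex.exp_ofReal_mul_I_re, one_mul]

theorem abs_le_one_of_admissible {α θ : ℝ} (hθ : |θ| ≤ min α (2 - α)) : |θ| ≤ 1 := by
  have h1 := hθ.trans (min_le_left _ _)
  have h2 := hθ.trans (min_le_right _ _)
  linarith

theorem cos_nonneg_of_abs_le_one {θ : ℝ} (hθ : |θ| ≤ 1) : 0 ≤ Real.cos (θ * Real.pi / 2) := by
  obtain ⟨h1, h2⟩ := abs_le.1 hθ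
  have := Real.pi_pos
  exact Real.cos_nonneg_of_mem_Icc ⟨by nlinarith, by nlinarith⟩

theorem cos_pos_of_abs_lt_one {θ : ℝ} (hθ : |θ| < 1) : 0 < Real.cos (θ * Real.pi / 2) := by
  obtain ⟨h1, h2⟩ := abs_lt.1 hθ
  have := Real.pi_pos
  exact Real.cos_pos_of_mem_Ioo ⟨by nlinarith, by nlinarith⟩

theorem re_fellerSymbol_nonneg {α θ : ℝ} (hα : 0 < α) (hθ : |θ| ≤ 1) (k : ℝ) :
    0 ≤ (fellerSymbol α θ k).re := by
  rw [re_fellerSymbol hα.ne']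
  exact mul_nonneg (by positivity) (cos_nonneg_of_abs_le_one hθ)

theorem norm_exp_neg_fellerSymbol_le_one {α θ : ℝ} (hα : 0 < α) (hθ : |θ| ≤ 1) (k : ℝ) :
    ‖Complex.exp (-fellerSymbol α θ k)‖ ≤ 1 := by
  rw [Complex.norm_exp, Real.exp_le_one_iff, Complex.neg_re]
  linarith [re_fellerSymbol_nonneg hα hθ k]

theorem integrable_exp_neg_mul_abs_rpow {α b : ℝ} (hα : 0 < α) (hb : 0 < b) :
    Integrable (fun k : ℝ => Real.exp (-b * |k| ^ α)) := by
  have h : IntegrableOn (fun k : ℝ => Real.exp (-b * |k| ^ α)) (Ioi 0) := by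
    refine (integrableOn_rpow_mul_exp_neg_mul_rpow (s := 0) (by norm_num) hα hb).congr_fun
      (fun x hx => ?_) measurableSet_Ioi
    simp [abs_of_pos (mem_Ioi.1 hx)]
  rw [← integrableOn_univ, ← Iic_union_Ioi (a := (0 : ℝ)), integrableOn_union]
  refine ⟨?_, h⟩
  rw [integrableOn_Iic_iff_integrableOn_Iio]
  have := h.comp_neg
  simpa using this

theorem integrable_exp_neg_fellerSymbol {α θ : ℝ} (hα : 0 < α) (hθ : |θ| < 1) :
    Integrable (fun k : ℝ => Complex.exp (-fellerSymbol α θ k)) := by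
  refine (integrable_exp_neg_mul_abs_rpow hα (cos_pos_of_abs_lt_one hθ)).mono'
    (Complex.continuous_exp.comp (continuous_fellerSymbol hα θ).neg).aestronglyMeasurable
    (Eventually.of_forall fun k => ?_)
  rw [Complex.norm_exp, Complex.neg_re, re_fellerSymbol hα.ne']
  refine le_of_eq ?_
  ring_nf

theorem tendsto_fellerSymbol {α θ : ℝ} (hα : 0 < α) (k : ℝ) {a : ℕ → ℝ}
    (ha : Tendsto a atTop (𝓝 α)) :
    Tendsto (fun n => fellerSymbol (a n) θ k) atTop (𝓝 (fellerSymbol α θ k)) := by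
  refine Tendsto.mul_const _ ((Complex.continuous_ofReal.tendsto _).comp ?_)
  exact (Real.continuousAt_const_rpow' hα.ne').tendsto.comp ha

/-- The remaining orders α = 1 and α = 2 are approached from below with θ fixed. At α = 1 the
condition |θ| < 1 keeps θ admissible for the nearby orders; at α = 2 admissibility gives θ = 0. -/
theorem fourierPos_exp_neg_fellerSymbol {α θ : ℝ} (h0 : 0 < α) (h2 : α ≤ 2)
    (hθ : |θ| ≤ min α (2 - α)) (hθ1 : |θ| < 1) (s : ℝ) :
    FourierPos (fun k => Complex.exp (-fellerSymbol α θ (s * k))) := by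
  by_cases h : α < 2 ∧ α ≠ 1
  · exact fourierPos_exp_neg_fellerSymbol_of_ne h0 h.1 h.2 hθ s
  have hl : Tendsto (fun n : ℕ => α - 1 / ((n : ℝ) + 1)) atTop (𝓝 α) := by
    simpa using tendsto_one_div_add_atTop_nhds_zero_nat.const_sub α
  have hpos : ∀ᶠ n : ℕ in atTop, 0 < α - 1 / ((n : ℝ) + 1) := hl.eventually (lt_mem_nhds h0)
  have hlt : ∀ n : ℕ, 0 < 1 / ((n : ℝ) + 1) := fun n => by positivity
  -- The value 0 is a filler for the first few n, where the approximating order may fail to be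
  -- positive.
  refine FourierPos.of_tendsto (C := 1)
    (p := fun n k => if 0 < α - 1 / ((n : ℝ) + 1) then
      Complex.exp (-fellerSymbol (α - 1 / ((n : ℝ) + 1)) θ (s * k)) else 0) ?_ ?_ ?_ ?_
  · have h' : ∀ᶠ n : ℕ in atTop, α - 1 / ((n : ℝ) + 1) ≠ 1 ∧
        |θ| ≤ min (α - 1 / ((n : ℝ) + 1)) (2 - (α - 1 / ((n : ℝ) + 1))) := by
      rcases eq_or_ne α 1 with rfl | hne
      · filter_upwards [hl.eventually (lt_mem_nhds hθ1)] with n hn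
        have := hlt n
        refine ⟨by linarith, le_min hn.le (by linarith)⟩
      · have h22 : α = 2 := by
          by_contra hcon
          exact h ⟨lt_of_le_of_ne h2 hcon, hne⟩
        subst h22
        have hθ0 : |θ| = 0 := le_antisymm (by simpa using hθ) (abs_nonneg _)
        filter_upwards [hl.eventually (lt_mem_nhds one_lt_two)] with n hn
        have := hlt n
        rw [hθ0]
        exact ⟨hn.ne', le_min (by linarith) (by linarith)⟩
    filter_upwards [hpos, h'] with n hn hn'
    simp only [hn, if_true]
    exact fourierPos_exp_neg_fellerSymbol_of_ne hn (by linarith [hlt n]) hn'.1 hn'.2 s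
  · intro n
    split_ifs with hn
    · have := continuous_fellerSymbol hn θ
      exact (Complex.continuous_exp.comp (this.comp (continuous_const_mul s)).neg).measurable
    · exact measurable_const
  · refine Eventually.of_forall fun n k => ?_
    split_ifs with hn
    · exact norm_exp_neg_fellerSymbol_le_one hn hθ1.le _
    · simp
  · intro k
    refine ((Complex.continuous_exp.tendsto _).comp
      (tendsto_fellerSymbol h0 (s * k) hl).neg).congr' ?_
    filter_upwards [hpos] with n hn
    simp only [hn, if_true, Function.comp]

/-! ### The stable density and Fourier inversion -/

section StableDensity

variable {α θ : ℝ}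

theorem fourier_exp_neg_fellerSymbol (α θ x : ℝ) :
    𝓕 (fun v : ℝ => Complex.exp (-fellerSymbol α θ (2 * Real.pi * v))) x =
      (1 / (2 * Real.pi) : ℝ) * ∫ κ : ℝ, Complex.exp (-(Complex.I * (κ : ℂ) * (x : ℂ))) *
        Complex.exp (-fellerSymbol α θ κ) := by
  rw [Real.fourier_real_eq_integral_exp_smul]
  have := Measure.integral_comp_mul_left (fun κ : ℝ => Complex.exp (-(Complex.I * (κ : ℂ) *
    (x : ℂ))) * Complex.exp (-fellerSymbol α θ κ)) (2 * Real.pi)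
  rw [abs_of_pos (by positivity), Complex.real_smul, ← one_div] at this
  rw [← this]
  congr 1
  ext v
  rw [smul_eq_mul]
  congr 2
  push_cast
  ring

/-- Nonnegativity in the order of ℂ includes being real, so taking the real part in `stableDensity`
loses nothing. -/
theorem ofReal_stableDensity (h0 : 0 < α) (h2 : α ≤ 2) (hθ : |θ| ≤ min α (2 - α)) (hθ1 : |θ| < 1)
    (x : ℝ) : (stableDensity α θ x : ℂ) =
      𝓕 (fun v : ℝ => Complex.exp (-fellerSymbol α θ (2 * Real.pi * v))) x := by
  have hpos := (fourierPos_exp_neg_fellerSymbol h0 h2 hθ hθ1 (2 * Real.pi)).fourier_nonneg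
    ((integrable_exp_neg_fellerSymbol h0 hθ1).comp_mul_left' (by positivity)) x
  have him := (Complex.nonneg_iff.1 hpos).2
  have hre : stableDensity α θ x =
      (𝓕 (fun v : ℝ => Complex.exp (-fellerSymbol α θ (2 * Real.pi * v))) x).re := by
    rw [fourier_exp_neg_fellerSymbol, Complex.re_ofReal_mul, stableDensity]
  apply Complex.ext
  · simpa using hre
  · simpa using him

theorem stableDensity_nonneg (h0 : 0 < α) (h2 : α ≤ 2) (hθ : |θ| ≤ min α (2 - α)) (hθ1 : |θ| < 1)
    (x : ℝ) : 0 ≤ stableDensity α θ x := by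
  have hpos := (fourierPos_exp_neg_fellerSymbol h0 h2 hθ hθ1 (2 * Real.pi)).fourier_nonneg
    ((integrable_exp_neg_fellerSymbol h0 hθ1).comp_mul_left' (by positivity)) x
  rw [← ofReal_stableDensity h0 h2 hθ hθ1] at hpos
  exact Complex.zero_le_real.1 hpos

theorem continuous_stableDensity (h0 : 0 < α) (h2 : α ≤ 2) (hθ : |θ| ≤ min α (2 - α))
    (hθ1 : |θ| < 1) : Continuous (stableDensity α θ) := by
  have hcont : Continuous
      (𝓕 (fun v : ℝ => Complex.exp (-fellerSymbol α θ (2 * Real.pi * v)))) :=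
    VectorFourier.fourierIntegral_continuous (L := innerₗ ℝ) Real.continuous_fourierChar
      continuous_inner ((integrable_exp_neg_fellerSymbol h0 hθ1).comp_mul_left' (by positivity))
  refine (Complex.continuous_re.comp hcont).congr fun x => ?_
  rw [Function.comp, ← ofReal_stableDensity h0 h2 hθ hθ1, Complex.ofReal_re]

theorem integrable_stableDensity (h0 : 0 < α) (h2 : α ≤ 2) (hθ : |θ| ≤ min α (2 - α))
    (hθ1 : |θ| < 1) : Integrable (stableDensity α θ) := by
  have h := ((fourierPos_exp_neg_fellerSymbol h0 h2 hθ hθ1 (2 * Real.pi)).integrable_fourier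
    ((integrable_exp_neg_fellerSymbol h0 hθ1).comp_mul_left' (by positivity))
    fun v => norm_exp_neg_fellerSymbol_le_one h0 hθ1.le _).re
  refine h.congr (Eventually.of_forall fun x => ?_)
  simp only [← ofReal_stableDensity h0 h2 hθ hθ1]
  simp

theorem integral_exp_mul_stableDensity (h0 : 0 < α) (h2 : α ≤ 2) (hθ : |θ| ≤ min α (2 - α))
    (hθ1 : |θ| < 1) (κ : ℝ) :
    ∫ x : ℝ, Complex.exp (Complex.I * κ * x) * (stableDensity α θ x : ℂ) =
      Complex.exp (-fellerSymbol α θ κ) := by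
  have hi : Integrable (fun v : ℝ => Complex.exp (-fellerSymbol α θ (2 * Real.pi * v))) :=
    (integrable_exp_neg_fellerSymbol h0 hθ1).comp_mul_left' (by positivity)
  have hc : Continuous (fun v : ℝ => Complex.exp (-fellerSymbol α θ (2 * Real.pi * v))) :=
    Complex.continuous_exp.comp
      ((continuous_fellerSymbol h0 θ).comp (continuous_const_mul _)).neg
  have hF := (fourierPos_exp_neg_fellerSymbol h0 h2 hθ hθ1 (2 * Real.pi)).integrable_fourier hi
    fun v => norm_exp_neg_fellerSymbol_le_one h0 hθ1.le _
  have h := congrFun (hc.fourierInv_fourier_eq hi hF) (κ / (2 * Real.pi))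
  rw [Real.fourierInv_eq'] at h
  have h2pi : 2 * Real.pi * (κ / (2 * Real.pi)) = κ := by field_simp
  rw [h2pi] at h
  rw [← h]
  congr 1
  ext x
  rw [← ofReal_stableDensity h0 h2 hθ hθ1, smul_eq_mul]
  congr 2
  simp only [RCLike.inner_apply, conj_trivial]
  push_cast
  field_simp

end StableDensity

/-! ### Laplace transforms in the right half-plane -/

theorem aestronglyMeasurable_of_exp_mul {f : ℝ → ℂ}
    (hf : ∀ s : ℝ, 0 < s → IntegrableOn (fun t : ℝ => Real.exp (-(s * t)) * f t) (Ioi 0)) :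
    AEStronglyMeasurable f (volume.restrict (Ioi 0)) := by
  have h := (hf 1 one_pos).1
  have h2 : Continuous fun t : ℝ => ((Real.exp t : ℝ) : ℂ) := by fun_prop
  refine (h2.aestronglyMeasurable.mul h).congr (Eventually.of_forall fun t => ?_)
  simp only [Pi.mul_apply, one_mul]
  rw [← mul_assoc, ← Complex.ofReal_mul, ← Real.exp_add]
  simp

theorem norm_exp_neg_mul (z : ℂ) (t : ℝ) : ‖Complex.exp (-(z * t))‖ = Real.exp (-(z.re * t)) := by
  rw [Complex.norm_exp, Complex.neg_re, Complex.re_mul_ofReal]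

/-- Differentiation under the integral. Near z the decay is at least exp(-t Re z/2); half of it
absorbs the factor t, at the price 4/Re z, and the other half keeps `f` integrable. -/
theorem differentiableOn_laplace {f : ℝ → ℂ}
    (hf : ∀ s : ℝ, 0 < s → IntegrableOn (fun t : ℝ => Real.exp (-(s * t)) * f t) (Ioi 0)) :
    DifferentiableOn ℂ (fun z : ℂ => ∫ t : ℝ in Ioi 0, Complex.exp (-(z * t)) * f t)
      {z | 0 < z.re} := by
  have hm := aestronglyMeasurable_of_exp_mul hf
  intro z hz
  have hz' : 0 < z.re := hz
  refine DifferentiableAt.differentiableWithinAt ?_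
  have hcont : ∀ w : ℂ, Continuous fun t : ℝ => Complex.exp (-(w * t)) := fun w => by fun_prop
  have hball : Metric.ball z (z.re / 2) ∈ 𝓝 z := Metric.ball_mem_nhds _ (by positivity)
  refine (hasDerivAt_integral_of_dominated_loc_of_deriv_le (μ := volume.restrict (Ioi (0 : ℝ)))
    (F := fun (w : ℂ) (t : ℝ) => Complex.exp (-(w * t)) * f t)
    (F' := fun (w : ℂ) (t : ℝ) => -(t : ℂ) * (Complex.exp (-(w * t)) * f t))
    (bound := fun t => (4 / z.re) * ‖(Real.exp (-(z.re / 4 * t)) : ℂ) * f t‖)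
    hball ?_ ?_ ?_ ?_ ?_ ?_).2.differentiableAt
  · exact Eventually.of_forall fun w => (hcont w).aestronglyMeasurable.mul hm
  · refine ((hf z.re hz').norm).mono' ((hcont z).aestronglyMeasurable.mul hm) ?_
    refine Eventually.of_forall fun t => ?_
    rw [norm_mul, norm_mul, norm_exp_neg_mul, Complex.norm_real,
      Real.norm_of_nonneg (Real.exp_pos _).le]
  · exact (Complex.continuous_ofReal.neg.aestronglyMeasurable).mul
      ((hcont z).aestronglyMeasurable.mul hm)
  · refine (ae_restrict_mem measurableSet_Ioi).mono fun t ht w hw => ?_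
    have ht : 0 < t := ht
    have hwre : z.re / 2 ≤ w.re := by
      have h1 := (Complex.abs_re_le_norm (w - z)).trans (mem_ball_iff_norm.1 hw).le
      have h2 := (abs_le.1 h1).1
      rw [Complex.sub_re] at h2
      linarith
    rw [norm_mul, norm_mul, norm_neg, Complex.norm_real, norm_exp_neg_mul,
      Real.norm_of_nonneg ht.le, norm_mul, Complex.norm_real,
      Real.norm_of_nonneg (Real.exp_pos _).le, ← mul_assoc, ← mul_assoc]
    refine mul_le_mul_of_nonneg_right ?_ (norm_nonneg _)
    have h3 : Real.exp (-(w.re * t)) ≤ Real.exp (-(z.re / 4 * t)) * Real.exp (-(z.re / 4 * t)) := by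
      rw [← Real.exp_add, Real.exp_le_exp]
      nlinarith
    have h4 : t * Real.exp (-(z.re / 4 * t)) ≤ 4 / z.re := by
      have h5 := Real.add_one_le_exp (z.re / 4 * t)
      rw [Real.exp_neg, ← div_eq_mul_inv, div_le_div_iff₀ (Real.exp_pos _) hz']
      linarith
    calc t * Real.exp (-(w.re * t))
        ≤ t * (Real.exp (-(z.re / 4 * t)) * Real.exp (-(z.re / 4 * t))) := by gcongr
      _ = t * Real.exp (-(z.re / 4 * t)) * Real.exp (-(z.re / 4 * t)) := by ring
      _ ≤ _ := by gcongr
  · exact ((hf _ (by positivity)).norm).const_mul _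
  · refine Eventually.of_forall fun t w _ => ?_
    have h1 : HasDerivAt (fun w : ℂ => -(w * (t : ℂ))) (-(t : ℂ)) w := by
      simpa using ((hasDerivAt_id w).mul_const (t : ℂ)).fun_neg
    have h2 := h1.cexp.mul_const (f t)
    convert! h2 using 1
    ring

theorem eqOn_re_pos_of_eq_ofReal {f g : ℂ → ℂ} (hf : DifferentiableOn ℂ f {z | 0 < z.re})
    (hg : DifferentiableOn ℂ g {z | 0 < z.re}) (h : ∀ s : ℝ, 0 < s → f s = g s) :
    EqOn f g {z | 0 < z.re} := by
  have hopen : IsOpen {z : ℂ | 0 < z.re} := isOpen_lt continuous_const Complex.continuous_re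
  have hconn : IsPreconnected {z : ℂ | 0 < z.re} := (convex_halfSpace_re_gt 0).isPreconnected
  refine (hf.analyticOnNhd hopen).eqOn_of_preconnected_of_frequently_eq (hg.analyticOnNhd hopen)
    hconn (z₀ := 1) (by simp) ?_
  have ht : Tendsto (fun s : ℝ => (s : ℂ)) (𝓝[≠] 1) (𝓝[≠] (1 : ℂ)) := by
    refine tendsto_nhdsWithin_iff.2 ⟨?_, ?_⟩
    · have := Complex.continuous_ofReal.tendsto 1
      rw [Complex.ofReal_one] at this
      exact this.mono_left nhdsWithin_le_nhds
    · filter_upwards [self_mem_nhdsWithin] with s hs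
      simpa using hs
  refine ht.frequently (Eventually.frequently ?_)
  exact (eventually_nhdsWithin_of_eventually_nhds (lt_mem_nhds one_pos)).mono fun s hs => h s hs

theorem integrableOn_rpow_mul_exp_neg_mul {a s : ℝ} (ha : 0 < a) (hs : 0 < s) :
    IntegrableOn (fun t : ℝ => t ^ (a - 1) * Real.exp (-(s * t))) (Ioi 0) := by
  refine (integrableOn_rpow_mul_exp_neg_mul_rpow (s := a - 1) (p := 1) (b := s) (by linarith)
    one_pos hs).congr_fun (fun x _ => ?_) measurableSet_Ioi
  simp

theorem integral_rpow_mul_cexp_neg_mul_Ioi {a : ℝ} (ha : 0 < a) {z : ℂ} (hz : 0 < z.re) :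
    ∫ t : ℝ in Ioi 0, Complex.exp (-(z * t)) * ((t ^ (a - 1) : ℝ) : ℂ) =
      (Real.Gamma a : ℂ) * z ^ (-(a : ℂ)) := by
  refine eqOn_re_pos_of_eq_ofReal (f := fun z : ℂ => ∫ t : ℝ in Ioi 0,
    Complex.exp (-(z * t)) * ((t ^ (a - 1) : ℝ) : ℂ))
    (g := fun z => (Real.Gamma a : ℂ) * z ^ (-(a : ℂ)))
    (differentiableOn_laplace fun s hs => ?_) ?_ (fun s hs => ?_) hz
  · refine (integrableOn_rpow_mul_exp_neg_mul ha hs).ofReal.congr (Eventually.of_forall fun t => ?_)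
    change ((t ^ (a - 1) * Real.exp (-(s * t)) : ℝ) : ℂ) = _
    push_cast
    ring
  · intro w hw
    have hw' : 0 < w.re := hw
    exact (((hasStrictDerivAt_id w).cpow_const (.inl hw')).hasDerivAt.differentiableAt.const_mul
      _).differentiableWithinAt
  · have h := Real.integral_rpow_mul_exp_neg_mul_Ioi ha hs
    have h2 : ∫ t : ℝ in Ioi 0, Complex.exp (-((s : ℂ) * t)) * ((t ^ (a - 1) : ℝ) : ℂ) =
        ((∫ t : ℝ in Ioi 0, t ^ (a - 1) * Real.exp (-(s * t)) : ℝ) : ℂ) := by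
      rw [← integral_complex_ofReal]
      congr 1
      ext t
      push_cast
      ring
    rw [h2, h, one_div, Real.inv_rpow hs.le, ← Real.rpow_neg hs.le, ← Complex.ofReal_neg,
      ← Complex.ofReal_cpow hs.le]
    push_cast
    ring

/-- Log-convexity of Γ between 1 and n+1, as νn+1 = ν(n+1) + (1-ν)·1. -/
theorem Gamma_mul_add_one_le {ν : ℝ} (h0 : 0 < ν) (h1 : ν < 1) (n : ℕ) :
    Real.Gamma (ν * n + 1) ≤ (n.factorial : ℝ) ^ ν := by
  have h := Real.Gamma_mul_add_mul_le_rpow_Gamma_mul_rpow_Gamma (s := n + 1) (t := 1) (a := ν)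
    (b := 1 - ν) (by positivity) one_pos h0 (by linarith) (by ring)
  rw [Real.Gamma_nat_eq_factorial, Real.Gamma_one, Real.one_rpow] at h
  simp only [mul_one] at h
  rwa [show ν * n + 1 = ν * (n + 1) + (1 - ν) * 1 by ring, mul_one (1 - ν)]

theorem summable_pow_mul_Gamma_div_factorial {ν : ℝ} (h0 : 0 < ν) (h1 : ν < 1) (R : ℝ)
    (hR : 0 ≤ R) : Summable fun n : ℕ => R ^ n * Real.Gamma (ν * n + 1) / n.factorial := by
  have h1' : 0 < 1 - ν := by linarith
  -- Chosen so that R^n/(n!)^{1-ν} = (Q^n/n!)^{1-ν} · 2^{-n}: a bounded factor times a geometric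
  -- one.
  set Q := (2 * R) ^ (1 / (1 - ν)) with hQ
  have hQ0 : 0 ≤ Q := by positivity
  obtain ⟨C, hC⟩ := (FloorSemiring.tendsto_pow_div_factorial_atTop Q).bddAbove_range
  refine Summable.of_nonneg_of_le (fun n => by positivity) (fun n => ?_)
    ((summable_geometric_two).mul_left (C ^ (1 - ν)))
  have hf : (0 : ℝ) < n.factorial := by positivity
  have hCn : Q ^ n / n.factorial ≤ C := hC ⟨n, rfl⟩
  have hQn : (Q ^ n) ^ (1 - ν) = (2 * R) ^ n := by
    rw [← Real.rpow_natCast, ← Real.rpow_mul hQ0, hQ, ← Real.rpow_mul (by positivity),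
      ← Real.rpow_natCast]
    congr 1
    field_simp
  calc R ^ n * Real.Gamma (ν * n + 1) / n.factorial
      ≤ R ^ n * (n.factorial : ℝ) ^ ν / n.factorial := by
        gcongr
        exact Gamma_mul_add_one_le h0 h1 n
    _ = (Q ^ n / n.factorial) ^ (1 - ν) * (1 / 2) ^ n := by
        rw [Real.div_rpow (by positivity) hf.le, hQn, Real.rpow_sub hf, Real.rpow_one, mul_pow,
          one_div, inv_pow]
        field_simp
    _ ≤ C ^ (1 - ν) * (1 / 2) ^ n := by gcongr

/-! ### Series and decay of the stable density -/

/-- The Laplace transform of `exp (-c κ^α)`. -/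
noncomputable def stretchedLaplace (α : ℝ) (c z : ℂ) : ℂ :=
  ∫ κ : ℝ in Ioi 0, Complex.exp (-(z * κ)) * Complex.exp (-(c * ((κ ^ α : ℝ) : ℂ)))

theorem hasSum_stretchedLaplace_of_re_pos {α : ℝ} (h0 : 0 < α) (h1 : α < 1) (c : ℂ) {z : ℂ}
    (hz : 0 < z.re) :
    HasSum (fun n : ℕ => (-c) ^ n / n.factorial *
      ((Real.Gamma (α * n + 1) : ℂ) * z ^ (-((α * n + 1 : ℝ) : ℂ)))) (stretchedLaplace α c z) := by
  have hpow : ∀ (n : ℕ) {t : ℝ}, 0 < t → (t ^ α) ^ n = t ^ (α * n + 1 - 1) := fun n t ht => by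
    rw [add_sub_cancel_right, Real.rpow_mul ht.le, Real.rpow_natCast]
  set F : ℕ → ℝ → ℂ := fun n t => (-c) ^ n / n.factorial *
    (Complex.exp (-(z * t)) * ((t ^ (α * n + 1 - 1) : ℝ) : ℂ)) with hF
  have hpos : ∀ n : ℕ, 0 < α * n + 1 := fun n => by positivity
  have hnorm : ∀ (n : ℕ) {t : ℝ}, 0 < t → ‖F n t‖ = ‖c‖ ^ n / n.factorial *
      (t ^ (α * n + 1 - 1) * Real.exp (-(z.re * t))) := by
    intro n t ht
    rw [hF]
    simp only [norm_mul, norm_div, norm_pow, norm_neg, norm_exp_neg_mul, Complex.norm_natCast,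
      Complex.norm_real]
    rw [Real.norm_of_nonneg (by positivity)]
    ring
  have hint : ∀ n, IntegrableOn (F n) (Ioi 0) := by
    intro n
    refine Integrable.mono' ((integrableOn_rpow_mul_exp_neg_mul (hpos n) hz).const_mul
      (‖c‖ ^ n / n.factorial)) ?_ ((ae_restrict_mem measurableSet_Ioi).mono fun t ht =>
        (hnorm n ht).le)
    exact Measurable.aestronglyMeasurable (by fun_prop)
  have hsumn : Summable fun n => ∫ t in Ioi 0, ‖F n t‖ := by
    have : ∀ n : ℕ, ∫ t in Ioi 0, ‖F n t‖ = (‖c‖ * (1 / z.re) ^ α) ^ n *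
        Real.Gamma (α * n + 1) / n.factorial * (1 / z.re) := by
      intro n
      rw [setIntegral_congr_fun measurableSet_Ioi fun t ht => hnorm n ht, integral_const_mul,
        Real.integral_rpow_mul_exp_neg_mul_Ioi (hpos n) hz, Real.rpow_add (by positivity),
        Real.rpow_mul (by positivity), Real.rpow_natCast, Real.rpow_one, mul_pow]
      ring
    simp only [this]
    exact (summable_pow_mul_Gamma_div_factorial h0 h1 _ (by positivity)).mul_right _
  have h := hasSum_integral_of_summable_integral_norm hint hsumn
  convert! h using 1
  · ext n
    rw [hF, integral_const_mul, integral_rpow_mul_cexp_neg_mul_Ioi (hpos n) hz]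
  · refine setIntegral_congr_fun measurableSet_Ioi fun t ht => ?_
    have ht : 0 < t := ht
    have he : Complex.exp (-(c * ((t ^ α : ℝ) : ℂ))) =
        ∑' n : ℕ, (-c * ((t ^ α : ℝ) : ℂ)) ^ n / n.factorial := by
      rw [← neg_mul, Complex.exp_eq_exp_ℂ, NormedSpace.exp_eq_tsum_div]
    rw [he, ← tsum_mul_left]
    congr 1
    ext n
    rw [hF, mul_pow, ← Complex.ofReal_pow, hpow n ht]
    ring

/-- The imaginary axis, where the stable density lives, is reached by z + 1/(n+1) → z. The integral
is dominated thanks to Re c > 0, and the series because this shift does not decrease |z|. -/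
theorem hasSum_stretchedLaplace {α : ℝ} (h0 : 0 < α) (h1 : α < 1) {c : ℂ} (hc : 0 < c.re) {z : ℂ}
    (hz : 0 ≤ z.re) (hz0 : z ≠ 0) :
    HasSum (fun n : ℕ => (-c) ^ n / n.factorial *
      ((Real.Gamma (α * n + 1) : ℂ) * z ^ (-((α * n + 1 : ℝ) : ℂ)))) (stretchedLaplace α c z) := by
  have he : Tendsto (fun n : ℕ => z + ((1 / ((n : ℝ) + 1) : ℝ) : ℂ)) atTop (𝓝 z) := by
    have := ((Complex.continuous_ofReal.tendsto _).comp
      tendsto_one_div_add_atTop_nhds_zero_nat).const_add z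
    simpa using this
  have hrepos : ∀ n : ℕ, 0 < (z + ((1 / ((n : ℝ) + 1) : ℝ) : ℂ)).re := by
    intro n
    rw [Complex.add_re, Complex.ofReal_re]
    positivity
  have hnormle : ∀ n : ℕ, ‖z‖ ≤ ‖z + ((1 / ((n : ℝ) + 1) : ℝ) : ℂ)‖ := by
    intro n
    have : 0 ≤ 1 / ((n : ℝ) + 1) := by positivity
    rw [← sq_le_sq₀ (norm_nonneg _) (norm_nonneg _), ← Complex.normSq_eq_norm_sq,
      ← Complex.normSq_eq_norm_sq, Complex.normSq_apply, Complex.normSq_apply]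
    simp only [Complex.add_re, Complex.add_im, Complex.ofReal_re, Complex.ofReal_im, add_zero]
    nlinarith
  have hznorm : 0 < ‖z‖ := norm_pos_iff.2 hz0
  have hslit : z ∈ Complex.slitPlane := by
    rcases hz.eq_or_lt with h | h
    · right
      intro him
      exact hz0 (Complex.ext h.symm him)
    · exact .inl h
  have hbound : Summable fun n : ℕ => (‖c‖ * (‖z‖ ^ (-α))) ^ n * Real.Gamma (α * n + 1) /
      n.factorial * ‖z‖⁻¹ :=
    (summable_pow_mul_Gamma_div_factorial h0 h1 _ (by positivity)).mul_right _
  have hcpow : ∀ (n : ℕ) (w : ℂ), 0 ≤ w.re → ‖z‖ ≤ ‖w‖ → ‖(-c) ^ n / n.factorial *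
      ((Real.Gamma (α * n + 1) : ℂ) * w ^ (-((α * n + 1 : ℝ) : ℂ)))‖ ≤
      (‖c‖ * (‖z‖ ^ (-α))) ^ n * Real.Gamma (α * n + 1) / n.factorial * ‖z‖⁻¹ := by
    intro n w hw hzw
    have hw0 : 0 < ‖w‖ := hznorm.trans_le hzw
    have hG : 0 ≤ Real.Gamma (α * n + 1) := Real.Gamma_nonneg_of_nonneg (by positivity)
    rw [norm_mul, norm_mul, norm_div, norm_pow, norm_neg, Complex.norm_natCast, Complex.norm_real,
      Real.norm_of_nonneg hG, ← Complex.ofReal_neg, Complex.norm_cpow_real]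
    have h2 : ‖w‖ ^ (-(α * n + 1)) ≤ (‖z‖ ^ (-α)) ^ n * ‖z‖⁻¹ := by
      rw [← Real.rpow_natCast, ← Real.rpow_mul hznorm.le, ← Real.rpow_neg_one, ← Real.rpow_add hznorm]
      refine (Real.rpow_le_rpow_of_nonpos hznorm hzw ?_).trans_eq ?_
      · have : 0 ≤ α * n := by positivity
        linarith
      · congr 1; ring
    calc ‖c‖ ^ n / n.factorial * (Real.Gamma (α * n + 1) * ‖w‖ ^ (-(α * n + 1)))
        ≤ ‖c‖ ^ n / n.factorial * (Real.Gamma (α * n + 1) * ((‖z‖ ^ (-α)) ^ n * ‖z‖⁻¹)) := by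
          gcongr
      _ = _ := by rw [mul_pow]; ring
  have hlim1 : Tendsto (fun m : ℕ => ∑' n : ℕ, (-c) ^ n / n.factorial *
      ((Real.Gamma (α * n + 1) : ℂ) *
        (z + ((1 / ((m : ℝ) + 1) : ℝ) : ℂ)) ^ (-((α * n + 1 : ℝ) : ℂ)))) atTop
      (𝓝 (∑' n : ℕ, (-c) ^ n / n.factorial *
      ((Real.Gamma (α * n + 1) : ℂ) * z ^ (-((α * n + 1 : ℝ) : ℂ))))) := by
    refine tendsto_tsum_of_dominated_convergence hbound (fun n => ?_)
      (Eventually.of_forall fun m n => hcpow n _ (hrepos m).le (hnormle m))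
    have hca : ContinuousAt (fun w : ℂ => w ^ (-((α * n + 1 : ℝ) : ℂ))) z :=
      continuousAt_id.cpow continuousAt_const hslit
    exact ((hca.tendsto.comp he).const_mul _).const_mul _
  have hlim2 : Tendsto (fun m : ℕ => stretchedLaplace α c (z + ((1 / ((m : ℝ) + 1) : ℝ) : ℂ))) atTop
      (𝓝 (stretchedLaplace α c z)) := by
    refine tendsto_integral_of_dominated_convergence
      (fun t : ℝ => t ^ (0 : ℝ) * Real.exp (-c.re * t ^ α)) ?_ ?_ ?_ ?_
    · intro m
      exact Measurable.aestronglyMeasurable (by fun_prop)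
    · exact integrableOn_rpow_mul_exp_neg_mul_rpow (by norm_num) h0 hc
    · intro m
      refine (ae_restrict_mem measurableSet_Ioi).mono fun t ht => ?_
      have ht : 0 < t := ht
      rw [norm_mul, norm_exp_neg_mul, norm_exp_neg_mul, Real.rpow_zero, neg_mul]
      refine mul_le_mul_of_nonneg_right ?_ (Real.exp_pos _).le
      rw [Real.exp_le_one_iff]
      have := mul_pos (hrepos m) ht
      linarith
    · refine Eventually.of_forall fun t => Tendsto.mul_const _ ?_
      exact (Complex.continuous_exp.tendsto _).comp (he.mul_const _).neg
  have hs : Summable (fun n : ℕ => (-c) ^ n / n.factorial *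
      ((Real.Gamma (α * n + 1) : ℂ) * z ^ (-((α * n + 1 : ℝ) : ℂ)))) :=
    Summable.of_norm_bounded hbound fun n => hcpow n z hz le_rfl
  have : stretchedLaplace α c z = ∑' n : ℕ, (-c) ^ n / n.factorial *
      ((Real.Gamma (α * n + 1) : ℂ) * z ^ (-((α * n + 1 : ℝ) : ℂ))) := by
    refine tendsto_nhds_unique hlim2 (hlim1.congr fun m => ?_)
    exact (hasSum_stretchedLaplace_of_re_pos h0 h1 c (hrepos m)).tsum_eq
  rw [this]
  exact hs.hasSum

/-- The contributions of κ < 0 and κ > 0 to the inversion integral are complex conjugates. -/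
theorem stableDensity_eq_stretchedLaplace {α θ : ℝ} (h0 : 0 < α) (hθ : |θ| < 1) (x : ℝ) :
    stableDensity α θ x = (1 / Real.pi) * (stretchedLaplace α
      (Complex.exp (Complex.I * ((θ * Real.pi / 2 : ℝ) : ℂ))) (Complex.I * x)).re := by
  set f : ℝ → ℂ := fun κ => Complex.exp (-(Complex.I * (κ : ℂ) * (x : ℂ))) *
      Complex.exp (-fellerSymbol α θ κ) with hf
  have hfi : Integrable f := by
    have hcont : Continuous fun κ : ℝ => Complex.exp (-(Complex.I * (κ : ℂ) * (x : ℂ))) := by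
      fun_prop
    refine (integrable_exp_neg_fellerSymbol h0 hθ).bdd_mul (c := 1) hcont.aestronglyMeasurable
      (Eventually.of_forall fun κ => le_of_eq ?_)
    rw [show -(Complex.I * (κ : ℂ) * (x : ℂ)) = ((-(κ * x) : ℝ) : ℂ) * Complex.I by push_cast; ring,
      Complex.norm_exp_ofReal_mul_I]
  have hpos : ∫ κ in Ioi 0, f κ = stretchedLaplace α
      (Complex.exp (Complex.I * ((θ * Real.pi / 2 : ℝ) : ℂ))) (Complex.I * x) := by
    refine setIntegral_congr_fun measurableSet_Ioi fun κ hκ => ?_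
    have hκ : 0 < κ := hκ
    rw [hf]
    dsimp only
    rw [fellerSymbol_of_pos hκ]
    congr 2 <;> ring
  have hneg : ∫ κ in Iic 0, f κ = (starRingEnd ℂ) (∫ κ in Ioi 0, f κ) := by
    rw [← integral_conj, ← neg_zero, ← integral_comp_neg_Ioi]
    simp only [neg_zero]
    refine setIntegral_congr_fun measurableSet_Ioi fun κ hκ => ?_
    have hκ : 0 < κ := hκ
    rw [hf]
    dsimp only
    rw [map_mul, ← Complex.exp_conj, ← Complex.exp_conj, fellerSymbol_neg, fellerSymbol_of_pos hκ,
      fellerSymbol_of_pos hκ, map_neg, map_neg, map_mul, map_mul, map_mul, ← Complex.exp_conj,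
      map_mul, Complex.conj_ofReal, Complex.conj_ofReal, Complex.conj_ofReal, Complex.conj_ofReal,
      Complex.conj_I]
    push_cast
    ring_nf
  have hsplit : ∫ κ, f κ = (∫ κ in Iic 0, f κ) + ∫ κ in Ioi 0, f κ :=
    (intervalIntegral.integral_Iic_add_Ioi hfi.integrableOn hfi.integrableOn).symm
  rw [stableDensity, hsplit, hneg, hpos, Complex.add_re, Complex.conj_re]
  field_simp
  ring

/-- One integration by parts trades the factor ix for a derivative of exp(-cκ^α). The boundary term
is 1, and the remaining integral is at most |c| ∫ ακ^{α-1} exp(-Re c κ^α) dκ = |c|/Re c. -/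
theorem norm_mul_stretchedLaplace_le {α : ℝ} (h0 : 0 < α) {c : ℂ} (hc : 0 < c.re) (x : ℝ) :
    ‖Complex.I * x * stretchedLaplace α c (Complex.I * x)‖ ≤ 1 + ‖c‖ / c.re := by
  set F : ℝ → ℂ := fun κ => Complex.exp (-(Complex.I * x * κ)) *
    Complex.exp (-(c * ((κ ^ α : ℝ) : ℂ))) with hF
  have hnorm : ∀ κ, ‖F κ‖ = Real.exp (-c.re * κ ^ α) := by
    intro κ
    rw [hF, norm_mul, norm_exp_neg_mul, norm_exp_neg_mul]
    simp
  have hFc : Continuous F := by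
    have : Continuous fun κ : ℝ => κ ^ α := Real.continuous_rpow_const h0.le
    fun_prop
  have hFi : IntegrableOn F (Ioi 0) := by
    refine (integrableOn_rpow_mul_exp_neg_mul_rpow (s := 0) (by norm_num) h0 hc).mono'
      hFc.aestronglyMeasurable (Eventually.of_forall fun κ => ?_)
    rw [hnorm, Real.rpow_zero, one_mul]
  set G : ℝ → ℂ := fun κ => (c * ((α * κ ^ (α - 1) : ℝ) : ℂ)) * F κ with hG
  have hGn : ∀ κ ∈ Ioi (0 : ℝ), ‖G κ‖ =
      (‖c‖ * α) * (κ ^ (α - 1) * Real.exp (-c.re * κ ^ α)) := by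
    intro κ hκ
    have hκ : 0 < κ := hκ
    rw [hG, norm_mul, norm_mul, hnorm, Complex.norm_real, Real.norm_of_nonneg (by positivity)]
    ring
  have hGb := (integrableOn_rpow_mul_exp_neg_mul_rpow (s := α - 1) (by linarith) h0 hc).const_mul
    (‖c‖ * α)
  have hGi : IntegrableOn G (Ioi 0) :=
    hGb.mono' (Measurable.aestronglyMeasurable (by have := hFc.measurable; fun_prop))
      ((ae_restrict_mem measurableSet_Ioi).mono fun κ hκ => (hGn κ hκ).le)
  have hGle : ‖∫ κ in Ioi 0, G κ‖ ≤ ‖c‖ / c.re := by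
    refine (norm_integral_le_of_norm_le hGb
      ((ae_restrict_mem measurableSet_Ioi).mono fun κ hκ => (hGn κ hκ).le)).trans_eq ?_
    rw [integral_const_mul, integral_rpow_mul_exp_neg_mul_rpow h0 (by linarith) hc]
    simp only [sub_add_cancel, neg_div, div_self h0.ne', Real.Gamma_one, Real.rpow_neg_one]
    field_simp
  have hderiv : ∀ κ ∈ Ioi (0 : ℝ), HasDerivAt F (-(Complex.I * x) * F κ - G κ) κ := by
    intro κ hκ
    have hκ : κ ≠ 0 := (mem_Ioi.1 hκ).ne'
    have h1 : HasDerivAt (fun κ : ℝ => Complex.exp (-(Complex.I * x * κ)))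
        (Complex.exp (-(Complex.I * x * κ)) * (-(Complex.I * x))) κ := by
      have : HasDerivAt (fun κ : ℝ => -(Complex.I * x * (κ : ℂ))) (-(Complex.I * x)) κ := by
        simpa using ((hasDerivAt_id κ).ofReal_comp.const_mul (Complex.I * (x : ℂ))).fun_neg
      exact this.cexp
    have h2 : HasDerivAt (fun κ : ℝ => Complex.exp (-(c * ((κ ^ α : ℝ) : ℂ))))
        (Complex.exp (-(c * ((κ ^ α : ℝ) : ℂ))) * (-(c * ((α * κ ^ (α - 1) : ℝ) : ℂ)))) κ :=
      ((Real.hasDerivAt_rpow_const (.inl hκ)).ofReal_comp.const_mul c).fun_neg.cexp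
    convert! h1.mul h2 using 1
    rw [hG, hF]
    ring
  have hlim : Tendsto F atTop (𝓝 0) := by
    rw [tendsto_zero_iff_norm_tendsto_zero]
    simp only [hnorm]
    refine Real.tendsto_exp_atBot.comp ?_
    exact (tendsto_rpow_atTop h0).const_mul_atTop_of_neg (by linarith)
  have hF' : IntegrableOn (fun κ => -(Complex.I * x) * F κ - G κ) (Ioi 0) :=
    (hFi.const_mul _).sub hGi
  have hFTC := integral_Ioi_of_hasDerivAt_of_tendsto hFc.continuousWithinAt hderiv hF' hlim
  have hF0 : F 0 = 1 := by simp [hF, h0.ne']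
  rw [integral_sub (hFi.const_mul _) hGi, integral_const_mul, hF0] at hFTC
  have : Complex.I * x * stretchedLaplace α c (Complex.I * x) = 1 - ∫ κ in Ioi 0, G κ := by
    have h3 : stretchedLaplace α c (Complex.I * x) = ∫ κ in Ioi 0, F κ := rfl
    rw [h3]
    linear_combination -hFTC
  rw [this]
  refine (norm_sub_le _ _).trans ?_
  rw [norm_one]
  linarith

theorem exists_abs_mul_stableDensity_le {α θ : ℝ} (h0 : 0 < α) (hθ : |θ| < 1) :
    ∃ C, 0 ≤ C ∧ ∀ x, |x| * |stableDensity α θ x| ≤ C := by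
  set c := Complex.exp (Complex.I * ((θ * Real.pi / 2 : ℝ) : ℂ)) with hcdef
  have hc : 0 < c.re := by
    rw [hcdef, mul_comm, Complex.exp_ofReal_mul_I_re]
    exact cos_pos_of_abs_lt_one hθ
  refine ⟨(1 / Real.pi) * (1 + ‖c‖ / c.re), by positivity, fun x => ?_⟩
  rw [stableDensity_eq_stretchedLaplace h0 hθ, abs_mul, abs_of_pos (by positivity : 0 < 1 / Real.pi),
    mul_left_comm]
  gcongr
  refine le_trans ?_ (norm_mul_stretchedLaplace_le h0 hc x)
  rw [norm_mul, norm_mul, Complex.norm_I, one_mul, Complex.norm_real, Real.norm_eq_abs]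
  gcongr
  exact Complex.abs_re_le_norm _

/-! ### The one-sided stable density and the M-Wright function -/

section OneSided

variable {ν : ℝ}

theorem I_mul_cpow_of_pos {x : ℝ} (hx : 0 < x) (s : ℝ) :
    (Complex.I * x) ^ (-(s : ℂ)) =
      ((x ^ (-s) : ℝ) : ℂ) * Complex.exp (((-(s * Real.pi / 2) : ℝ) : ℂ) * Complex.I) := by
  rw [mul_comm, Complex.ofReal_mul_cpow hx, ← Complex.ofReal_neg, ← Complex.ofReal_cpow hx.le,
    Complex.cpow_def_of_ne_zero Complex.I_ne_zero, Complex.log_I]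
  congr 2
  push_cast
  ring

theorem I_mul_cpow_of_neg {x : ℝ} (hx : x < 0) (s : ℝ) :
    (Complex.I * x) ^ (-(s : ℂ)) =
      (((-x) ^ (-s) : ℝ) : ℂ) * Complex.exp (((s * Real.pi / 2 : ℝ) : ℂ) * Complex.I) := by
  have : Complex.I * x = ((-x : ℝ) : ℂ) * (-Complex.I) := by push_cast; ring
  rw [this, Complex.ofReal_mul_cpow (by linarith), ← Complex.ofReal_neg,
    ← Complex.ofReal_cpow (by linarith),
    Complex.cpow_def_of_ne_zero (neg_ne_zero.2 Complex.I_ne_zero), Complex.log_neg_I]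
  congr 2
  push_cast
  ring

theorem hasSum_stableDensity_oneSided (h0 : 0 < ν) (h1 : ν < 1) {x : ℝ} (hx : x ≠ 0) :
    HasSum (fun n : ℕ => (1 / Real.pi) * ((-Complex.exp (Complex.I *
        ((-ν * Real.pi / 2 : ℝ) : ℂ))) ^ n / n.factorial *
      ((Real.Gamma (ν * n + 1) : ℂ) * (Complex.I * x) ^ (-((ν * n + 1 : ℝ) : ℂ)))).re)
      (stableDensity ν (-ν) x) := by
  have hθ : |(-ν)| < 1 := by rwa [abs_neg, abs_of_pos h0]
  rw [stableDensity_eq_stretchedLaplace h0 hθ]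
  have hc : 0 < (Complex.exp (Complex.I * ((-ν * Real.pi / 2 : ℝ) : ℂ))).re := by
    rw [mul_comm, Complex.exp_ofReal_mul_I_re]
    exact cos_pos_of_abs_lt_one hθ
  exact (Complex.hasSum_re (hasSum_stretchedLaplace h0 h1 hc (z := Complex.I * x) (by simp)
    (by simpa using hx))).mul_left _

theorem neg_exp_pow (ν : ℝ) (n : ℕ) :
    (-Complex.exp (Complex.I * ((-ν * Real.pi / 2 : ℝ) : ℂ))) ^ n =
      (((-1) ^ n : ℝ) : ℂ) * Complex.exp (((-(ν * n * Real.pi / 2) : ℝ) : ℂ) * Complex.I) := by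
  rw [neg_pow, ← Complex.exp_nat_mul]
  push_cast
  ring_nf

/-- For x < 0 the phases in every term of the series combine to exp(iπ/2), whose real part is 0. -/
theorem stableDensity_oneSided_of_neg (h0 : 0 < ν) (h1 : ν < 1) {x : ℝ} (hx : x < 0) :
    stableDensity ν (-ν) x = 0 := by
  rw [← (hasSum_stableDensity_oneSided h0 h1 hx.ne).tsum_eq]
  convert tsum_zero with n
  rw [neg_exp_pow, I_mul_cpow_of_neg hx]
  have : (((-1) ^ n : ℝ) : ℂ) * Complex.exp (((-(ν * n * Real.pi / 2) : ℝ) : ℂ) * Complex.I) /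
      n.factorial * ((Real.Gamma (ν * n + 1) : ℂ) * ((((-x) ^ (-(ν * n + 1)) : ℝ) : ℂ) *
        Complex.exp ((((ν * n + 1) * Real.pi / 2 : ℝ) : ℂ) * Complex.I))) =
      (((-1) ^ n / n.factorial * Real.Gamma (ν * n + 1) * (-x) ^ (-(ν * n + 1)) : ℝ) : ℂ) *
        Complex.exp (((Real.pi / 2 : ℝ) : ℂ) * Complex.I) := by
    have he : Complex.exp (((Real.pi / 2 : ℝ) : ℂ) * Complex.I) =
        Complex.exp (((-(ν * n * Real.pi / 2) : ℝ) : ℂ) * Complex.I) *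
        Complex.exp ((((ν * n + 1) * Real.pi / 2 : ℝ) : ℂ) * Complex.I) := by
      rw [← Complex.exp_add]
      congr 1
      push_cast
      ring
    rw [he]
    push_cast
    ring
  rw [this, Complex.re_ofReal_mul, Complex.exp_ofReal_mul_I_re, Real.cos_pi_div_two]
  simp

/-- The reflection formula; it also holds at the poles of Γ(1-s), where `Real.Gamma` is 0 and so is
the sine. -/
theorem inv_Gamma_one_sub_of_pos {s : ℝ} (hs : 0 < s) :
    (Real.Gamma (1 - s))⁻¹ = Real.Gamma s * Real.sin (Real.pi * s) / Real.pi := by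
  have h := Real.Gamma_mul_Gamma_one_sub s
  have hG : Real.Gamma s ≠ 0 := (Real.Gamma_pos_of_pos hs).ne'
  by_cases h0 : Real.sin (Real.pi * s) = 0
  · rw [h0, div_zero] at h
    rw [(mul_eq_zero.1 h).resolve_left hG, h0]
    simp
  · rw [eq_div_iff h0] at h
    have hne : Real.Gamma (1 - s) ≠ 0 := fun h1 => by
      rw [h1] at h; simp [Real.pi_ne_zero.symm] at h
    rw [eq_div_iff Real.pi_ne_zero, inv_mul_eq_iff_eq_mul₀ hne]
    linarith

theorem hasSum_mWright (h0 : 0 < ν) (h1 : ν < 1) {x : ℝ} (hx : 0 < x) :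
    HasSum (fun n : ℕ => (-(x ^ (-ν))) ^ n /
      ((n.factorial : ℝ) * Real.Gamma (-ν * n + (1 - ν))))
      (stableDensity ν (-ν) x / (ν * x ^ (-ν - 1))) := by
  have h := hasSum_stableDensity_oneSided h0 h1 hx.ne'
  have hterm : ∀ n : ℕ, (1 / Real.pi) * ((-Complex.exp (Complex.I *
        ((-ν * Real.pi / 2 : ℝ) : ℂ))) ^ n / n.factorial *
      ((Real.Gamma (ν * n + 1) : ℂ) * (Complex.I * x) ^ (-((ν * n + 1 : ℝ) : ℂ)))).re =
      (-1) ^ (n + 1) * Real.Gamma (ν * n + 1) / n.factorial * x ^ (-(ν * n + 1)) *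
        Real.sin (Real.pi * (ν * n)) / Real.pi := by
    intro n
    rw [neg_exp_pow, I_mul_cpow_of_pos hx]
    have : (((-1) ^ n : ℝ) : ℂ) * Complex.exp (((-(ν * n * Real.pi / 2) : ℝ) : ℂ) * Complex.I) /
        n.factorial * ((Real.Gamma (ν * n + 1) : ℂ) * (((x ^ (-(ν * n + 1)) : ℝ) : ℂ) *
          Complex.exp (((-((ν * n + 1) * Real.pi / 2) : ℝ) : ℂ) * Complex.I))) =
        (((-1) ^ n / n.factorial * Real.Gamma (ν * n + 1) * x ^ (-(ν * n + 1)) : ℝ) : ℂ) *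
          Complex.exp (((-(Real.pi * (ν * n) + Real.pi / 2) : ℝ) : ℂ) * Complex.I) := by
      have he : Complex.exp (((-(Real.pi * (ν * n) + Real.pi / 2) : ℝ) : ℂ) * Complex.I) =
          Complex.exp (((-(ν * n * Real.pi / 2) : ℝ) : ℂ) * Complex.I) *
          Complex.exp (((-((ν * n + 1) * Real.pi / 2) : ℝ) : ℂ) * Complex.I) := by
        rw [← Complex.exp_add]
        congr 1
        push_cast
        ring
      rw [he]
      push_cast
      ring
    rw [this, Complex.re_ofReal_mul, Complex.exp_ofReal_mul_I_re, Real.cos_neg,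
      Real.cos_add_pi_div_two]
    ring
  simp only [hterm] at h
  -- The term n = 0 contains sin 0, so the index may be shifted; term n+1 of the density then
  -- matches term n of M_ν.
  have h2 := ((hasSum_nat_add_iff' 1).2 h).div_const (ν * x ^ (-ν - 1))
  simp only [Finset.sum_range_one, Nat.cast_zero, mul_zero, Real.sin_zero, zero_div, sub_zero] at h2
  convert! h2 using 2 with n
  have hs : 0 < ν * ((n : ℝ) + 1) := by positivity
  have hΓ := inv_Gamma_one_sub_of_pos hs
  have e1 : -ν * n + (1 - ν) = 1 - ν * (n + 1) := by ring
  rw [e1, div_mul_eq_div_div, div_eq_mul_inv _ (Real.Gamma _), hΓ]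
  push_cast
  rw [Real.Gamma_add_one hs.ne', Nat.factorial_succ]
  have e2 : x ^ (-(ν * ((n : ℝ) + 1) + 1)) = (x ^ (-ν)) ^ n * x ^ (-ν - 1) := by
    rw [← Real.rpow_natCast, ← Real.rpow_mul hx.le, ← Real.rpow_add hx]
    congr 1
    ring
  rw [e2, neg_pow]
  have : x ^ (-ν - 1) ≠ 0 := (Real.rpow_pos_of_pos hx _).ne'
  push_cast
  field_simp
  ring

theorem stableDensity_eq_mWright (h0 : 0 < ν) (h1 : ν < 1) {x : ℝ} (hx : 0 < x) :
    stableDensity ν (-ν) x = ν * x ^ (-ν - 1) * mWright ν (x ^ (-ν)) := by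
  rw [mWright, (hasSum_mWright h0 h1 hx).tsum_eq]
  field_simp

theorem mWright_eq_stableDensity (h0 : 0 < ν) (h1 : ν < 1) {r : ℝ} (hr : 0 < r) :
    mWright ν r = stableDensity ν (-ν) (r ^ (-1 / ν)) * r ^ (-1 / ν - 1) / ν := by
  have hx : 0 < r ^ (-1 / ν) := by positivity
  have e1 : (r ^ (-1 / ν)) ^ (-ν) = r := by
    rw [← Real.rpow_mul hr.le]
    have : -1 / ν * -ν = 1 := by field_simp
    rw [this, Real.rpow_one]
  have e2 : (r ^ (-1 / ν)) ^ (-ν - 1) * r ^ (-1 / ν - 1) = 1 := by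
    rw [← Real.rpow_mul hr.le, ← Real.rpow_add hr]
    have : -1 / ν * (-ν - 1) + (-1 / ν - 1) = 0 := by field_simp; ring
    rw [this, Real.rpow_zero]
  rw [stableDensity_eq_mWright h0 h1 hx, e1]
  rw [eq_div_iff h0.ne']
  linear_combination (-(ν * mWright ν r)) * e2

theorem admissible_neg_self (h0 : 0 < ν) (h1 : ν < 1) : |(-ν)| ≤ min ν (2 - ν) := by
  rw [abs_neg, abs_of_pos h0]
  exact le_min le_rfl (by linarith)

theorem mWright_nonneg (h0 : 0 < ν) (h1 : ν < 1) {r : ℝ} (hr : 0 ≤ r) : 0 ≤ mWright ν r := by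
  rcases hr.eq_or_lt with rfl | hr
  · rw [mWright, tsum_eq_single 0]
    · simp only [neg_zero, pow_zero, Nat.factorial_zero, Nat.cast_one, Nat.cast_zero, mul_zero,
        zero_add, one_mul]
      exact one_div_nonneg.2 (Real.Gamma_nonneg_of_nonneg (by linarith))
    · intro n hn
      simp [hn]
  · rw [mWright_eq_stableDensity h0 h1 hr]
    have := stableDensity_nonneg h0 (by linarith) (admissible_neg_self h0 h1)
      (by rwa [abs_neg, abs_of_pos h0]) (r ^ (-1 / ν))
    positivity

theorem continuousOn_mWright (h0 : 0 < ν) (h1 : ν < 1) : ContinuousOn (mWright ν) (Ioi 0) := by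
  have hc := continuous_stableDensity h0 (by linarith) (admissible_neg_self h0 h1)
    (by rwa [abs_neg, abs_of_pos h0])
  have hr : ∀ p : ℝ, ContinuousOn (fun r : ℝ => r ^ p) (Ioi 0) := fun p r hr =>
    (Real.continuousAt_rpow_const _ _ (.inl (mem_Ioi.1 hr).ne')).continuousWithinAt
  exact (((hc.comp_continuousOn (hr _)).mul (hr _)).div_const ν).congr fun r hr =>
    mWright_eq_stableDensity h0 h1 hr

end OneSided

/-! ### Moments and Laplace transform of the M-Wright function -/

theorem rpow_mul_exp_neg_le_Gamma {A x : ℝ} (hA : 0 < A) (hx : 1 ≤ x) :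
    A ^ (x - 1) * Real.exp (-A) ≤ Real.Gamma x := by
  have hx0 : 0 < x := by linarith
  have hi := Real.GammaIntegral_convergent hx0
  have hsub : Ioi A ⊆ Ioi (0 : ℝ) := Ioi_subset_Ioi hA.le
  rw [Real.Gamma_eq_integral hx0]
  calc A ^ (x - 1) * Real.exp (-A) = ∫ t in Ioi A, Real.exp (-t) * A ^ (x - 1) := by
        rw [integral_mul_const, integral_exp_neg_Ioi, mul_comm]
    _ ≤ ∫ t in Ioi A, Real.exp (-t) * t ^ (x - 1) := by
        refine setIntegral_mono_on ((integrableOn_exp_neg_Ioi A).mul_const _) (hi.mono_set hsub)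
          measurableSet_Ioi fun t ht => ?_
        have ht : A < t := ht
        gcongr
    _ ≤ ∫ t in Ioi 0, Real.exp (-t) * t ^ (x - 1) := by
        refine setIntegral_mono_set hi ?_ hsub.eventuallyLE
        refine (ae_restrict_mem measurableSet_Ioi).mono fun t ht => ?_
        have ht : 0 < t := ht
        dsimp only [Pi.zero_apply]
        positivity

theorem summable_pow_mul_inv_Gamma {b : ℝ} (hb : 0 < b) (c : ℝ) {R : ℝ} (hR : 0 ≤ R) :
    Summable fun n : ℕ => R ^ n * |(Real.Gamma (b * n + c))⁻¹| := by
  -- The lower bound for Γ grows like A^{bn} = (2R+1)^n, leaving the ratio R/(2R+1) ≤ 1/2.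
  set A := (2 * R + 1) ^ (1 / b) with hA
  have hA0 : 0 < A := by positivity
  have hAb : A ^ b = 2 * R + 1 := by
    rw [hA, ← Real.rpow_mul (by positivity), one_div_mul_cancel hb.ne', Real.rpow_one]
  refine Summable.of_norm_bounded_eventually_nat
    ((summable_geometric_two).mul_left (Real.exp A * A ^ (1 - c))) ?_
  have hev : ∀ᶠ n : ℕ in atTop, 1 ≤ b * n + c := by
    have : Tendsto (fun n : ℕ => b * (n : ℝ) + c) atTop atTop :=
      tendsto_atTop_add_const_right _ _ (tendsto_natCast_atTop_atTop.const_mul_atTop hb)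
    exact this.eventually_ge_atTop 1
  filter_upwards [hev] with n hn
  have hG := rpow_mul_exp_neg_le_Gamma hA0 hn
  have hpos : 0 < A ^ (b * n + c - 1) * Real.exp (-A) := by positivity
  rw [Real.norm_of_nonneg (by positivity), abs_of_pos (inv_pos.2 (hpos.trans_le hG))]
  calc R ^ n * (Real.Gamma (b * n + c))⁻¹
      ≤ R ^ n * (A ^ (b * n + c - 1) * Real.exp (-A))⁻¹ := by gcongr
    _ = Real.exp A * A ^ (1 - c) * (R / (2 * R + 1)) ^ n := by
        have : A ^ (b * n + c - 1) = (2 * R + 1) ^ n * (A ^ (1 - c))⁻¹ := by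
          rw [← Real.rpow_neg hA0.le, ← hAb, ← Real.rpow_natCast (A ^ b), ← Real.rpow_mul hA0.le,
            ← Real.rpow_add hA0]
          congr 1
          ring
        rw [this, Real.exp_neg, div_pow]
        field_simp
    _ ≤ Real.exp A * A ^ (1 - c) * (1 / 2) ^ n := by
        have : R / (2 * R + 1) ≤ 1 / 2 := by
          rw [div_le_div_iff₀ (by positivity) two_pos]
          linarith
        gcongr

section OneSided

variable {ν : ℝ}

theorem re_cpow_nonneg (h0 : 0 < ν) (h1 : ν < 1) {z : ℂ} (hz : 0 ≤ z.re) :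
    0 ≤ (z ^ (ν : ℂ)).re := by
  rw [Complex.cpow_ofReal_re]
  refine mul_nonneg (by positivity) (Real.cos_nonneg_of_mem_Icc ?_)
  have h := Complex.abs_arg_le_pi_div_two_iff.2 hz
  have h2 : |z.arg * ν| ≤ Real.pi / 2 := by
    rw [abs_mul, abs_of_pos h0]
    nlinarith [abs_nonneg z.arg]
  exact abs_le.1 h2

theorem integrable_oneSided (h0 : 0 < ν) (h1 : ν < 1) : Integrable (stableDensity ν (-ν)) :=
  integrable_stableDensity h0 (by linarith) (admissible_neg_self h0 h1)
    (by rwa [abs_neg, abs_of_pos h0])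

theorem continuous_oneSided (h0 : 0 < ν) (h1 : ν < 1) : Continuous (stableDensity ν (-ν)) :=
  continuous_stableDensity h0 (by linarith) (admissible_neg_self h0 h1)
    (by rwa [abs_neg, abs_of_pos h0])

theorem oneSided_nonneg (h0 : 0 < ν) (h1 : ν < 1) (x : ℝ) : 0 ≤ stableDensity ν (-ν) x :=
  stableDensity_nonneg h0 (by linarith) (admissible_neg_self h0 h1)
    (by rwa [abs_neg, abs_of_pos h0]) x

theorem setIntegral_oneSided (h0 : 0 < ν) (h1 : ν < 1) (g : ℝ → ℂ) :
    ∫ x in Ioi 0, g x * (stableDensity ν (-ν) x : ℂ) =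
      ∫ x, g x * (stableDensity ν (-ν) x : ℂ) := by
  rw [← integral_indicator measurableSet_Ioi]
  refine integral_congr_ae ?_
  filter_upwards [compl_mem_ae_iff.2 (measure_singleton (0 : ℝ))] with x hx
  rcases lt_or_gt_of_ne hx with h | h
  · rw [indicator_of_notMem (by simpa using h.le), stableDensity_oneSided_of_neg h0 h1 h]
    simp
  · rw [indicator_of_mem (mem_Ioi.2 h)]

/-- The difference of the two sides is analytic for Re z > 0, bounded and continuous up to the
imaginary axis, and vanishes there by the known Fourier transform. Phragmén–Lindelöf makes it zero.
-/
theorem laplace_oneSided (h0 : 0 < ν) (h1 : ν < 1) {z : ℂ} (hz : 0 ≤ z.re) :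
    ∫ x : ℝ in Ioi 0, Complex.exp (-(z * x)) * (stableDensity ν (-ν) x : ℂ) =
      Complex.exp (-(z ^ (ν : ℂ))) := by
  have hpi := integrable_oneSided h0 h1
  have hpc := continuous_oneSided h0 h1
  have hle : ∀ z : ℂ, 0 ≤ z.re → ∀ x ∈ Ioi (0 : ℝ),
      ‖Complex.exp (-(z * x)) * (stableDensity ν (-ν) x : ℂ)‖ ≤ stableDensity ν (-ν) x := by
    intro z hz x hx
    have hx : 0 < x := hx
    rw [norm_mul, norm_exp_neg_mul, Complex.norm_real, Real.norm_of_nonneg (oneSided_nonneg h0 h1 x)]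
    refine mul_le_of_le_one_left (oneSided_nonneg h0 h1 x) ?_
    rw [Real.exp_le_one_iff]
    have := mul_nonneg hz hx.le
    linarith
  have hmeas : ∀ z : ℂ, AEStronglyMeasurable (fun x : ℝ => Complex.exp (-(z * x)) *
      (stableDensity ν (-ν) x : ℂ)) (volume.restrict (Ioi 0)) := fun z =>
    Continuous.aestronglyMeasurable (by fun_prop)
  set f : ℂ → ℂ := fun z => (∫ x : ℝ in Ioi 0, Complex.exp (-(z * x)) *
    (stableDensity ν (-ν) x : ℂ)) - Complex.exp (-(z ^ (ν : ℂ))) with hf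
  have hbd : ∀ z : ℂ, 0 ≤ z.re → ‖f z‖ ≤ (∫ x in Ioi 0, stableDensity ν (-ν) x) + 1 := by
    intro z hz
    refine (norm_sub_le _ _).trans (add_le_add ?_ ?_)
    · exact norm_integral_le_of_norm_le hpi.integrableOn
        ((ae_restrict_mem measurableSet_Ioi).mono (hle z hz))
    · rw [Complex.norm_exp, Real.exp_le_one_iff, Complex.neg_re]
      linarith [re_cpow_nonneg h0 h1 hz]
  have hd : DiffContOnCl ℂ f {z | 0 < z.re} := by
    refine ⟨DifferentiableOn.sub (differentiableOn_laplace fun s hs => ?_) ?_, ?_⟩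
    · refine hpi.integrableOn.mono' (Continuous.aestronglyMeasurable (by fun_prop))
        ((ae_restrict_mem measurableSet_Ioi).mono fun x hx => ?_)
      have := hle s (by simpa using hs.le) x hx
      simpa using this
    · intro w hw
      have hw' : 0 < w.re := hw
      exact ((hasStrictDerivAt_id w).cpow_const (.inl hw')).hasDerivAt.differentiableAt.neg.cexp
        |>.differentiableWithinAt
    · rw [Complex.closure_setOfPred_lt_re]
      refine ContinuousOn.sub ?_ ?_
      · refine continuousOn_of_dominated (bound := stableDensity ν (-ν)) (fun z _ => hmeas z)
          (fun z hz => (ae_restrict_mem measurableSet_Ioi).mono (hle z hz)) hpi.integrableOn ?_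
        exact Eventually.of_forall fun x => Continuous.continuousOn (by fun_prop)
      · intro w hw
        have hw' : 0 ≤ w.re := hw
        exact ((Complex.continuousAt_cpow_const_of_re_pos (.inl hw') (by simpa using h0)).neg.cexp
          ).continuousWithinAt
  have hzero : ∀ y : ℝ, ‖f (y * Complex.I)‖ ≤ 0 := by
    intro y
    rw [norm_le_zero_iff, hf, sub_eq_zero, setIntegral_oneSided h0 h1]
    have h := integral_exp_mul_stableDensity h0 (by linarith) (admissible_neg_self h0 h1)
      (by rwa [abs_neg, abs_of_pos h0]) (-y)
    rw [← neg_I_mul_cpow h0] at h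
    convert! h using 2
    · ext x
      congr 2
      push_cast
      ring
    · congr 2
      push_cast
      ring
  -- The growth condition is met with exponent 1 < 2 and rate 0, that is, by boundedness.
  have := PhragmenLindelof.right_half_plane_of_bounded_on_real hd
    ⟨1, one_lt_two, 0, ?_⟩ ?_ hzero hz
  · rwa [norm_le_zero_iff, sub_eq_zero] at this
  · refine Asymptotics.IsBigO.of_bound ((∫ x in Ioi 0, stableDensity ν (-ν) x) + 1) ?_
    filter_upwards [mem_inf_of_right (mem_principal_self _)] with z hz
    simpa using hbd z (le_of_lt hz)
  · refine ⟨(∫ x in Ioi 0, stableDensity ν (-ν) x) + 1, eventually_map.2 ?_⟩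
    filter_upwards [eventually_ge_atTop 0] with x hx
    exact hbd x (by simpa using hx)

theorem integral_exp_neg_mul_oneSided (h0 : 0 < ν) (h1 : ν < 1) {s : ℝ} (hs : 0 ≤ s) :
    ∫ x : ℝ in Ioi 0, Real.exp (-(s * x)) * stableDensity ν (-ν) x = Real.exp (-(s ^ ν)) := by
  have h := laplace_oneSided h0 h1 (z := s) (by simpa using hs)
  rw [← Complex.ofReal_inj, ← integral_complex_ofReal]
  push_cast [Complex.ofReal_cpow hs]
  exact h

/-- Negative moments of the one-sided stable law. -/
theorem lintegral_rpow_neg_mul_oneSided (h0 : 0 < ν) (h1 : ν < 1) {p : ℝ} (hp : 0 < p) :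
    ∫⁻ x in Ioi 0, ENNReal.ofReal (x ^ (-p) * stableDensity ν (-ν) x) =
      ENNReal.ofReal (Real.Gamma (p / ν) / (ν * Real.Gamma p)) := by
  have hΓ := Real.Gamma_pos_of_pos hp
  have hpc := continuous_oneSided h0 h1
  have hnn := oneSided_nonneg h0 h1
  -- Write x^{-p} as Γ(p)⁻¹ ∫ s^{p-1} exp(-sx) ds and exchange the integrals; the extended
  -- nonnegative integral requires no prior finiteness of the moment.
  have hinner : ∀ x ∈ Ioi (0 : ℝ), ENNReal.ofReal (x ^ (-p) * stableDensity ν (-ν) x) =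
      ∫⁻ s in Ioi 0, ENNReal.ofReal ((Real.Gamma p)⁻¹ * (s ^ (p - 1) * Real.exp (-(s * x)) *
        stableDensity ν (-ν) x)) := by
    intro x hx
    have hx : 0 < x := hx
    have hi : IntegrableOn (fun s : ℝ => s ^ (p - 1) * Real.exp (-(s * x))) (Ioi 0) := by
      simpa only [mul_comm] using integrableOn_rpow_mul_exp_neg_mul hp hx
    rw [← ofReal_integral_eq_lintegral_ofReal ((hi.mul_const _).const_mul _)]
    · have := Real.integral_rpow_mul_exp_neg_mul_Ioi hp hx
      rw [integral_const_mul, integral_mul_const]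
      simp only [mul_comm _ x]
      rw [this, one_div, Real.inv_rpow hx.le, ← Real.rpow_neg hx.le]
      congr 1
      field_simp
    · refine (ae_restrict_mem measurableSet_Ioi).mono fun s hs => ?_
      have hs : 0 < s := hs
      have := hnn x
      dsimp only [Pi.zero_apply]
      positivity
  have houter : ∀ s ∈ Ioi (0 : ℝ), ∫⁻ x in Ioi 0, ENNReal.ofReal ((Real.Gamma p)⁻¹ *
      (s ^ (p - 1) * Real.exp (-(s * x)) * stableDensity ν (-ν) x)) =
      ENNReal.ofReal ((Real.Gamma p)⁻¹ * (s ^ (p - 1) * Real.exp (-s ^ ν))) := by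
    intro s hs
    have hs : 0 < s := hs
    have hi : IntegrableOn (fun x => Real.exp (-(s * x)) * stableDensity ν (-ν) x) (Ioi 0) := by
      refine (integrable_oneSided h0 h1).integrableOn.mono'
        (Continuous.aestronglyMeasurable (by fun_prop))
        ((ae_restrict_mem measurableSet_Ioi).mono fun x hx => ?_)
      have hx : 0 < x := hx
      rw [Real.norm_of_nonneg (mul_nonneg (Real.exp_pos _).le (hnn x))]
      refine mul_le_of_le_one_left (hnn x) ?_
      rw [Real.exp_le_one_iff]
      have := mul_pos hs hx
      linarith
    simp only [mul_assoc]
    rw [← ofReal_integral_eq_lintegral_ofReal ((hi.const_mul _).const_mul _)]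
    · rw [integral_const_mul, integral_const_mul, integral_exp_neg_mul_oneSided h0 h1 hs.le]
    · refine Eventually.of_forall fun x => ?_
      have := hnn x
      dsimp only [Pi.zero_apply]
      positivity
  rw [setLIntegral_congr_fun measurableSet_Ioi hinner, lintegral_lintegral_swap]
  · rw [setLIntegral_congr_fun measurableSet_Ioi houter,
      ← ofReal_integral_eq_lintegral_ofReal]
    · rw [integral_const_mul, integral_rpow_mul_exp_neg_rpow h0 (by linarith)]
      congr 1
      rw [sub_add_cancel]
      field_simp
    · exact (integrableOn_rpow_mul_exp_neg_rpow (by linarith) h0).const_mul _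
    · refine (ae_restrict_mem measurableSet_Ioi).mono fun s hs => ?_
      have hs : 0 < s := hs
      dsimp only [Pi.zero_apply]
      positivity
  · have := hpc.measurable
    exact Measurable.aemeasurable (by fun_prop)

theorem moment_oneSided (h0 : 0 < ν) (h1 : ν < 1) (n : ℕ) :
    IntegrableOn (fun x => (x ^ (-ν)) ^ n * stableDensity ν (-ν) x) (Ioi 0) ∧
    ∫ x in Ioi 0, (x ^ (-ν)) ^ n * stableDensity ν (-ν) x =
      n.factorial / Real.Gamma (ν * n + 1) := by
  have hnn := oneSided_nonneg h0 h1
  rcases Nat.eq_zero_or_pos n with rfl | hn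
  · have h := integral_exp_neg_mul_oneSided h0 h1 le_rfl
    rw [Real.zero_rpow h0.ne'] at h
    simp only [zero_mul, neg_zero, Real.exp_zero, one_mul] at h
    simpa [h] using (integrable_oneSided h0 h1).integrableOn
  have hn' : (0 : ℝ) < n := by exact_mod_cast hn
  have hp : 0 < ν * n := by positivity
  have h := lintegral_rpow_neg_mul_oneSided h0 h1 hp
  have hcongr : EqOn (fun x => (x ^ (-ν)) ^ n * stableDensity ν (-ν) x)
      (fun x => x ^ (-(ν * n)) * stableDensity ν (-ν) x) (Ioi 0) := by
    intro x hx
    dsimp only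
    rw [← Real.rpow_natCast, ← Real.rpow_mul (le_of_lt hx), neg_mul]
  have hm : AEStronglyMeasurable (fun x => x ^ (-(ν * n)) * stableDensity ν (-ν) x)
      (volume.restrict (Ioi 0)) := by
    have := (continuous_oneSided h0 h1).measurable
    exact Measurable.aestronglyMeasurable (by fun_prop)
  have hnn' : 0 ≤ᵐ[volume.restrict (Ioi (0 : ℝ))]
      (fun x => x ^ (-(ν * n)) * stableDensity ν (-ν) x) := by
    refine (ae_restrict_mem measurableSet_Ioi).mono fun x hx => ?_
    have hx : 0 < x := hx
    have := hnn x
    dsimp only [Pi.zero_apply]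
    positivity
  have hΓ := Real.Gamma_pos_of_pos hp
  have hΓ' := Real.Gamma_pos_of_pos (div_pos hp h0)
  constructor
  · refine IntegrableOn.congr_fun ?_ hcongr.symm measurableSet_Ioi
    refine ⟨hm, ?_⟩
    rw [hasFiniteIntegral_iff_ofReal hnn', h]
    exact ENNReal.ofReal_lt_top
  · rw [setIntegral_congr_fun measurableSet_Ioi hcongr, integral_eq_lintegral_of_nonneg_ae hnn' hm,
      h, ENNReal.toReal_ofReal (by positivity), Real.Gamma_add_one hp.ne',
      mul_div_cancel_left₀ _ h0.ne']
    obtain ⟨m, rfl⟩ : ∃ m, n = m + 1 := ⟨n - 1, by omega⟩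
    have := Real.Gamma_nat_eq_factorial m
    rw [Nat.cast_succ, this, Nat.factorial_succ]
    push_cast at hΓ ⊢
    field_simp

/-- The substitution r = x^{-ν} turns M_ν(r) dr into the one-sided stable law, so these are its
moments of order -νn. -/
theorem moment_mWright (h0 : 0 < ν) (h1 : ν < 1) (n : ℕ) :
    IntegrableOn (fun r => r ^ n * mWright ν r) (Ioi 0) ∧
    ∫ r in Ioi 0, r ^ n * mWright ν r = n.factorial / Real.Gamma (ν * n + 1) := by
  have hne : -ν ≠ 0 := neg_ne_zero.2 h0.ne'
  have hcongr : EqOn (fun x : ℝ => (|(-ν)| * x ^ (-ν - 1)) • ((x ^ (-ν)) ^ n * mWright ν (x ^ (-ν))))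
      (fun x => (x ^ (-ν)) ^ n * stableDensity ν (-ν) x) (Ioi 0) := by
    intro x hx
    dsimp only
    rw [stableDensity_eq_mWright h0 h1 hx, abs_neg, abs_of_pos h0, smul_eq_mul]
    ring
  obtain ⟨hi, he⟩ := moment_oneSided h0 h1 n
  constructor
  · rw [← integrableOn_Ioi_comp_rpow_iff _ hne]
    exact hi.congr_fun hcongr.symm measurableSet_Ioi
  · rw [← integral_comp_rpow_Ioi _ hne, setIntegral_congr_fun measurableSet_Ioi hcongr, he]

theorem integrableOn_mWright (h0 : 0 < ν) (h1 : ν < 1) : IntegrableOn (mWright ν) (Ioi 0) := by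
  simpa using (moment_mWright h0 h1 0).1

theorem hasSum_laplace_mWright (h0 : 0 < ν) (h1 : ν < 1) (z : ℂ) :
    HasSum (fun n : ℕ => (-z) ^ n * (((Real.Gamma (ν * n + 1))⁻¹ : ℝ) : ℂ))
      (∫ r : ℝ in Ioi 0, Complex.exp (-(z * r)) * (mWright ν r : ℂ)) := by
  set F : ℕ → ℝ → ℂ := fun n r => ((-z) ^ n / n.factorial) * ((r ^ n * mWright ν r : ℝ) : ℂ) with hF
  have hint : ∀ n, IntegrableOn (F n) (Ioi 0) := fun n =>
    ((moment_mWright h0 h1 n).1.ofReal).const_mul _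
  have hnorm : ∀ n, ∫ r in Ioi 0, ‖F n r‖ = ‖z‖ ^ n * |(Real.Gamma (ν * n + 1))⁻¹| := by
    intro n
    have hG : 0 < Real.Gamma (ν * n + 1) := Real.Gamma_pos_of_pos (by positivity)
    have : EqOn (fun r => ‖F n r‖) (fun r => ‖z‖ ^ n / n.factorial * (r ^ n * mWright ν r))
        (Ioi 0) := by
      intro r hr
      have hr : 0 < r := hr
      have := mWright_nonneg h0 h1 hr.le
      dsimp only [F]
      rw [norm_mul, norm_div, norm_pow, norm_neg, Complex.norm_natCast, Complex.norm_real,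
        Real.norm_of_nonneg (by positivity)]
    rw [setIntegral_congr_fun measurableSet_Ioi this, integral_const_mul, (moment_mWright h0 h1 n).2,
      abs_of_pos (inv_pos.2 hG)]
    field_simp
  have h := hasSum_integral_of_summable_integral_norm hint (by
    simp only [hnorm]
    exact summable_pow_mul_inv_Gamma h0 1 (norm_nonneg z))
  convert! h using 1
  · ext n
    rw [hF, integral_const_mul, integral_complex_ofReal, (moment_mWright h0 h1 n).2]
    have : (n.factorial : ℂ) ≠ 0 := by exact_mod_cast n.factorial_ne_zero
    push_cast
    field_simp
  · refine integral_congr_ae (Eventually.of_forall fun r => ?_)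
    dsimp only
    rw [← neg_mul, Complex.exp_eq_exp_ℂ, NormedSpace.exp_eq_tsum_div, ← tsum_mul_right]
    congr 1
    ext n
    rw [hF]
    push_cast
    ring

end OneSided

/-! ### Beta integrals and Mittag-Leffler functions -/

theorem integral_beta {a d t : ℝ} (ha : 0 < a) (hd : 0 < d) (ht : 0 < t) :
    ∫ s in (0 : ℝ)..t, (t - s) ^ (a - 1) * s ^ (d - 1) =
      Real.Gamma a * Real.Gamma d / Real.Gamma (a + d) * t ^ (a + d - 1) := by
  have h := Complex.betaIntegral_scaled d a ht
  rw [Complex.betaIntegral_eq_Gamma_mul_div _ _ (by simpa using hd) (by simpa using ha)] at h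
  rw [← Complex.ofReal_inj, ← intervalIntegral.integral_ofReal]
  have hc : ∫ s in (0 : ℝ)..t, (((t - s) ^ (a - 1) * s ^ (d - 1) : ℝ) : ℂ) =
      ∫ x in (0 : ℝ)..t, (x : ℂ) ^ ((d : ℂ) - 1) * ((t : ℂ) - x) ^ ((a : ℂ) - 1) := by
    refine intervalIntegral.integral_congr fun s hs => ?_
    rw [uIcc_of_le ht.le] at hs
    have h1 : 0 ≤ t - s := by linarith [hs.2]
    push_cast [Complex.ofReal_cpow h1, Complex.ofReal_cpow hs.1]
    ring
  rw [hc, h]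
  have e1 : (d : ℂ) + a = ((a + d : ℝ) : ℂ) := by push_cast; ring
  rw [e1, Complex.Gamma_ofReal, Complex.Gamma_ofReal, Complex.Gamma_ofReal]
  push_cast [Complex.ofReal_cpow ht.le]
  ring

theorem integrableOn_beta {a d t : ℝ} (ha : 0 < a) (hd : 0 < d) (ht : 0 < t) :
    IntegrableOn (fun s => (t - s) ^ (a - 1) * s ^ (d - 1)) (Ioc 0 t) := by
  rw [← intervalIntegrable_iff_integrableOn_Ioc_of_le ht.le]
  -- The integral of a non-integrable function is 0 by convention, so the nonzero beta value already
  -- gives integrability.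
  refine intervalIntegral.intervalIntegrable_of_integral_ne_zero ?_
  rw [integral_beta ha hd ht]
  have h1 := Real.Gamma_pos_of_pos ha
  have h2 := Real.Gamma_pos_of_pos hd
  have h3 := Real.Gamma_pos_of_pos (add_pos ha hd)
  positivity

theorem setIntegral_beta {a d t : ℝ} (ha : 0 < a) (hd : 0 < d) (ht : 0 < t) :
    ∫ s in Ioc 0 t, (t - s) ^ (a - 1) * s ^ (d - 1) =
      Real.Gamma a * Real.Gamma d / Real.Gamma (a + d) * t ^ (a + d - 1) := by
  rw [← intervalIntegral.integral_of_le ht.le, integral_beta ha hd ht]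

/-- `t^{c-1} E_{b,c}(-l t^b)` with the two-parameter Mittag-Leffler function `E_{b,c}`. -/
noncomputable def mittagLeffler (b c : ℝ) (l : ℂ) (t : ℝ) : ℂ :=
  ∑' n : ℕ, (-l) ^ n * ((t ^ (b * n + c - 1) * (Real.Gamma (b * n + c))⁻¹ : ℝ) : ℂ)

section MittagLeffler

variable {b : ℝ}

theorem norm_mittagLeffler_term (c : ℝ) (l : ℂ) {t : ℝ} (ht : 0 < t) (n : ℕ) :
    ‖(-l) ^ n * ((t ^ (b * n + c - 1) * (Real.Gamma (b * n + c))⁻¹ : ℝ) : ℂ)‖ =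
      t ^ (c - 1) * ((‖l‖ * t ^ b) ^ n * |(Real.Gamma (b * n + c))⁻¹|) := by
  have : t ^ (b * n + c - 1) = (t ^ b) ^ n * t ^ (c - 1) := by
    rw [← Real.rpow_natCast, ← Real.rpow_mul ht.le, ← Real.rpow_add ht]
    congr 1
    ring
  rw [norm_mul, norm_pow, norm_neg, Complex.norm_real, Real.norm_eq_abs, abs_mul, this, mul_pow,
    abs_of_pos (by positivity : 0 < (t ^ b) ^ n * t ^ (c - 1))]
  ring

theorem summable_mittagLeffler (hb : 0 < b) (c : ℝ) (l : ℂ) {t : ℝ} (ht : 0 < t) :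
    Summable fun n : ℕ =>
      (-l) ^ n * ((t ^ (b * n + c - 1) * (Real.Gamma (b * n + c))⁻¹ : ℝ) : ℂ) := by
  refine Summable.of_norm ?_
  simp only [norm_mittagLeffler_term c l ht]
  exact (summable_pow_mul_inv_Gamma hb c (by positivity)).mul_left _

/-- Splitting off the term n = 0. This isolates the singular part at 0 and is valid for all real c.
-/
theorem mittagLeffler_eq_add (hb : 0 < b) (c : ℝ) (l : ℂ) {t : ℝ} (ht : 0 < t) :
    mittagLeffler b c l t = ((t ^ (c - 1) * (Real.Gamma c)⁻¹ : ℝ) : ℂ) -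
      l * mittagLeffler b (b + c) l t := by
  rw [mittagLeffler, (summable_mittagLeffler hb c l ht).tsum_eq_zero_add, mittagLeffler,
    sub_eq_add_neg ((t ^ (c - 1) * (Real.Gamma c)⁻¹ : ℝ) : ℂ), ← neg_mul, ← tsum_mul_left]
  congr 1
  · simp
  · congr 1
    ext n
    have : b * ((n + 1 : ℕ) : ℝ) + c = b * n + (b + c) := by push_cast; ring
    rw [this]
    ring

theorem exists_norm_mittagLeffler_le (hb : 0 < b) (c : ℝ) (l : ℂ) (T : ℝ) (hT : 0 < T) :
    ∃ C, 0 ≤ C ∧ ∀ t ∈ Ioc 0 T, ‖mittagLeffler b c l t‖ ≤ t ^ (c - 1) * C := by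
  have hs := summable_pow_mul_inv_Gamma hb c (R := ‖l‖ * T ^ b) (by positivity)
  refine ⟨∑' n : ℕ, (‖l‖ * T ^ b) ^ n * |(Real.Gamma (b * n + c))⁻¹|,
    tsum_nonneg fun n => ?_, fun t ht => ?_⟩
  · positivity
  · rw [← tsum_mul_left]
    refine tsum_of_norm_bounded (hs.mul_left _).hasSum fun n => ?_
    rw [norm_mittagLeffler_term c l ht.1]
    have := ht.1
    have h2 : t ^ b ≤ T ^ b := Real.rpow_le_rpow ht.1.le ht.2 hb.le
    gcongr

theorem inv_Gamma_sub_one (x : ℝ) : (x - 1) * (Real.Gamma x)⁻¹ = (Real.Gamma (x - 1))⁻¹ := by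
  rcases eq_or_ne (x - 1) 0 with h | h
  · rw [h]
    simp
  · have := Real.Gamma_add_one h
    rw [sub_add_cancel] at this
    rw [this, mul_inv, mul_inv_cancel_left₀ h]

/-- Differentiating lowers c by 1, termwise, since (x-1)/Γ(x) = 1/Γ(x-1) for every real x with 1/Γ =
0 at the poles. Parameters c ≤ 0 are therefore needed. -/
theorem hasDerivAt_mittagLeffler (hb : 0 < b) (c : ℝ) (l : ℂ) {t : ℝ} (ht : 0 < t) :
    HasDerivAt (mittagLeffler b c l) (mittagLeffler b (c - 1) l t) t := by
  -- The sum of the endpoint values bounds y^{c-2} whatever the sign of the exponent.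
  set K := (t / 2) ^ (c - 1 - 1) + (2 * t) ^ (c - 1 - 1) with hK
  have hmem : t ∈ Ioo (t / 2) (2 * t) := ⟨by linarith, by linarith⟩
  have hKle : ∀ y ∈ Ioo (t / 2) (2 * t), y ^ (c - 1 - 1) ≤ K := by
    intro y hy
    have hy0 : 0 < y := by linarith [hy.1]
    have p1 : 0 < (t / 2) ^ (c - 1 - 1) := by positivity
    have p2 : 0 < (2 * t) ^ (c - 1 - 1) := by positivity
    rcases le_total 0 (c - 1 - 1) with h | h
    · exact (Real.rpow_le_rpow hy0.le hy.2.le h).trans (by linarith)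
    · exact (Real.rpow_le_rpow_of_nonpos (by positivity) hy.1.le h).trans (by linarith)
  have key := hasDerivAt_tsum_of_isPreconnected (t := Ioo (t / 2) (2 * t)) (y := t) (y₀ := t)
    (g := fun (n : ℕ) (t : ℝ) =>
      (-l) ^ n * ((t ^ (b * n + c - 1) * (Real.Gamma (b * n + c))⁻¹ : ℝ) : ℂ))
    (g' := fun (n : ℕ) (t : ℝ) =>
      (-l) ^ n * ((t ^ (b * n + (c - 1) - 1) * (Real.Gamma (b * n + (c - 1)))⁻¹ : ℝ) : ℂ))
    (u := fun n : ℕ => K * ((‖l‖ * (2 * t) ^ b) ^ n * |(Real.Gamma (b * n + (c - 1)))⁻¹|))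
    ((summable_pow_mul_inv_Gamma hb (c - 1) (by positivity)).mul_left _) isOpen_Ioo
    isPreconnected_Ioo ?_ ?_ hmem (summable_mittagLeffler hb c l ht) hmem
  · exact key
  · intro n y hy
    have hy0 : 0 < y := by linarith [hy.1]
    have h := (((Real.hasDerivAt_rpow_const (p := b * n + c - 1) (.inl hy0.ne')).mul_const
      (Real.Gamma (b * n + c))⁻¹).ofReal_comp).const_mul ((-l) ^ n)
    convert! h using 3
    rw [← add_sub_assoc, ← inv_Gamma_sub_one]
    ring
  · intro n y hy
    have hy0 : 0 < y := by linarith [hy.1]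
    rw [norm_mittagLeffler_term (c - 1) l hy0]
    have h1 := hKle y hy
    have h2 : y ^ b ≤ (2 * t) ^ b := Real.rpow_le_rpow hy0.le hy.2.le hb.le
    gcongr

theorem continuousOn_mittagLeffler (hb : 0 < b) (c : ℝ) (l : ℂ) :
    ContinuousOn (mittagLeffler b c l) (Ioi 0) := fun _ ht =>
  (hasDerivAt_mittagLeffler hb c l ht).continuousAt.continuousWithinAt

theorem contDiffOn_mittagLeffler (hb : 0 < b) (l : ℂ) (n : ℕ) (c : ℝ) :
    ContDiffOn ℝ n (mittagLeffler b c l) (Ioi 0) := by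
  induction n generalizing c with
  | zero => simpa using continuousOn_mittagLeffler hb c l
  | succ n ih =>
    rw [Nat.cast_succ, contDiffOn_succ_iff_deriv_of_isOpen isOpen_Ioi]
    refine ⟨fun t ht => (hasDerivAt_mittagLeffler hb c l
      ht).differentiableAt.differentiableWithinAt, fun h => by simp at h, ?_⟩
    exact (ih (c - 1)).congr fun t ht => (hasDerivAt_mittagLeffler hb c l ht).deriv

theorem integrableOn_mittagLeffler (hb : 0 < b) {c : ℝ} (hc : 0 < c) (l : ℂ) {T : ℝ} (hT : 0 < T) :
    IntegrableOn (mittagLeffler b c l) (Ioc 0 T) := by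
  obtain ⟨C, _, hC⟩ := exists_norm_mittagLeffler_le hb c l T hT
  have hi : IntegrableOn (fun t : ℝ => t ^ (c - 1) * C) (Ioc 0 T) :=
    ((intervalIntegrable_iff_integrableOn_Ioc_of_le hT.le).1
      (intervalIntegral.intervalIntegrable_rpow' (by linarith))).mul_const C
  refine hi.mono' ?_ ((ae_restrict_mem measurableSet_Ioc).mono hC)
  exact ((continuousOn_mittagLeffler hb c l).mono Ioc_subset_Ioi_self).aestronglyMeasurable
    measurableSet_Ioc

theorem tendsto_mittagLeffler_zero (hb : 0 < b) {c : ℝ} (hc : 1 < c) (l : ℂ) :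
    Tendsto (mittagLeffler b c l) (𝓝[>] 0) (𝓝 0) := by
  obtain ⟨C, _, hC⟩ := exists_norm_mittagLeffler_le hb c l 1 one_pos
  have hl : Tendsto (fun t : ℝ => t ^ (c - 1) * C) (𝓝[>] 0) (𝓝 0) := by
    have h := (Real.continuousAt_rpow_const 0 (c - 1) (.inr (by linarith))).tendsto.mul_const C
    rw [Real.zero_rpow (by linarith), zero_mul] at h
    exact h.mono_left nhdsWithin_le_nhds
  refine squeeze_zero_norm' ?_ hl
  filter_upwards [Ioc_mem_nhdsGT one_pos] with t ht using hC t ht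

theorem tendsto_mittagLeffler_one (hb : 0 < b) (l : ℂ) :
    Tendsto (mittagLeffler b 1 l) (𝓝[>] 0) (𝓝 1) := by
  have h := ((tendsto_mittagLeffler_zero hb (c := b + 1) (by linarith) l).const_mul l).const_sub 1
  rw [mul_zero, sub_zero] at h
  refine h.congr' ?_
  filter_upwards [self_mem_nhdsWithin] with t ht
  rw [mittagLeffler_eq_add hb 1 l ht]
  simp

/-- Termwise a beta integral: fractional integration of order a raises c by a. -/
theorem fracIntegral_mittagLeffler (hb : 0 < b) {a c : ℝ} (ha : 0 < a) (hc : 0 < c) (l : ℂ) {t : ℝ}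
    (ht : 0 < t) :
    ∫ s in (0 : ℝ)..t, ((t - s) ^ (a - 1) : ℝ) • mittagLeffler b c l s =
      Real.Gamma a • mittagLeffler b (a + c) l t := by
  rw [intervalIntegral.integral_of_le ht.le]
  have hΓa := Real.Gamma_pos_of_pos ha
  have hpos : ∀ n : ℕ, 0 < b * n + c := fun n => by positivity
  set F : ℕ → ℝ → ℂ := fun n s => ((-l) ^ n * ((Real.Gamma (b * n + c))⁻¹ : ℝ)) *
    (((t - s) ^ (a - 1) * s ^ (b * n + c - 1) : ℝ) : ℂ) with hF
  have hint : ∀ n, IntegrableOn (F n) (Ioc 0 t) := fun n =>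
    (integrableOn_beta ha (hpos n) ht).ofReal.const_mul _
  have hval : ∀ n : ℕ, Real.Gamma a * Real.Gamma (b * n + c) / Real.Gamma (a + (b * n + c)) *
      t ^ (a + (b * n + c) - 1) * (Real.Gamma (b * n + c))⁻¹ =
      Real.Gamma a * (t ^ (b * n + (a + c) - 1) * (Real.Gamma (b * n + (a + c)))⁻¹) := by
    intro n
    have e : a + (b * n + c) = b * n + (a + c) := by ring
    have := (Real.Gamma_pos_of_pos (hpos n)).ne'
    rw [e]
    field_simp
  have hnorm : ∀ n : ℕ, ∫ s in Ioc 0 t, ‖F n s‖ = Real.Gamma a *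
      ‖(-l) ^ n * ((t ^ (b * n + (a + c) - 1) * (Real.Gamma (b * n + (a + c)))⁻¹ : ℝ) : ℂ)‖ := by
    intro n
    have hG := Real.Gamma_pos_of_pos (hpos n)
    have hG' : 0 < Real.Gamma (b * n + (a + c)) := Real.Gamma_pos_of_pos (by positivity)
    have : EqOn (fun s => ‖F n s‖) (fun s => ‖l‖ ^ n * (Real.Gamma (b * n + c))⁻¹ *
        ((t - s) ^ (a - 1) * s ^ (b * n + c - 1))) (Ioc 0 t) := by
      intro s hs
      have h1 : 0 ≤ t - s := by linarith [hs.2]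
      have h2 := hs.1
      dsimp only [F]
      rw [norm_mul, norm_mul, norm_pow, norm_neg, Complex.norm_real, Complex.norm_real,
        Real.norm_of_nonneg (by positivity), Real.norm_of_nonneg (by positivity)]
    rw [setIntegral_congr_fun measurableSet_Ioc this, integral_const_mul,
      setIntegral_beta ha (hpos n) ht, norm_mul, norm_pow, norm_neg, Complex.norm_real,
      Real.norm_of_nonneg (by positivity)]
    linear_combination ‖l‖ ^ n * hval n
  have hsum := summable_mittagLeffler hb (a + c) l ht
  have h := hasSum_integral_of_summable_integral_norm hint (by
    simp only [hnorm]
    exact hsum.norm.mul_left _)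
  have h1 : ∫ s in Ioc 0 t, ((t - s) ^ (a - 1) : ℝ) • mittagLeffler b c l s =
      ∫ s in Ioc 0 t, ∑' n, F n s := by
    refine setIntegral_congr_fun measurableSet_Ioc fun s hs => ?_
    rw [mittagLeffler, Complex.real_smul, ← tsum_mul_left]
    congr 1
    ext n
    rw [hF]
    push_cast
    ring
  rw [h1, ← h.tsum_eq, mittagLeffler, Complex.real_smul, ← tsum_mul_left]
  congr 1
  ext n
  rw [hF, integral_const_mul, integral_complex_ofReal, setIntegral_beta ha (hpos n) ht]
  have := congrArg (fun x : ℝ => (x : ℂ)) (hval n)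
  push_cast at this ⊢
  linear_combination (-l) ^ n * this

theorem iteratedDeriv_mittagLeffler (hb : 0 < b) (l : ℂ) {f : ℝ → ℂ}
    (hf : ∀ t, 0 < t → f t = mittagLeffler b 1 l t) (m : ℕ) {t : ℝ} (ht : 0 < t) :
    iteratedDeriv m f t = mittagLeffler b (1 - m) l t := by
  induction m generalizing t with
  | zero => simpa using hf t ht
  | succ m ih =>
    have hev : iteratedDeriv m f =ᶠ[𝓝 t] mittagLeffler b (1 - m) l := by
      filter_upwards [lt_mem_nhds ht] with s hs using ih hs
    rw [iteratedDeriv_succ, hev.deriv_eq, (hasDerivAt_mittagLeffler hb _ l ht).deriv]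
    congr 1
    push_cast
    ring

theorem ceil_pos_of_pos (hb : 0 < b) : 1 ≤ ⌈b⌉₊ := Nat.one_le_ceil_iff.2 hb

/-- With m = ⌈b⌉, the m-th derivative has parameter 1-m, and its leading term drops because 1/Γ(1-m)
= 0. What remains has parameter b+1-m > 0, hence is integrable at 0. -/
theorem iteratedDeriv_ceil_mittagLeffler (hb : 0 < b) (l : ℂ) {f : ℝ → ℂ}
    (hf : ∀ t, 0 < t → f t = mittagLeffler b 1 l t) {t : ℝ} (ht : 0 < t) :
    iteratedDeriv ⌈b⌉₊ f t = -l * mittagLeffler b (b + (1 - ⌈b⌉₊)) l t := by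
  obtain ⟨k, hk⟩ : ∃ k, ⌈b⌉₊ = k + 1 := ⟨⌈b⌉₊ - 1, by have := ceil_pos_of_pos hb; omega⟩
  have h0 : Real.Gamma (1 - ⌈b⌉₊) = 0 := by
    rw [hk, show (1 : ℝ) - ((k + 1 : ℕ) : ℝ) = -(k : ℝ) by push_cast; ring]
    exact Real.Gamma_neg_nat_eq_zero k
  rw [iteratedDeriv_mittagLeffler hb l hf _ ht, mittagLeffler_eq_add hb _ l ht, h0]
  simp

theorem ceil_lt_add_one' (hb : 0 < b) : 0 < b + (1 - (⌈b⌉₊ : ℝ)) := by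
  linarith [Nat.ceil_lt_add_one hb.le]

/-- The fractional integral of order m-b raises the parameter b+1-m of the m-th derivative back to
1; for b = m it is 1 already. -/
theorem caputoDeriv_mittagLeffler (hb : 0 < b) (l : ℂ) {f : ℝ → ℂ}
    (hf : ∀ t, 0 < t → f t = mittagLeffler b 1 l t) {t : ℝ} (ht : 0 < t) :
    caputoDeriv b f t = -l * f t := by
  rw [caputoDeriv]
  split_ifs with h
  · rw [iteratedDeriv_ceil_mittagLeffler hb l hf ht, hf t ht, ← h]
    ring_nf
  · have hm : 0 < (⌈b⌉₊ : ℝ) - b := sub_pos.2 (lt_of_le_of_ne (Nat.le_ceil b) h)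
    have h1 : ∫ τ in (0 : ℝ)..t, ((t - τ) ^ ((⌈b⌉₊ : ℝ) - b - 1) : ℝ) • iteratedDeriv ⌈b⌉₊ f τ =
        -l * ∫ τ in (0 : ℝ)..t, ((t - τ) ^ ((⌈b⌉₊ : ℝ) - b - 1) : ℝ) •
          mittagLeffler b (b + (1 - ⌈b⌉₊)) l τ := by
      rw [← intervalIntegral.integral_const_mul]
      refine intervalIntegral.integral_congr_ae (Eventually.of_forall fun τ hτ => ?_)
      rw [uIoc_of_le ht.le] at hτ
      rw [iteratedDeriv_ceil_mittagLeffler hb l hf hτ.1, Complex.real_smul, Complex.real_smul]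
      ring
    rw [h1, fracIntegral_mittagLeffler hb hm (ceil_lt_add_one' hb) l ht, hf t ht]
    have e : (⌈b⌉₊ : ℝ) - b + (b + (1 - ⌈b⌉₊)) = 1 := by ring
    have hΓ : ((Real.Gamma ((⌈b⌉₊ : ℝ) - b) : ℝ) : ℂ) ≠ 0 := by
      exact_mod_cast (Real.Gamma_pos_of_pos hm).ne'
    rw [e, Complex.real_smul, Complex.real_smul, Complex.ofReal_inv]
    field_simp

theorem isGreenFunction_of_fourierIn {α θ : ℝ} (hb : 0 < b) {G : ℝ → Measure ℝ}
    (hfin : ∀ t, 0 < t → IsFiniteMeasure (G t))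
    (hG : ∀ κ t, 0 < t → fourierIn G κ t = mittagLeffler b 1 (fellerSymbol α θ κ) t) :
    IsGreenFunction α b θ G where
  finite := hfin
  smooth κ := (contDiffOn_mittagLeffler hb _ _ 1).congr fun t ht => hG κ t ht
  integrable κ T hT := by
    refine IntegrableOn.congr_fun ((integrableOn_mittagLeffler hb (ceil_lt_add_one' hb)
      (fellerSymbol α θ κ) hT).const_mul (-fellerSymbol α θ κ)) (fun t ht => ?_) measurableSet_Ioc
    exact (iteratedDeriv_ceil_mittagLeffler hb _ (hG κ) ht.1).symm
  equation κ t ht := (caputoDeriv_mittagLeffler hb _ (hG κ) ht).symm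
  initial κ := (tendsto_mittagLeffler_one hb _).congr' (by
    filter_upwards [self_mem_nhdsWithin] with t ht using (hG κ t ht).symm)
  initial_deriv h1 κ := by
    have h := (tendsto_mittagLeffler_zero hb h1 (fellerSymbol α θ κ)).const_mul
      (-fellerSymbol α θ κ)
    rw [mul_zero] at h
    refine h.congr' ?_
    filter_upwards [self_mem_nhdsWithin] with t ht
    have h2 := iteratedDeriv_mittagLeffler hb _ (hG κ) 1 ht
    rw [iteratedDeriv_one] at h2
    rw [h2, mittagLeffler_eq_add hb (1 - (1 : ℕ)) _ ht]
    simp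
end MittagLeffler

/-! ### From the Caputo equation to a Volterra equation; uniqueness -/

/-- Semigroup property of fractional integration, for total order at least one. -/
theorem fracIntegral_fracIntegral {a c t : ℝ} (ha : 0 < a) (hc : 0 < c) (hac : 1 ≤ a + c)
    (ht : 0 < t) {g : ℝ → ℂ} (hg : IntegrableOn g (Ioc 0 t)) :
    ∫ s in (0 : ℝ)..t, ((t - s) ^ (a - 1) : ℝ) • ∫ u in (0 : ℝ)..s, ((s - u) ^ (c - 1) : ℝ) • g u =
      (Real.Gamma a * Real.Gamma c / Real.Gamma (a + c)) •
        ∫ u in (0 : ℝ)..t, ((t - u) ^ (a + c - 1) : ℝ) • g u := by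
  set B := Real.Gamma a * Real.Gamma c / Real.Gamma (a + c) with hB
  have hB0 : 0 < B := by
    have h1 := Real.Gamma_pos_of_pos ha
    have h2 := Real.Gamma_pos_of_pos hc
    have h3 := Real.Gamma_pos_of_pos (add_pos ha hc)
    positivity
  set k : ℝ → ℝ → ℝ := fun s u => if u < s then (t - s) ^ (a - 1) * (s - u) ^ (c - 1) else 0 with hk
  have hkm : Measurable fun p : ℝ × ℝ => k p.1 p.2 := by
    refine Measurable.ite (measurableSet_lt measurable_snd measurable_fst) ?_ measurable_const
    fun_prop
  -- the inner kernel integrates to a beta integral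
  have hshift : ∀ u ∈ Ioo 0 t, IntegrableOn (fun s => k s u) (Ioc 0 t) ∧
      ∫ s in Ioc 0 t, k s u = B * (t - u) ^ (a + c - 1) := by
    intro u hu
    have htu : 0 < t - u := by linarith [hu.2]
    have hind : (Ioc 0 t).indicator (fun s => k s u) =
        fun s => (Ioc 0 (t - u)).indicator
          (fun v => (t - u - v) ^ (a - 1) * v ^ (c - 1)) (s - u) := by
      ext s
      by_cases hs : s ∈ Ioc u t
      · have h1 : s ∈ Ioc 0 t := ⟨hu.1.trans hs.1, hs.2⟩
        have h2 : s - u ∈ Ioc 0 (t - u) := ⟨by linarith [hs.1], by linarith [hs.2]⟩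
        rw [indicator_of_mem h1, indicator_of_mem h2, hk]
        simp only [hs.1, if_true]
        ring_nf
      · have h2 : s - u ∉ Ioc 0 (t - u) := fun h => hs ⟨by linarith [h.1], by linarith [h.2]⟩
        rw [indicator_of_notMem h2]
        by_cases h1 : s ∈ Ioc 0 t
        · rw [indicator_of_mem h1, hk]
          have : ¬ u < s := fun h => hs ⟨h, h1.2⟩
          simp only [this, if_false]
        · rw [indicator_of_notMem h1]
    constructor
    · rw [← integrable_indicator_iff measurableSet_Ioc, hind]
      exact ((integrable_indicator_iff measurableSet_Ioc).2
        (integrableOn_beta ha hc htu)).comp_sub_right u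
    · rw [← integral_indicator measurableSet_Ioc, hind,
        integral_sub_right_eq_self (fun s => (Ioc 0 (t - u)).indicator
          (fun v => (t - u - v) ^ (a - 1) * v ^ (c - 1)) s) u,
        integral_indicator measurableSet_Ioc, setIntegral_beta ha hc htu]
  have hkn : ∀ u, ∀ s ∈ Ioc 0 t, 0 ≤ k s u := by
    intro u s hs
    rw [hk]
    dsimp only
    split_ifs with h
    · have h1 : 0 ≤ t - s := by linarith [hs.2]
      have h2 : 0 ≤ s - u := by linarith
      positivity
    · exact le_rfl
  have hae : ∀ᵐ u ∂(volume.restrict (Ioc 0 t)), u ∈ Ioo 0 t := by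
    rw [← restrict_Ioo_eq_restrict_Ioc]
    exact ae_restrict_mem measurableSet_Ioo
  have hprod : Integrable (fun p : ℝ × ℝ => k p.1 p.2 • g p.2)
      ((volume.restrict (Ioc 0 t)).prod (volume.restrict (Ioc 0 t))) := by
    rw [integrable_prod_iff']
    · refine ⟨hae.mono fun u hu => (hshift u hu).1.smul_const (g u), ?_⟩
      -- Here a + c ≥ 1 matters: (t-u)^{a+c-1} ≤ t^{a+c-1}, so integrability of g alone justifies
      -- Fubini at every t.
      have hb : Integrable (fun u => (B * t ^ (a + c - 1)) * ‖g u‖) (volume.restrict (Ioc 0 t)) :=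
        hg.norm.const_mul _
      refine hb.mono' ?_ (hae.mono fun u hu => ?_)
      · exact (hkm.aestronglyMeasurable.smul hg.1.comp_snd).norm.prod_swap.integral_prod_right'
      · have h1 : ∫ s in Ioc 0 t, ‖k s u • g u‖ = B * (t - u) ^ (a + c - 1) * ‖g u‖ := by
          rw [← (hshift u hu).2, ← integral_mul_const]
          refine setIntegral_congr_fun measurableSet_Ioc fun s hs => ?_
          rw [norm_smul, Real.norm_of_nonneg (hkn u s hs)]
        have h2 : 0 ≤ t - u := by linarith [hu.2]
        have h3 : t - u ≤ t := by linarith [hu.1]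
        rw [h1, Real.norm_of_nonneg (by positivity)]
        gcongr
    · exact hkm.aestronglyMeasurable.smul hg.1.comp_snd
  have hleft : ∫ s in (0 : ℝ)..t, ((t - s) ^ (a - 1) : ℝ) •
      ∫ u in (0 : ℝ)..s, ((s - u) ^ (c - 1) : ℝ) • g u =
      ∫ s in Ioc 0 t, ∫ u in Ioc 0 t, k s u • g u := by
    rw [intervalIntegral.integral_of_le ht.le]
    refine setIntegral_congr_fun measurableSet_Ioc fun s hs => ?_
    rw [intervalIntegral.integral_of_le hs.1.le, integral_Ioc_eq_integral_Ioo, ← integral_smul,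
      ← integral_indicator measurableSet_Ioo, ← integral_indicator measurableSet_Ioc]
    congr 1
    ext u
    by_cases hu : u ∈ Ioo 0 s
    · have hu' : u ∈ Ioc 0 t := ⟨hu.1, hu.2.le.trans hs.2⟩
      rw [indicator_of_mem hu, indicator_of_mem hu', hk]
      simp only [hu.2, if_true, smul_smul]
    · rw [indicator_of_notMem hu]
      by_cases hu' : u ∈ Ioc 0 t
      · have : ¬ u < s := fun h => hu ⟨hu'.1, h⟩
        rw [indicator_of_mem hu', hk]
        simp only [this, if_false, zero_smul]
      · rw [indicator_of_notMem hu']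
  rw [hleft, integral_integral_swap hprod, intervalIntegral.integral_of_le ht.le, ← integral_smul]
  refine integral_congr_ae (hae.mono fun u hu => ?_)
  dsimp only
  rw [integral_smul_const, (hshift u hu).2, smul_smul]

/-- Uniqueness for the homogeneous Abel–Volterra equation of the second kind. -/
theorem eq_zero_of_volterra {b : ℝ} (hb : 0 < b) (l : ℂ) {h : ℝ → ℂ} {T M : ℝ}
    (hM : ∀ t ∈ Ioc 0 T, ‖h t‖ ≤ M)
    (hV : ∀ t ∈ Ioc 0 T, h t = l * ∫ s in (0 : ℝ)..t, ((t - s) ^ (b - 1) : ℝ) • h s) :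
    ∀ t ∈ Ioc 0 T, h t = 0 := by
  intro t₀ ht₀
  have hM0 : 0 ≤ M := (norm_nonneg _).trans (hM t₀ ht₀)
  have hΓ := Real.Gamma_pos_of_pos hb
  -- In the norm weighted by exp(-kt) the Volterra operator has norm at most |l| k^{-b} Γ(b). For
  -- this k it is a contraction with factor 1/2, and iteration sends the bound on h to 0.
  obtain ⟨k, hk0, hk⟩ : ∃ k : ℝ, 0 < k ∧ ‖l‖ * ((1 / k) ^ b * Real.Gamma b) ≤ 1 / 2 := by
    have h1 : Tendsto (fun k : ℝ => ‖l‖ * ((1 / k) ^ b * Real.Gamma b)) atTop (𝓝 0) := by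
      have h2 : Tendsto (fun k : ℝ => (1 / k) ^ b) atTop (𝓝 0) := by
        refine (tendsto_rpow_neg_atTop hb).congr' ?_
        filter_upwards [eventually_gt_atTop 0] with k hk
        rw [one_div, Real.inv_rpow hk.le, Real.rpow_neg hk.le]
      simpa using (h2.mul_const (Real.Gamma b)).const_mul ‖l‖
    obtain ⟨k, hk1, hk2⟩ := ((eventually_gt_atTop 0).and
      (h1.eventually (gt_mem_nhds (by norm_num : (0 : ℝ) < 1 / 2)))).exists
    exact ⟨k, hk1, hk2.le⟩
  have hkernel : ∀ t ∈ Ioc 0 T, IntegrableOn (fun s => (t - s) ^ (b - 1) * Real.exp (k * s))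
      (Ioc 0 t) ∧ ∫ s in Ioc 0 t, (t - s) ^ (b - 1) * Real.exp (k * s) ≤
        Real.exp (k * t) * ((1 / k) ^ b * Real.Gamma b) := by
    intro t ht
    have hi := integrableOn_rpow_mul_exp_neg_mul hb hk0
    have e : (fun s => (t - s) ^ (b - 1) * Real.exp (k * s)) = fun s =>
        Real.exp (k * t) * (fun v => v ^ (b - 1) * Real.exp (-(k * v))) (t - s) := by
      ext s
      dsimp only
      rw [mul_left_comm, ← Real.exp_add]
      ring_nf
    have hI : IntervalIntegrable (fun v => v ^ (b - 1) * Real.exp (-(k * v))) volume 0 t :=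
      (intervalIntegrable_iff_integrableOn_Ioc_of_le ht.1.le).2 (hi.mono_set Ioc_subset_Ioi_self)
    constructor
    · rw [← intervalIntegrable_iff_integrableOn_Ioc_of_le ht.1.le, e]
      have := (hI.comp_sub_left t).symm
      simp only [sub_self, sub_zero] at this
      exact this.const_mul _
    · rw [← intervalIntegral.integral_of_le ht.1.le, e, intervalIntegral.integral_const_mul,
        intervalIntegral.integral_comp_sub_left (fun v => v ^ (b - 1) * Real.exp (-(k * v))),
        sub_self, sub_zero, ← Real.integral_rpow_mul_exp_neg_mul_Ioi hb hk0,
        intervalIntegral.integral_of_le ht.1.le]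
      refine mul_le_mul_of_nonneg_left
        (setIntegral_mono_set hi ?_ Ioc_subset_Ioi_self.eventuallyLE) (Real.exp_pos _).le
      refine (ae_restrict_mem measurableSet_Ioi).mono fun v hv => ?_
      have hv : 0 < v := hv
      dsimp only [Pi.zero_apply]
      positivity
  have hiter : ∀ n : ℕ, ∀ t ∈ Ioc 0 T, ‖h t‖ ≤ M * (1 / 2) ^ n * Real.exp (k * t) := by
    intro n
    induction n with
    | zero =>
      intro t ht
      have : 1 ≤ Real.exp (k * t) := Real.one_le_exp (mul_nonneg hk0.le ht.1.le)
      have := hM t ht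
      nlinarith
    | succ n ih =>
      intro t ht
      obtain ⟨h1, h2⟩ := hkernel t ht
      rw [hV t ht, norm_mul, intervalIntegral.integral_of_le ht.1.le]
      calc ‖l‖ * ‖∫ s in Ioc 0 t, ((t - s) ^ (b - 1) : ℝ) • h s‖
          ≤ ‖l‖ * ∫ s in Ioc 0 t, M * (1 / 2) ^ n * ((t - s) ^ (b - 1) * Real.exp (k * s)) := by
            gcongr
            refine norm_integral_le_of_norm_le (h1.const_mul _)
              ((ae_restrict_mem measurableSet_Ioc).mono fun s hs => ?_)
            have h3 : 0 ≤ t - s := by linarith [hs.2]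
            have h4 := ih s ⟨hs.1, hs.2.trans ht.2⟩
            rw [norm_smul, Real.norm_of_nonneg (by positivity), mul_left_comm]
            gcongr
        _ ≤ ‖l‖ * (M * (1 / 2) ^ n * (Real.exp (k * t) * ((1 / k) ^ b * Real.Gamma b))) := by
            rw [integral_const_mul]
            gcongr
        _ = M * (1 / 2) ^ n * Real.exp (k * t) * (‖l‖ * ((1 / k) ^ b * Real.Gamma b)) := by ring
        _ ≤ M * (1 / 2) ^ n * Real.exp (k * t) * (1 / 2) := by gcongr
        _ = M * (1 / 2) ^ (n + 1) * Real.exp (k * t) := by ring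
  have hlim : Tendsto (fun n : ℕ => M * (1 / 2) ^ n * Real.exp (k * t₀)) atTop (𝓝 0) := by
    have := ((tendsto_pow_atTop_nhds_zero_of_lt_one (r := (1 / 2 : ℝ)) (by norm_num)
      (by norm_num)).const_mul M).mul_const (Real.exp (k * t₀))
    simpa using this
  exact norm_le_zero_iff.1 (ge_of_tendsto' hlim fun n => hiter n t₀ ht₀)

theorem exists_bound_of_tendsto {f : ℝ → ℂ} {L : ℂ} (hc : ContinuousOn f (Ioi 0))
    (hf : Tendsto f (𝓝[>] 0) (𝓝 L)) (T : ℝ) : ∃ M, ∀ t ∈ Ioc 0 T, ‖f t‖ ≤ M := by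
  have h1 : ∀ᶠ t in 𝓝[>] (0 : ℝ), ‖f t‖ ≤ ‖L‖ + 1 :=
    (hf.norm.eventually (gt_mem_nhds (lt_add_one _))).mono fun _ h => h.le
  obtain ⟨δ, hδ, hδ'⟩ := mem_nhdsGT_iff_exists_Ioc_subset.1 h1
  have hδ : 0 < δ := hδ
  obtain ⟨M, hM⟩ := (isCompact_Icc (a := δ) (b := T)).exists_bound_of_continuousOn
    (hc.mono fun t ht => hδ.trans_le ht.1)
  refine ⟨max (‖L‖ + 1) M, fun t ht => ?_⟩
  rcases le_total t δ with h | h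
  · exact (hδ' ⟨ht.1, h⟩).trans (le_max_left _ _)
  · exact (hM t ⟨h, ht.2⟩).trans (le_max_right _ _)

section Uniqueness

variable {b : ℝ} {f : ℝ → ℂ}

/-- Taylor's formula with integral remainder at `0⁺`, to order `⌈b⌉`. -/
theorem eq_one_add_integral_iteratedDeriv (hb : 0 < b) (hb2 : b ≤ 2)
    (hsm : ContDiffOn ℝ (⌈b⌉₊ : ℕ) f (Ioi 0))
    (hint : ∀ T, 0 < T → IntegrableOn (iteratedDeriv ⌈b⌉₊ f) (Ioc 0 T))
    (hf : Tendsto f (𝓝[>] 0) (𝓝 1)) (hf' : 1 < b → Tendsto (deriv f) (𝓝[>] 0) (𝓝 0))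
    {t : ℝ} (ht : 0 < t) :
    f t = 1 + ∫ s in (0 : ℝ)..t, ((t - s) ^ ((⌈b⌉₊ : ℝ) - 1) : ℝ) • iteratedDeriv ⌈b⌉₊ f s := by
  have hii := (intervalIntegrable_iff_integrableOn_Ioc_of_le ht.le).2 (hint t ht)
  have hleft : Tendsto f (𝓝[<] t) (𝓝 (f t)) :=
    ((hsm.continuousOn.continuousAt (Ioi_mem_nhds ht)).tendsto).mono_left nhdsWithin_le_nhds
  rcases le_or_gt b 1 with h1 | h1
  · have hm : ⌈b⌉₊ = 1 := by
      have h2 : ⌈b⌉₊ ≤ 1 := Nat.ceil_le.2 (by exact_mod_cast h1)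
      have := ceil_pos_of_pos hb
      omega
    rw [hm] at hii hsm ⊢
    rw [iteratedDeriv_one] at hii ⊢
    have := intervalIntegral.integral_eq_sub_of_hasDerivAt_of_tendsto ht (f := f) (f' := deriv f)
      (fun s hs => ((hsm.differentiableOn (by simp)).differentiableAt
        (Ioi_mem_nhds hs.1)).hasDerivAt) hii hf hleft
    simp only [Nat.cast_one, sub_self, Real.rpow_zero, one_smul]
    rw [this]
    ring
  · have hm : ⌈b⌉₊ = 2 := by
      have h2 : ⌈b⌉₊ ≤ 2 := Nat.ceil_le.2 (by exact_mod_cast hb2)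
      have := Nat.lt_ceil.2 (by exact_mod_cast h1 : ((1 : ℕ) : ℝ) < b)
      omega
    rw [hm] at hii hsm ⊢
    have hi2 : iteratedDeriv 2 f = deriv (deriv f) := by
      rw [iteratedDeriv_succ, iteratedDeriv_one]
    rw [hi2] at hii ⊢
    have hsm1 : ContDiffOn ℝ (1 : ℕ) (deriv f) (Ioi 0) :=
      hsm.deriv_of_isOpen isOpen_Ioi (by norm_num)
    have hd1 : ∀ s : ℝ, 0 < s → HasDerivAt f (deriv f s) s := fun s hs =>
      ((hsm.differentiableOn (by simp)).differentiableAt (Ioi_mem_nhds hs)).hasDerivAt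
    have hd2 : ∀ s : ℝ, 0 < s → HasDerivAt (deriv f) (deriv (deriv f) s) s := fun s hs =>
      ((hsm1.differentiableOn (by simp)).differentiableAt (Ioi_mem_nhds hs)).hasDerivAt
    have hlin : ∀ s : ℝ, HasDerivAt (fun s : ℝ => (((t - s) : ℝ) : ℂ)) (-1) s := by
      intro s
      have := ((hasDerivAt_id s).const_sub t).ofReal_comp
      simpa using this
    have hlint : Tendsto (fun s : ℝ => (((t - s) : ℝ) : ℂ)) (𝓝[>] 0) (𝓝 t) := by
      have : Continuous fun s : ℝ => (((t - s) : ℝ) : ℂ) := by fun_prop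
      simpa using (this.tendsto 0).mono_left nhdsWithin_le_nhds
    have hlinl : Tendsto (fun s : ℝ => (((t - s) : ℝ) : ℂ)) (𝓝[<] t) (𝓝 0) := by
      have : Continuous fun s : ℝ => (((t - s) : ℝ) : ℂ) := by fun_prop
      simpa using (this.tendsto t).mono_left nhdsWithin_le_nhds
    have hleft' : Tendsto (deriv f) (𝓝[<] t) (𝓝 (deriv f t)) :=
      (hd2 t ht).continuousAt.tendsto.mono_left nhdsWithin_le_nhds
    have hii' : IntervalIntegrable (fun s => (((t - s) : ℝ) : ℂ) * deriv (deriv f) s) volume 0 t :=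
      hii.continuousOn_mul (Continuous.continuousOn (by fun_prop))
    -- The function (t-s) f'(s) + f(s) is a primitive of (t-s) f''(s); it tends to 1 at 0⁺, by both
    -- initial conditions, and to f(t) at t.
    have := intervalIntegral.integral_eq_sub_of_hasDerivAt_of_tendsto ht
      (f := fun s => (((t - s) : ℝ) : ℂ) * deriv f s + f s)
      (f' := fun s => (((t - s) : ℝ) : ℂ) * deriv (deriv f) s)
      (fun s hs => by
        convert! ((hlin s).mul (hd2 s hs.1)).add (hd1 s hs.1) using 1
        ring) hii' ((hlint.mul (hf' h1)).add hf) ((hlinl.mul hleft').add hleft)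
    have e : ∀ s : ℝ, ((t - s) ^ (((2 : ℕ) : ℝ) - 1) : ℝ) • deriv (deriv f) s =
        (((t - s) : ℝ) : ℂ) * deriv (deriv f) s := by
      intro s
      rw [Complex.real_smul]
      norm_num
    simp only [e]
    rw [this]
    ring

/-- Apply the fractional integral of order b to the equation: composed with the one of order m-b
inside the Caputo derivative, it gives the m-fold integral of f^{(m)}, which is f - 1 by Taylor. As
m is 1 or 2, Γ(m) = 1. -/
theorem volterra_of_caputo (hb : 0 < b) (hb2 : b ≤ 2) (l : ℂ)
    (hsm : ContDiffOn ℝ (⌈b⌉₊ : ℕ) f (Ioi 0))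
    (hint : ∀ T, 0 < T → IntegrableOn (iteratedDeriv ⌈b⌉₊ f) (Ioc 0 T))
    (heq : ∀ t, 0 < t → -l * f t = caputoDeriv b f t)
    (hf : Tendsto f (𝓝[>] 0) (𝓝 1)) (hf' : 1 < b → Tendsto (deriv f) (𝓝[>] 0) (𝓝 0))
    {t : ℝ} (ht : 0 < t) :
    f t = 1 - l * ((Real.Gamma b)⁻¹ : ℝ) * ∫ s in (0 : ℝ)..t, ((t - s) ^ (b - 1) : ℝ) • f s := by
  have hT := eq_one_add_integral_iteratedDeriv hb hb2 hsm hint hf hf' ht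
  have hmΓ : Real.Gamma (⌈b⌉₊ : ℝ) = 1 := by
    have h2 : ⌈b⌉₊ ≤ 2 := Nat.ceil_le.2 (by exact_mod_cast hb2)
    have := ceil_pos_of_pos hb
    interval_cases h : ⌈b⌉₊ <;> simp
  have hcap : ∀ s, 0 < s → caputoDeriv b f s = -l * f s := fun s hs => (heq s hs).symm
  by_cases h : b = (⌈b⌉₊ : ℝ)
  · have hΓ : Real.Gamma b = 1 := by rw [h, hmΓ]
    have hc : ∀ s, 0 < s → iteratedDeriv ⌈b⌉₊ f s = -l * f s := by
      intro s hs
      rw [← hcap s hs, caputoDeriv, if_pos h]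
    have hI : ∫ s in (0 : ℝ)..t, ((t - s) ^ ((⌈b⌉₊ : ℝ) - 1) : ℝ) • iteratedDeriv ⌈b⌉₊ f s =
        -l * ∫ s in (0 : ℝ)..t, ((t - s) ^ (b - 1) : ℝ) • f s := by
      rw [← intervalIntegral.integral_const_mul]
      refine intervalIntegral.integral_congr_ae (Eventually.of_forall fun s hs => ?_)
      rw [uIoc_of_le ht.le] at hs
      rw [hc s hs.1, ← h, Complex.real_smul, Complex.real_smul]
      ring
    rw [hT, hI, hΓ]
    push_cast
    ring
  · have hm : 0 < (⌈b⌉₊ : ℝ) - b := sub_pos.2 (lt_of_le_of_ne (Nat.le_ceil b) h)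
    have hΓ : Real.Gamma ((⌈b⌉₊ : ℝ) - b) ≠ 0 := (Real.Gamma_pos_of_pos hm).ne'
    have hc : ∀ s, 0 < s → ∫ τ in (0 : ℝ)..s, ((s - τ) ^ ((⌈b⌉₊ : ℝ) - b - 1) : ℝ) •
        iteratedDeriv ⌈b⌉₊ f τ = Real.Gamma ((⌈b⌉₊ : ℝ) - b) • (-l * f s) := by
      intro s hs
      rw [← hcap s hs, caputoDeriv, if_neg h, smul_smul, mul_inv_cancel₀ hΓ, one_smul]
    have hF := fracIntegral_fracIntegral hb hm (by
      have := ceil_pos_of_pos hb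
      have : (1 : ℝ) ≤ ⌈b⌉₊ := by exact_mod_cast this
      linarith) ht (hint t ht)
    have e : b + ((⌈b⌉₊ : ℝ) - b) = ⌈b⌉₊ := by ring
    rw [e, hmΓ, div_one] at hF
    have hI : ∫ s in (0 : ℝ)..t, ((t - s) ^ (b - 1) : ℝ) • ∫ τ in (0 : ℝ)..s,
        ((s - τ) ^ ((⌈b⌉₊ : ℝ) - b - 1) : ℝ) • iteratedDeriv ⌈b⌉₊ f τ =
        (-l * Real.Gamma ((⌈b⌉₊ : ℝ) - b)) *
          ∫ s in (0 : ℝ)..t, ((t - s) ^ (b - 1) : ℝ) • f s := by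
      rw [← intervalIntegral.integral_const_mul]
      refine intervalIntegral.integral_congr_ae (Eventually.of_forall fun s hs => ?_)
      rw [uIoc_of_le ht.le] at hs
      rw [hc s hs.1, Complex.real_smul, Complex.real_smul, Complex.real_smul]
      ring
    rw [hI, Complex.real_smul] at hF
    rw [hT]
    have hΓb : ((Real.Gamma b : ℝ) : ℂ) ≠ 0 := by exact_mod_cast (Real.Gamma_pos_of_pos hb).ne'
    have hΓ' : ((Real.Gamma ((⌈b⌉₊ : ℝ) - b) : ℝ) : ℂ) ≠ 0 := by exact_mod_cast hΓ
    rw [Complex.ofReal_mul] at hF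
    have hF' : ((Real.Gamma b : ℝ) : ℂ) * ∫ u in (0 : ℝ)..t,
        ((t - u) ^ ((⌈b⌉₊ : ℝ) - 1) : ℝ) • iteratedDeriv ⌈b⌉₊ f u =
        -l * ∫ s in (0 : ℝ)..t, ((t - s) ^ (b - 1) : ℝ) • f s := by
      refine mul_left_cancel₀ hΓ' ?_
      linear_combination -hF
    rw [(eq_inv_mul_iff_mul_eq₀ hΓb).2 hF', Complex.ofReal_inv]
    ring

/-- Both functions solve the same Volterra equation and are bounded near 0 because they have limits
there; their difference solves the homogeneous one. -/
theorem eq_mittagLeffler_of_caputo (hb : 0 < b) (hb2 : b ≤ 2) (l : ℂ)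
    (hsm : ContDiffOn ℝ (⌈b⌉₊ : ℕ) f (Ioi 0))
    (hint : ∀ T, 0 < T → IntegrableOn (iteratedDeriv ⌈b⌉₊ f) (Ioc 0 T))
    (heq : ∀ t, 0 < t → -l * f t = caputoDeriv b f t)
    (hf : Tendsto f (𝓝[>] 0) (𝓝 1)) (hf' : 1 < b → Tendsto (deriv f) (𝓝[>] 0) (𝓝 0))
    {t : ℝ} (ht : 0 < t) : f t = mittagLeffler b 1 l t := by
  have hΓ : Real.Gamma b ≠ 0 := (Real.Gamma_pos_of_pos hb).ne'
  have hml : ∀ t, 0 < t → mittagLeffler b 1 l t = 1 - l * ((Real.Gamma b)⁻¹ : ℝ) *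
      ∫ s in (0 : ℝ)..t, ((t - s) ^ (b - 1) : ℝ) • mittagLeffler b 1 l s := by
    intro t ht
    rw [fracIntegral_mittagLeffler hb hb one_pos l ht, mittagLeffler_eq_add hb 1 l ht,
      Complex.real_smul]
    have : ((Real.Gamma b : ℝ) : ℂ) ≠ 0 := by exact_mod_cast hΓ
    simp only [sub_self, Real.rpow_zero, Real.Gamma_one]
    push_cast
    field_simp
  obtain ⟨M1, hM1⟩ := exists_bound_of_tendsto hsm.continuousOn hf t
  obtain ⟨M2, hM2⟩ := exists_bound_of_tendsto (continuousOn_mittagLeffler hb 1 l)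
    (tendsto_mittagLeffler_one hb l) t
  have hkint : ∀ {g : ℝ → ℂ} {M s : ℝ}, ContinuousOn g (Ioi 0) → (∀ u ∈ Ioc 0 t, ‖g u‖ ≤ M) →
      s ∈ Ioc 0 t → IntervalIntegrable (fun u => ((s - u) ^ (b - 1) : ℝ) • g u) volume 0 s := by
    intro g M s hg hM hs
    rw [intervalIntegrable_iff_integrableOn_Ioc_of_le hs.1.le]
    have h1 : IntegrableOn (fun u => (s - u) ^ (b - 1)) (Ioc 0 s) := by
      have := integrableOn_beta hb one_pos hs.1
      simpa using this
    refine Integrable.smul_bdd h1 M ?_ ?_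
    · exact (hg.mono Ioc_subset_Ioi_self).aestronglyMeasurable measurableSet_Ioc
    · exact (ae_restrict_mem measurableSet_Ioc).mono fun u hu => hM u ⟨hu.1, hu.2.trans hs.2⟩
  have hzero := eq_zero_of_volterra (h := fun s => f s - mittagLeffler b 1 l s) (M := M1 + M2)
    (T := t) hb (-(l * ((Real.Gamma b)⁻¹ : ℝ)))
    (fun s hs => (norm_sub_le _ _).trans (add_le_add (hM1 s hs) (hM2 s hs))) (fun s hs => by
      have h1 := volterra_of_caputo hb hb2 l hsm hint heq hf hf' hs.1
      have h2 := hml s hs.1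
      simp only [smul_sub]
      rw [intervalIntegral.integral_sub (hkint hsm.continuousOn hM1 hs)
        (hkint (continuousOn_mittagLeffler hb 1 l) hM2 hs)]
      linear_combination h1 - h2) t ⟨ht, le_rfl⟩
  exact sub_eq_zero.1 hzero

theorem IsGreenFunction.fourierIn_eq {α θ : ℝ} (hb : 0 < b) (hb2 : b ≤ 2) {G : ℝ → Measure ℝ}
    (hG : IsGreenFunction α b θ G) (κ : ℝ) {t : ℝ} (ht : 0 < t) :
    fourierIn G κ t = mittagLeffler b 1 (fellerSymbol α θ κ) t :=
  eq_mittagLeffler_of_caputo hb hb2 _ (hG.smooth κ) (hG.integrable κ)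
    (hG.equation κ) (hG.initial κ) (fun h => hG.initial_deriv h κ) ht

end Uniqueness

/-! ### Stable laws, the directing law and subordination of measures -/

theorem integral_withDensity_ofReal {X : Type*} [MeasurableSpace X] {μ : Measure X} {f : X → ℝ}
    (hf : AEMeasurable f μ) (h0 : 0 ≤ᵐ[μ] f) (g : X → ℂ) :
    ∫ x, g x ∂(μ.withDensity fun x => ENNReal.ofReal (f x)) = ∫ x, g x * (f x : ℂ) ∂μ := by
  rw [integral_withDensity_eq_integral_toReal_smul₀ hf.ennreal_ofReal
    (Eventually.of_forall fun _ => ENNReal.ofReal_lt_top)]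
  refine integral_congr_ae (h0.mono fun x hx => ?_)
  dsimp only
  rw [ENNReal.toReal_ofReal hx, Complex.real_smul, mul_comm]

theorem fellerSymbol_one_of_sq_eq_one {θ : ℝ} (hθ : θ = 1 ∨ θ = -1) (κ : ℝ) :
    fellerSymbol 1 θ κ = Complex.I * κ * θ := by
  rw [fellerSymbol, Real.rpow_one, mul_comm Complex.I]
  rcases lt_trichotomy κ 0 with h | rfl | h
  · rw [abs_of_neg h, Real.sign_of_neg h]
    rcases hθ with rfl | rfl
    · rw [show (((-1 * 1 * Real.pi / 2 : ℝ) : ℂ) * Complex.I) = -(Real.pi / 2 * Complex.I) by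
        push_cast; ring, Complex.exp_neg, Complex.exp_pi_div_two_mul_I, Complex.inv_I]
      push_cast
      ring
    · rw [show (((-1 * -1 * Real.pi / 2 : ℝ) : ℂ) * Complex.I) = Real.pi / 2 * Complex.I by
        push_cast; ring, Complex.exp_pi_div_two_mul_I]
      push_cast
      ring
  · simp
  · rw [abs_of_pos h, Real.sign_of_pos h]
    rcases hθ with rfl | rfl
    · rw [show (((1 * 1 * Real.pi / 2 : ℝ) : ℂ) * Complex.I) = Real.pi / 2 * Complex.I by
        push_cast; ring, Complex.exp_pi_div_two_mul_I]
      push_cast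
      ring
    · rw [show (((1 * -1 * Real.pi / 2 : ℝ) : ℂ) * Complex.I) = -(Real.pi / 2 * Complex.I) by
        push_cast; ring, Complex.exp_neg, Complex.exp_pi_div_two_mul_I, Complex.inv_I]
      push_cast
      ring

/-- Existence of the strictly stable law with symbol `ψ_α^θ`, including the degenerate ones. -/
theorem exists_stableLaw {α θ : ℝ} (h0 : 0 < α) (h2 : α ≤ 2) (hθ : |θ| ≤ min α (2 - α)) :
    ∃ μ : Measure ℝ, IsFiniteMeasure μ ∧
      ∀ κ : ℝ, ∫ x : ℝ, Complex.exp (Complex.I * κ * x) ∂μ = Complex.exp (-fellerSymbol α θ κ) := by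
  rcases (abs_le_one_of_admissible hθ).lt_or_eq with h1 | h1
  · have hi := integrable_stableDensity h0 h2 hθ h1
    refine ⟨volume.withDensity fun x => ENNReal.ofReal (stableDensity α θ x),
      isFiniteMeasure_withDensity_ofReal hi.2, fun κ => ?_⟩
    rw [integral_withDensity_ofReal hi.1.aemeasurable
      (Eventually.of_forall (stableDensity_nonneg h0 h2 hθ h1)),
      integral_exp_mul_stableDensity h0 h2 hθ h1]
  · have hα : α = 1 := by
      rw [h1, le_min_iff] at hθ
      linarith [hθ.1, hθ.2]
    -- For α = 1, θ = ±1 the symbol is iκθ, a pure drift, and exp(-iκθ) is the transform of a point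
    -- mass at -θ.
    refine ⟨Measure.dirac (-θ), inferInstance, fun κ => ?_⟩
    rw [integral_dirac, hα, fellerSymbol_one_of_sq_eq_one (eq_or_eq_neg_of_abs_eq h1)]
    push_cast
    ring_nf

theorem integral_exp_map_rpow_mul {α θ : ℝ} (h0 : 0 < α) {μ : Measure ℝ}
    (hμ : ∀ κ : ℝ, ∫ x : ℝ, Complex.exp (Complex.I * κ * x) ∂μ =
      Complex.exp (-fellerSymbol α θ κ)) {τ : ℝ} (hτ : 0 < τ) (κ : ℝ) :
    ∫ x : ℝ, Complex.exp (Complex.I * κ * ((τ ^ (1 / α) * x : ℝ) : ℂ)) ∂μ =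
      Complex.exp (-(fellerSymbol α θ κ * τ)) := by
  have h := hμ (τ ^ (1 / α) * κ)
  rw [fellerSymbol_mul (Real.rpow_pos_of_pos hτ _), ← Real.rpow_mul hτ.le,
    one_div_mul_cancel h0.ne', Real.rpow_one, mul_comm (τ : ℂ)] at h
  rw [← h]
  refine integral_congr_ae (Eventually.of_forall fun x => ?_)
  dsimp only
  push_cast
  ring_nf

theorem mittagLeffler_one_one (l : ℂ) (t : ℝ) :
    mittagLeffler 1 1 l t = Complex.exp (-(l * t)) := by
  rw [mittagLeffler, Complex.exp_eq_exp_ℂ, NormedSpace.exp_eq_tsum_div]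
  refine tsum_congr fun n => ?_
  rw [one_mul, add_sub_cancel_right, Real.rpow_natCast, Real.Gamma_nat_eq_factorial, ← neg_mul,
    mul_pow]
  push_cast
  ring

/-- The odd terms cancel, and the even ones form the series of order 2b. This is why the order in
time doubles in the second formula. -/
theorem mittagLeffler_add_neg {b : ℝ} (hb : 0 < b) (l : ℂ) {t : ℝ} (ht : 0 < t) :
    mittagLeffler b 1 l t + mittagLeffler b 1 (-l) t = 2 * mittagLeffler (2 * b) 1 (-l ^ 2) t := by
  rw [mittagLeffler, mittagLeffler, ← (summable_mittagLeffler hb 1 l ht).tsum_add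
    (summable_mittagLeffler hb 1 (-l) ht), mittagLeffler, ← tsum_mul_left]
  have hinj : Function.Injective fun n : ℕ => 2 * n := fun m n h => by simpa using h
  rw [← hinj.tsum_eq]
  · refine tsum_congr fun n => ?_
    rw [neg_neg, neg_neg, pow_mul, pow_mul, neg_sq, show b * ((2 * n : ℕ) : ℝ) = 2 * b * n by
      push_cast; ring]
    ring
  · intro n hn
    rcases n.even_or_odd' with ⟨k, rfl | rfl⟩
    · exact ⟨k, rfl⟩
    · refine absurd ?_ hn
      dsimp only
      rw [neg_neg, Odd.neg_pow ⟨k, rfl⟩]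
      ring

section DirectingLaw

variable {ν t : ℝ}

theorem mWrightAt_nonneg (h0 : 0 < ν) (h1 : ν < 1) (ht : 0 < t) {τ : ℝ} (hτ : 0 ≤ τ) :
    0 ≤ mWrightAt ν τ t :=
  mul_nonneg (Real.rpow_nonneg ht.le _)
    (mWright_nonneg h0 h1 (div_nonneg hτ (Real.rpow_nonneg ht.le _)))

theorem continuousOn_mWrightAt (h0 : 0 < ν) (h1 : ν < 1) (ht : 0 < t) :
    ContinuousOn (fun τ => mWrightAt ν τ t) (Ioi 0) :=
  continuousOn_const.mul ((continuousOn_mWright h0 h1).comp (continuousOn_id.div_const _)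
    fun _ hτ => div_pos hτ (Real.rpow_pos_of_pos ht _))

theorem integrableOn_mWrightAt (h0 : 0 < ν) (h1 : ν < 1) (ht : 0 < t) :
    IntegrableOn (fun τ => mWrightAt ν τ t) (Ioi 0) := by
  have hp : 0 < (t ^ ν)⁻¹ := inv_pos.2 (Real.rpow_pos_of_pos ht _)
  have h := (integrableOn_Ioi_comp_mul_left_iff (mWright ν) 0 hp).2
    (by rw [mul_zero]; exact integrableOn_mWright h0 h1)
  refine (h.const_mul (t ^ (-ν))).congr (Eventually.of_forall fun τ => ?_)
  simp only [mWrightAt, div_eq_inv_mul]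

theorem laplace_mWrightAt (h0 : 0 < ν) (h1 : ν < 1) (ht : 0 < t) (l : ℂ) :
    ∫ τ : ℝ in Ioi 0, Complex.exp (-(l * τ)) * (mWrightAt ν τ t : ℂ) = mittagLeffler ν 1 l t := by
  have htp : 0 < t ^ ν := Real.rpow_pos_of_pos ht _
  have htc : ((t ^ ν : ℝ) : ℂ) ≠ 0 := by exact_mod_cast htp.ne'
  have h := integral_comp_mul_left_Ioi (fun r : ℝ =>
    Complex.exp (-(l * ((t ^ ν : ℝ) : ℂ) * r)) * (mWright ν r : ℂ)) 0 (inv_pos.2 htp)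
  rw [mul_zero, inv_inv, ← (hasSum_laplace_mWright h0 h1 (l * ((t ^ ν : ℝ) : ℂ))).tsum_eq] at h
  have e : ∀ τ : ℝ, Complex.exp (-(l * τ)) * (mWrightAt ν τ t : ℂ) = ((t ^ ν : ℝ) : ℂ)⁻¹ *
      (Complex.exp (-(l * ((t ^ ν : ℝ) : ℂ) * (((t ^ ν)⁻¹ * τ : ℝ) : ℂ))) *
        (mWright ν ((t ^ ν)⁻¹ * τ) : ℂ)) := by
    intro τ
    rw [mWrightAt, Real.rpow_neg ht.le, div_eq_inv_mul τ]
    push_cast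
    rw [show l * ((t ^ ν : ℝ) : ℂ) * (((t ^ ν : ℝ) : ℂ)⁻¹ * τ) = l * τ by field_simp]
    ring
  simp only [e]
  rw [integral_const_mul, h, Complex.real_smul, inv_mul_cancel_left₀ htc, mittagLeffler]
  refine tsum_congr fun n => ?_
  rw [add_sub_cancel_right, Real.rpow_mul ht.le, Real.rpow_natCast, ← neg_mul, mul_pow]
  push_cast
  ring

theorem isFiniteMeasure_mWrightLaw (h0 : 0 < ν) (h1 : ν ≤ 1) (ht : 0 < t) :
    IsFiniteMeasure (mWrightLaw ν t) := by
  rw [mWrightLaw]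
  split_ifs with h
  · infer_instance
  · exact isFiniteMeasure_withDensity_ofReal
      (integrableOn_mWrightAt h0 (lt_of_le_of_ne h1 h) ht).2

theorem ae_pos_mWrightLaw (ht : 0 < t) : ∀ᵐ τ ∂(mWrightLaw ν t), 0 < τ := by
  rw [mWrightLaw]
  split_ifs with h
  · rw [ae_dirac_iff measurableSet_Ioi]
    exact ht
  · exact (withDensity_absolutelyContinuous _ _).ae_le (ae_restrict_mem measurableSet_Ioi)

theorem integral_exp_mWrightLaw (h0 : 0 < ν) (h1 : ν ≤ 1) (ht : 0 < t) (l : ℂ) :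
    ∫ τ : ℝ, Complex.exp (-(l * τ)) ∂(mWrightLaw ν t) = mittagLeffler ν 1 l t := by
  rw [mWrightLaw]
  split_ifs with h
  · rw [integral_dirac, h, mittagLeffler_one_one l t]
  · have h1 := lt_of_le_of_ne h1 h
    rw [integral_withDensity_ofReal (integrableOn_mWrightAt h0 h1 ht).1.aemeasurable
      ((ae_restrict_mem measurableSet_Ioi).mono fun τ hτ =>
        mWrightAt_nonneg h0 h1 ht (mem_Ioi.1 hτ).le), laplace_mWrightAt h0 h1 ht]

end DirectingLaw

section Subordination

variable {α β θ : ℝ} {μ : Measure ℝ}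

/-- The law of `T^{1/α} X` for independent `T ∼ M_β(·;t)` and `X ∼ μ`. -/
noncomputable def subordinatedLaw (α β : ℝ) (μ : Measure ℝ) (t : ℝ) : Measure ℝ :=
  ((mWrightLaw β t).prod μ).map fun p => p.1 ^ (1 / α) * p.2

theorem measurable_rpow_mul (α : ℝ) : Measurable fun p : ℝ × ℝ => p.1 ^ (1 / α) * p.2 := by
  fun_prop

theorem isGreenFunction_subordinatedLaw (h0 : 0 < α) [IsFiniteMeasure μ]
    (hμ : ∀ κ : ℝ, ∫ x : ℝ, Complex.exp (Complex.I * κ * x) ∂μ =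
      Complex.exp (-fellerSymbol α θ κ)) (hβ : 0 < β) (hβ1 : β ≤ 1) :
    IsGreenFunction α β θ (subordinatedLaw α β μ) := by
  refine isGreenFunction_of_fourierIn hβ (fun t ht => ?_) (fun κ t ht => ?_)
  · have := isFiniteMeasure_mWrightLaw hβ hβ1 ht
    rw [subordinatedLaw]
    infer_instance
  · have := isFiniteMeasure_mWrightLaw hβ hβ1 ht
    rw [fourierIn, subordinatedLaw, integral_map (measurable_rpow_mul α).aemeasurable
      (Continuous.aestronglyMeasurable (by fun_prop)), integral_prod]
    · rw [← integral_exp_mWrightLaw hβ hβ1 ht]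
      refine integral_congr_ae ((ae_pos_mWrightLaw ht).mono fun τ hτ => ?_)
      exact integral_exp_map_rpow_mul h0 hμ hτ κ
    · refine (integrable_const (1 : ℝ)).mono' ?_ (Eventually.of_forall fun p => ?_)
      · exact Measurable.aestronglyMeasurable (by fun_prop)
      · rw [show Complex.I * κ * ((p.1 ^ (1 / α) * p.2 : ℝ) : ℂ) =
          ((κ * (p.1 ^ (1 / α) * p.2) : ℝ) : ℂ) * Complex.I by push_cast; ring,
          Complex.norm_exp_ofReal_mul_I]

theorem subordinatedLaw_apply [IsFiniteMeasure μ] (t : ℝ) {A : Set ℝ} (hA : MeasurableSet A) :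
    subordinatedLaw α β μ t A =
      ∫⁻ τ, μ.map (fun x => τ ^ (1 / α) * x) A ∂(mWrightLaw β t) := by
  rw [subordinatedLaw, Measure.map_apply (measurable_rpow_mul α) hA,
    Measure.prod_apply (measurable_rpow_mul α hA)]
  refine lintegral_congr fun τ => ?_
  rw [Measure.map_apply (by fun_prop) hA]
  rfl

theorem isGreenFunction_map_rpow_mul (h0 : 0 < α) [IsFiniteMeasure μ]
    (hμ : ∀ κ : ℝ, ∫ x : ℝ, Complex.exp (Complex.I * κ * x) ∂μ =
      Complex.exp (-fellerSymbol α θ κ)) :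
    IsGreenFunction α 1 θ fun τ => μ.map fun x => τ ^ (1 / α) * x := by
  refine isGreenFunction_of_fourierIn one_pos (fun t ht => inferInstance) (fun κ t ht => ?_)
  rw [fourierIn, integral_map (by fun_prop) (Continuous.aestronglyMeasurable (by fun_prop)),
    integral_exp_map_rpow_mul h0 hμ ht, mittagLeffler_one_one]

theorem fellerSymbol_two_zero (κ : ℝ) : fellerSymbol 2 0 κ = (κ : ℂ) ^ 2 := by
  rw [fellerSymbol, mul_zero, zero_mul, zero_div, Complex.ofReal_zero, mul_zero, Complex.exp_zero,
    mul_one, Real.rpow_two, sq_abs, Complex.ofReal_pow]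

theorem mittagLeffler_I_mul_add (hβ : 0 < β) (κ : ℝ) {t : ℝ} (ht : 0 < t) :
    mittagLeffler β 1 (-(Complex.I * κ)) t + mittagLeffler β 1 (Complex.I * κ) t =
      2 * mittagLeffler (2 * β) 1 (fellerSymbol 2 0 κ) t := by
  rw [add_comm, mittagLeffler_add_neg hβ _ ht, fellerSymbol_two_zero, mul_pow, Complex.I_sq,
    neg_one_mul, neg_neg]

/-- The symmetrization of the directing law. -/
noncomputable def symmetrizedLaw (β t : ℝ) : Measure ℝ :=
  (2⁻¹ : ENNReal) • (mWrightLaw β t + (mWrightLaw β t).map Neg.neg)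

theorem isGreenFunction_symmetrizedLaw (hβ : 0 < β) (hβ1 : β ≤ 1) :
    IsGreenFunction 2 (2 * β) 0 (symmetrizedLaw β) := by
  refine isGreenFunction_of_fourierIn (by positivity) (fun t ht => ?_) (fun κ t ht => ?_)
  · have := isFiniteMeasure_mWrightLaw hβ hβ1 ht
    exact Measure.smul_finite _ (by simp)
  · have := isFiniteMeasure_mWrightLaw hβ hβ1 ht
    have hi : ∀ (ρ : Measure ℝ) [IsFiniteMeasure ρ],
        Integrable (fun x : ℝ => Complex.exp (Complex.I * κ * x)) ρ := by
      intro ρ _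
      refine (integrable_const (1 : ℝ)).mono' (Continuous.aestronglyMeasurable (by fun_prop))
        (Eventually.of_forall fun x => ?_)
      rw [show Complex.I * κ * x = ((κ * x : ℝ) : ℂ) * Complex.I by push_cast; ring,
        Complex.norm_exp_ofReal_mul_I]
    rw [fourierIn, symmetrizedLaw, integral_smul_measure, integral_add_measure (hi _) (hi _),
      integral_map (by fun_prop) (Continuous.aestronglyMeasurable (by fun_prop))]
    have h1 := integral_exp_mWrightLaw hβ hβ1 ht (-(Complex.I * κ))
    have h2 := integral_exp_mWrightLaw hβ hβ1 ht (Complex.I * κ)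
    have h3 := mittagLeffler_I_mul_add hβ κ ht
    rw [← h1, ← h2] at h3
    simp only [neg_mul, neg_neg] at h3
    simp only [Complex.ofReal_neg, mul_neg]
    rw [h3, ENNReal.toReal_inv, ENNReal.toReal_ofNat, Complex.real_smul]
    push_cast
    ring

/-- The reflected half charges only the negative axis, so on (0,∞) the symmetrization is half of the
directing law. -/
theorem two_mul_setLIntegral_symmetrizedLaw {t : ℝ} (ht : 0 < t) (f : ℝ → ENNReal) :
    2 * ∫⁻ τ in Ioi 0, f τ ∂(symmetrizedLaw β t) = ∫⁻ τ in Ioi 0, f τ ∂(mWrightLaw β t) := by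
  have h1 : ((mWrightLaw β t).map Neg.neg).restrict (Ioi 0) = 0 := by
    rw [Measure.restrict_eq_zero, Measure.map_apply measurable_neg measurableSet_Ioi]
    refine measure_mono_null (fun τ hτ => ?_) (ae_iff.1 (ae_pos_mWrightLaw ht))
    have : 0 < -τ := hτ
    exact not_lt.2 (by linarith)
  rw [symmetrizedLaw, Measure.restrict_smul, Measure.restrict_add, h1, add_zero,
    lintegral_smul_measure, smul_eq_mul, ← mul_assoc,
    ENNReal.mul_inv_cancel two_ne_zero ENNReal.ofNat_ne_top, one_mul]

theorem IsGreenFunction.eq_of_pos {b : ℝ} (hb : 0 < b) (hb2 : b ≤ 2) {G G' : ℝ → Measure ℝ}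
    (hG : IsGreenFunction α b θ G) (hG' : IsGreenFunction α b θ G') {t : ℝ} (ht : 0 < t) :
    G t = G' t := by
  have := hG.finite t ht
  have := hG'.finite t ht
  refine Measure.ext_of_charFun (funext fun κ => ?_)
  have h := (hG.fourierIn_eq hb hb2 κ ht).trans (hG'.fourierIn_eq hb hb2 κ ht).symm
  simp only [fourierIn, mul_assoc, mul_comm Complex.I] at h
  simp only [charFun_apply_real, mul_assoc] at h ⊢
  exact h

end Subordination

/-! ### Densities and the pointwise identities -/

section StableDensity

variable {α θ : ℝ}

theorem measurable_stableDensityAt (h0 : 0 < α) (h2 : α ≤ 2) (hθ : |θ| ≤ min α (2 - α))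
    (hθ1 : |θ| < 1) : Measurable fun p : ℝ × ℝ => stableDensityAt α θ p.1 p.2 := by
  have hm := (continuous_stableDensity h0 h2 hθ hθ1).measurable
  unfold stableDensityAt
  fun_prop

theorem continuous_stableDensityAt (h0 : 0 < α) (h2 : α ≤ 2) (hθ : |θ| ≤ min α (2 - α))
    (hθ1 : |θ| < 1) (t : ℝ) : Continuous fun x => stableDensityAt α θ x t :=
  ((continuous_stableDensity h0 h2 hθ hθ1).comp (continuous_id.div_const _)).const_mul _

theorem stableDensityAt_nonneg (h0 : 0 < α) (h2 : α ≤ 2) (hθ : |θ| ≤ min α (2 - α))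
    (hθ1 : |θ| < 1) (x : ℝ) {t : ℝ} (ht : 0 ≤ t) : 0 ≤ stableDensityAt α θ x t :=
  mul_nonneg (Real.rpow_nonneg ht _) (stableDensity_nonneg h0 h2 hθ hθ1 _)

theorem isGreenDensity_stableDensityAt (h0 : 0 < α) (h2 : α ≤ 2) (hθ : |θ| ≤ min α (2 - α))
    (hθ1 : |θ| < 1) : IsGreenDensity α 1 θ (stableDensityAt α θ) where
  nonneg t ht x := stableDensityAt_nonneg h0 h2 hθ hθ1 x ht.le
  continuousOn t _ := (continuous_stableDensityAt h0 h2 hθ hθ1 t).continuousOn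
  isGreen := by
    refine isGreenFunction_of_fourierIn one_pos (fun t ht => ?_) (fun κ t ht => ?_)
    · exact isFiniteMeasure_withDensity_ofReal (((integrable_stableDensity h0 h2 hθ hθ1).comp_div
        (Real.rpow_pos_of_pos ht _).ne').const_mul _).2
    · have hp : 0 < t ^ (1 / α) := Real.rpow_pos_of_pos ht _
      have hpc : ((t ^ (1 / α) : ℝ) : ℂ) ≠ 0 := by exact_mod_cast hp.ne'
      have h := Measure.integral_comp_div (fun x : ℝ =>
        Complex.exp (Complex.I * ((t ^ (1 / α) * κ : ℝ) : ℂ) * x) * (stableDensity α θ x : ℂ))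
        (t ^ (1 / α))
      rw [integral_exp_mul_stableDensity h0 h2 hθ hθ1, fellerSymbol_mul hp,
        ← Real.rpow_mul ht.le, one_div_mul_cancel h0.ne', Real.rpow_one, abs_of_pos hp,
        Complex.real_smul] at h
      rw [fourierIn, integral_withDensity_ofReal
        (continuous_stableDensityAt h0 h2 hθ hθ1 t).aemeasurable
        (Eventually.of_forall fun x => stableDensityAt_nonneg h0 h2 hθ hθ1 x ht.le),
        mittagLeffler_one_one, mul_comm _ (t : ℂ)]
      refine mul_left_cancel₀ hpc ?_
      rw [← h, ← integral_const_mul]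
      refine integral_congr_ae (Eventually.of_forall fun x => ?_)
      dsimp only
      rw [stableDensityAt, neg_div, Real.rpow_neg ht.le]
      push_cast
      rw [show Complex.I * (((t ^ (1 / α) : ℝ) : ℂ) * κ) * (x / ((t ^ (1 / α) : ℝ) : ℂ)) =
        Complex.I * κ * x by field_simp]
      field_simp

/-- By scaling, |x| |L(x;τ)| = |u| |L(u)| with u = x/τ^{1/α}, so the bound is uniform in τ; at fixed
x ≠ 0 nothing blows up as τ → 0. -/
theorem exists_stableDensityAt_le (h0 : 0 < α) (hθ1 : |θ| < 1) :
    ∃ C, 0 ≤ C ∧ ∀ x τ, x ≠ 0 → 0 < τ → |stableDensityAt α θ x τ| ≤ C / |x| := by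
  obtain ⟨C, hC0, hC⟩ := exists_abs_mul_stableDensity_le h0 hθ1
  refine ⟨C, hC0, fun x τ hx hτ => ?_⟩
  have hp : 0 < τ ^ (1 / α) := Real.rpow_pos_of_pos hτ _
  rw [le_div_iff₀ (abs_pos.2 hx)]
  refine le_of_eq_of_le ?_ (hC (x / τ ^ (1 / α)))
  rw [stableDensityAt, neg_div, Real.rpow_neg hτ.le, abs_mul, abs_inv, abs_div, abs_of_pos hp]
  ring

end StableDensity

theorem isGreenDensity_mWrightAt_abs {β : ℝ} (h0 : 0 < β) (h1 : β < 1) :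
    IsGreenDensity 2 (2 * β) 0 fun x t => mWrightAt β |x| t / 2 := by
  have hcont : ∀ t, 0 < t → ContinuousOn (fun x => mWrightAt β |x| t / 2) {0}ᶜ := fun t ht =>
    ((continuousOn_mWrightAt h0 h1 ht).comp continuous_abs.continuousOn
      fun x hx => abs_pos.2 hx).div_const 2
  have hnn : ∀ t, 0 < t → ∀ x, 0 ≤ mWrightAt β |x| t / 2 := fun t ht x =>
    div_nonneg (mWrightAt_nonneg h0 h1 ht (abs_nonneg x)) zero_le_two
  have hint : ∀ t, 0 < t → Integrable fun x => mWrightAt β |x| t / 2 := by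
    intro t ht
    have hpos : IntegrableOn (fun x => mWrightAt β |x| t / 2) (Ioi 0) :=
      IntegrableOn.congr_fun ((integrableOn_mWrightAt h0 h1 ht).div_const 2)
        (fun x hx => by rw [abs_of_pos (mem_Ioi.1 hx)]) measurableSet_Ioi
    have hneg := hpos.comp_neg
    simp only [abs_neg, neg_Ioi, neg_zero] at hneg
    have := hneg.union hpos
    rwa [Iio_union_Ioi, IntegrableOn, restrict_compl_singleton] at this
  refine ⟨hnn, hcont, isGreenFunction_of_fourierIn (by positivity) (fun t ht => ?_)
    (fun κ t ht => ?_)⟩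
  · exact isFiniteMeasure_withDensity_ofReal (hint t ht).2
  · have hi : Integrable fun x : ℝ =>
        Complex.exp (Complex.I * κ * x) * ((mWrightAt β |x| t / 2 : ℝ) : ℂ) := by
      refine (hint t ht).norm.mono' ((Continuous.aestronglyMeasurable (by fun_prop)).mul
        (Complex.continuous_ofReal.comp_aestronglyMeasurable (hint t ht).1))
        (Eventually.of_forall fun x => ?_)
      rw [norm_mul, show Complex.I * κ * x = ((κ * x : ℝ) : ℂ) * Complex.I by push_cast; ring,
        Complex.norm_exp_ofReal_mul_I, one_mul, Complex.norm_real]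
    have h3 := mittagLeffler_I_mul_add h0 κ ht
    rw [← laplace_mWrightAt h0 h1 ht, ← laplace_mWrightAt h0 h1 ht] at h3
    have hpos : ∫ x : ℝ in Ioi 0,
        Complex.exp (Complex.I * κ * x) * ((mWrightAt β |x| t / 2 : ℝ) : ℂ) =
        2⁻¹ * ∫ τ : ℝ in Ioi 0, Complex.exp (-(-(Complex.I * κ) * τ)) * (mWrightAt β τ t : ℂ) := by
      rw [← integral_const_mul]
      refine setIntegral_congr_fun measurableSet_Ioi fun x hx => ?_
      rw [abs_of_pos (mem_Ioi.1 hx), neg_mul, neg_neg]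
      push_cast
      ring
    have hneg : ∫ x : ℝ in Iic 0,
        Complex.exp (Complex.I * κ * x) * ((mWrightAt β |x| t / 2 : ℝ) : ℂ) =
        2⁻¹ * ∫ τ : ℝ in Ioi 0, Complex.exp (-(Complex.I * κ * τ)) * (mWrightAt β τ t : ℂ) := by
      rw [← neg_zero, ← integral_comp_neg_Ioi, neg_zero, ← integral_const_mul]
      refine setIntegral_congr_fun measurableSet_Ioi fun x hx => ?_
      rw [abs_neg, abs_of_pos (mem_Ioi.1 hx)]
      push_cast
      rw [mul_neg]
      ring
    rw [fourierIn, integral_withDensity_ofReal (hint t ht).1.aemeasurable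
      (Eventually.of_forall (hnn t ht)), ← intervalIntegral.integral_Iic_add_Ioi hi.integrableOn
      hi.integrableOn, hpos, hneg, ← mul_add, add_comm, h3]
    ring

theorem IsGreenDensity.aemeasurable {α b θ : ℝ} {K : ℝ → ℝ → ℝ} (hK : IsGreenDensity α b θ K)
    {t : ℝ} (ht : 0 < t) : AEMeasurable fun x => K x t := by
  have := (hK.continuousOn t ht).aemeasurable (μ := volume)
    (measurableSet_singleton (0 : ℝ)).compl
  rwa [restrict_compl_singleton] at this

/-- Equality of the measures gives equality almost everywhere, and continuity off 0 upgrades it to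
every x ≠ 0. -/
theorem IsGreenDensity.eq_of_ne {α b θ : ℝ} (hb : 0 < b) (hb2 : b ≤ 2) {K K' : ℝ → ℝ → ℝ}
    (hK : IsGreenDensity α b θ K) (hK' : IsGreenDensity α b θ K') {t : ℝ} (ht : 0 < t) {x : ℝ}
    (hx : x ≠ 0) : K x t = K' x t := by
  have hfin := hK.isGreen.finite t ht
  have hlt := measure_lt_top
    ((volume : Measure ℝ).withDensity (fun x => ENNReal.ofReal (K x t))) univ
  rw [withDensity_apply _ MeasurableSet.univ, Measure.restrict_univ] at hlt
  have hae := (withDensity_eq_iff (hK.aemeasurable ht).ennreal_ofReal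
    (hK'.aemeasurable ht).ennreal_ofReal hlt.ne).1 (hK.isGreen.eq_of_pos hb hb2 hK'.isGreen ht)
  refine Measure.eqOn_open_of_ae_eq (μ := volume) (f := fun x => K x t) (g := fun x => K' x t)
    (ae_restrict_of_ae (hae.mono fun y hy => ?_)) isOpen_compl_singleton (hK.continuousOn t ht)
    (hK'.continuousOn t ht) hx
  exact (ENNReal.ofReal_eq_ofReal_iff (hK.nonneg t ht y) (hK'.nonneg t ht y)).1 hy

theorem restrict_Ioi_mWrightLaw {ν t : ℝ} (ht : 0 < t) :
    (mWrightLaw ν t).restrict (Ioi 0) = mWrightLaw ν t :=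
  Measure.restrict_eq_self_of_ae_mem (ae_pos_mWrightLaw ht)

section Subordination

variable {α β θ : ℝ}

/-- By uniqueness G is the law of T^{1/α} X and P_τ the law of τ^{1/α} X; conditioning on T = τ
gives the formula. -/
theorem IsGreenFunction.apply_eq_lintegral (h0 : 0 < α) (h2 : α ≤ 2) (hθ : |θ| ≤ min α (2 - α))
    (hβ : 0 < β) (hβ1 : β ≤ 1) {G P : ℝ → Measure ℝ} (hG : IsGreenFunction α β θ G)
    (hP : IsGreenFunction α 1 θ P) {t : ℝ} (ht : 0 < t) {A : Set ℝ} (hA : MeasurableSet A) :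
    G t A = ∫⁻ τ in Ioi 0, P τ A ∂(mWrightLaw β t) := by
  obtain ⟨μ, hfin, hμ⟩ := exists_stableLaw h0 h2 hθ
  rw [hG.eq_of_pos hβ (by linarith) (isGreenFunction_subordinatedLaw h0 hμ hβ hβ1) ht,
    subordinatedLaw_apply t hA,
    restrict_Ioi_mWrightLaw ht]
  refine lintegral_congr_ae ((ae_pos_mWrightLaw ht).mono fun τ hτ => ?_)
  dsimp only
  rw [hP.eq_of_pos one_pos one_le_two (isGreenFunction_map_rpow_mul h0 hμ) hτ]

theorem integrableOn_stableDensityAt_mul_mWrightAt (h0 : 0 < α) (h2 : α ≤ 2)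
    (hθ : |θ| ≤ min α (2 - α)) (hθ1 : |θ| < 1) (hβ : 0 < β) (hβ1 : β < 1) {t : ℝ} (ht : 0 < t)
    {x : ℝ} (hx : x ≠ 0) :
    IntegrableOn (fun τ => stableDensityAt α θ x τ * mWrightAt β τ t) (Ioi 0) := by
  obtain ⟨C, _, hC⟩ := exists_stableDensityAt_le (α := α) (θ := θ) h0 hθ1
  refine (integrableOn_mWrightAt hβ hβ1 ht).bdd_mul (c := C / |x|)
    ((measurable_stableDensityAt h0 h2 hθ hθ1).comp
      (measurable_const.prodMk measurable_id)).aestronglyMeasurable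
    ((ae_restrict_mem measurableSet_Ioi).mono fun τ hτ => hC x τ hx hτ)

theorem continuousOn_integral_stableDensityAt_mul_mWrightAt (h0 : 0 < α) (h2 : α ≤ 2)
    (hθ : |θ| ≤ min α (2 - α)) (hθ1 : |θ| < 1) (hβ : 0 < β) (hβ1 : β < 1) {t : ℝ} (ht : 0 < t) :
    ContinuousOn (fun x => ∫ τ in Ioi (0 : ℝ), stableDensityAt α θ x τ * mWrightAt β τ t)
      {0}ᶜ := by
  obtain ⟨C, hC0, hC⟩ := exists_stableDensityAt_le (α := α) (θ := θ) h0 hθ1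
  intro x₀ hx₀
  have hx₀ : 0 < |x₀| := abs_pos.2 hx₀
  have hev : ∀ᶠ x in 𝓝 x₀, |x₀| / 2 < |x| :=
    continuous_abs.continuousAt.eventually (lt_mem_nhds (by linarith))
  refine ContinuousAt.continuousWithinAt (continuousAt_of_dominated
    (bound := fun τ => C / (|x₀| / 2) * mWrightAt β τ t) (hev.mono fun x hx => ?_)
    (hev.mono fun x hx => ?_) ((integrableOn_mWrightAt hβ hβ1 ht).const_mul _)
    (Eventually.of_forall fun τ => ?_))
  · exact (integrableOn_stableDensityAt_mul_mWrightAt h0 h2 hθ hθ1 hβ hβ1 ht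
      (abs_pos.1 ((half_pos hx₀).trans hx))).1
  · refine (ae_restrict_mem measurableSet_Ioi).mono fun τ hτ => ?_
    have hM := mWrightAt_nonneg hβ hβ1 ht (mem_Ioi.1 hτ).le
    rw [norm_mul, Real.norm_of_nonneg hM]
    refine mul_le_mul_of_nonneg_right ?_ hM
    exact (hC x τ (abs_pos.1 ((half_pos hx₀).trans hx)) hτ).trans (by gcongr)
  · exact ((continuous_stableDensityAt h0 h2 hθ hθ1 τ).mul_const _).continuousAt

theorem isGreenDensity_integral_stableDensityAt_mul_mWrightAt (h0 : 0 < α) (h2 : α ≤ 2)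
    (hθ : |θ| ≤ min α (2 - α)) (hθ1 : |θ| < 1) (hβ : 0 < β) (hβ1 : β < 1) :
    IsGreenDensity α β θ fun x t =>
      ∫ τ in Ioi (0 : ℝ), stableDensityAt α θ x τ * mWrightAt β τ t := by
  have hL := isGreenDensity_stableDensityAt h0 h2 hθ hθ1
  obtain ⟨μ, hfin, hμ⟩ := exists_stableLaw h0 h2 hθ
  have hG := isGreenFunction_subordinatedLaw h0 hμ hβ hβ1.le
  refine ⟨fun t ht x => setIntegral_nonneg measurableSet_Ioi fun τ hτ =>
    mul_nonneg (stableDensityAt_nonneg h0 h2 hθ hθ1 x (mem_Ioi.1 hτ).le)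
      (mWrightAt_nonneg hβ hβ1 ht (mem_Ioi.1 hτ).le),
    fun t ht => continuousOn_integral_stableDensityAt_mul_mWrightAt h0 h2 hθ hθ1 hβ hβ1 ht, ?_⟩
  have heq : ∀ t, 0 < t → (volume : Measure ℝ).withDensity (fun x => ENNReal.ofReal
      (∫ τ in Ioi (0 : ℝ), stableDensityAt α θ x τ * mWrightAt β τ t)) =
      subordinatedLaw α β μ t := by
    intro t ht
    have hMm := (integrableOn_mWrightAt hβ hβ1 ht).1.aemeasurable.ennreal_ofReal
    have hLm := (measurable_stableDensityAt h0 h2 hθ hθ1).ennreal_ofReal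
    ext A hA
    rw [hG.apply_eq_lintegral h0 h2 hθ hβ hβ1.le hL.isGreen ht hA,
      restrict_Ioi_mWrightLaw ht,
      mWrightLaw, if_neg hβ1.ne]
    simp only [withDensity_apply _ hA]
    have hswap : AEMeasurable (Function.uncurry fun x τ => ENNReal.ofReal (mWrightAt β τ t) *
        ENNReal.ofReal (stableDensityAt α θ x τ))
        ((volume.restrict A).prod (volume.restrict (Ioi 0))) := hMm.comp_snd.mul hLm.aemeasurable
    rw [lintegral_withDensity_eq_lintegral_mul₀ hMm
      (Measurable.lintegral_prod_left' hLm).aemeasurable]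
    simp only [Pi.mul_apply]
    have hpull : ∀ τ, ENNReal.ofReal (mWrightAt β τ t) *
        ∫⁻ x in A, ENNReal.ofReal (stableDensityAt α θ x τ) =
        ∫⁻ x in A, ENNReal.ofReal (mWrightAt β τ t) * ENNReal.ofReal (stableDensityAt α θ x τ) :=
      fun τ => (lintegral_const_mul _ (hLm.comp (measurable_id.prodMk measurable_const))).symm
    simp only [hpull]
    rw [← lintegral_lintegral_swap hswap]
    -- Absolute convergence is only known off the origin, and the origin is a null set.
    have hne : ∀ᵐ x ∂(volume.restrict A), x ≠ (0 : ℝ) := ae_restrict_of_ae (by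
      rw [ae_iff]; simp)
    refine lintegral_congr_ae (hne.mono fun x hx => ?_)
    dsimp only
    rw [ofReal_integral_eq_lintegral_ofReal
      (integrableOn_stableDensityAt_mul_mWrightAt h0 h2 hθ hθ1 hβ hβ1 ht hx)]
    · refine setLIntegral_congr_fun measurableSet_Ioi fun τ hτ => ?_
      rw [mul_comm, ENNReal.ofReal_mul (mWrightAt_nonneg hβ hβ1 ht (mem_Ioi.1 hτ).le)]
    · exact (ae_restrict_mem measurableSet_Ioi).mono fun τ hτ =>
        mul_nonneg (stableDensityAt_nonneg h0 h2 hθ hθ1 x (mem_Ioi.1 hτ).le)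
          (mWrightAt_nonneg hβ hβ1 ht (mem_Ioi.1 hτ).le)
  refine isGreenFunction_of_fourierIn hβ (fun t ht => ?_) (fun κ t ht => ?_)
  · rw [heq t ht]
    exact hG.finite t ht
  · rw [fourierIn, heq t ht]
    exact hG.fourierIn_eq hβ (by linarith) κ ht

end Subordination

theorem mainTheorem3 (α β θ : ℝ) (hα : 0 < α) (hα2 : α ≤ 2) (hθ : |θ| ≤ min α (2 - α))
    (hβ : 0 < β) (hβ1 : β ≤ 1) :
    -- the Green functions exist
    (∃ G, IsGreenFunction α β θ G) ∧ (∃ P, IsGreenFunction α 1 θ P) ∧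
    (∃ N, IsGreenFunction 2 (2 * β) 0 N) ∧
    -- both forms of the subordination law, as identities between measures in `x`
    (∀ G P N : ℝ → Measure ℝ, IsGreenFunction α β θ G → IsGreenFunction α 1 θ P →
      IsGreenFunction 2 (2 * β) 0 N → ∀ t, 0 < t →
        (∀ κ, fourierIn P κ t = Complex.exp (-(t : ℂ) * fellerSymbol α θ κ)) ∧
        ∀ A : Set ℝ, MeasurableSet A →
          G t A = ∫⁻ τ in Ioi 0, P τ A ∂(mWrightLaw β t) ∧
          G t A = 2 * ∫⁻ τ in Ioi 0, P τ A ∂(N t)) ∧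
    -- both forms, pointwise, whenever the functions on the right-hand side are genuine functions
    (|θ| < 1 → IsGreenDensity α 1 θ (stableDensityAt α θ)) ∧
    (β < 1 → IsGreenDensity 2 (2 * β) 0 (fun x t => mWrightAt β |x| t / 2)) ∧
    (|θ| < 1 → β < 1 →
      (∃ K, IsGreenDensity α β θ K) ∧
      (∀ K, IsGreenDensity α β θ K → ∀ t, 0 < t → ∀ x, x ≠ 0 →
        IntegrableOn (fun τ => stableDensityAt α θ x τ * mWrightAt β τ t) (Ioi 0) ∧
        K x t = ∫ τ in Ioi (0 : ℝ), stableDensityAt α θ x τ * mWrightAt β τ t) ∧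
      (∀ K P N, IsGreenDensity α β θ K → IsGreenDensity α 1 θ P →
        IsGreenDensity 2 (2 * β) 0 N → ∀ t, 0 < t → ∀ x, x ≠ 0 →
          IntegrableOn (fun τ => P x τ * N τ t) (Ioi 0) ∧
          K x t = 2 * ∫ τ in Ioi (0 : ℝ), P x τ * N τ t)) := by
  obtain ⟨μ, hfin, hμ⟩ := exists_stableLaw hα hα2 hθ
  have hsym := isGreenFunction_symmetrizedLaw hβ hβ1
  refine ⟨⟨_, isGreenFunction_subordinatedLaw hα hμ hβ hβ1⟩,
    ⟨_, isGreenFunction_map_rpow_mul hα hμ⟩, ⟨_, hsym⟩, fun G P N hG hP hN t ht => ?_,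
    isGreenDensity_stableDensityAt hα hα2 hθ, isGreenDensity_mWrightAt_abs hβ,
    fun hθ1 hβ' => ?_⟩
  · refine ⟨fun κ => ?_, fun A hA => ?_⟩
    · rw [hP.fourierIn_eq one_pos one_le_two κ ht, mittagLeffler_one_one, neg_mul, mul_comm]
    · have h := hG.apply_eq_lintegral hα hα2 hθ hβ hβ1 hP ht hA
      refine ⟨h, ?_⟩
      rw [hN.eq_of_pos (by positivity) (by linarith) hsym ht,
        two_mul_setLIntegral_symmetrizedLaw ht, h]
  · have hK₀ := isGreenDensity_integral_stableDensityAt_mul_mWrightAt hα hα2 hθ hθ1 hβ hβ'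
    have hK : ∀ K, IsGreenDensity α β θ K → ∀ t, 0 < t → ∀ x, x ≠ 0 →
        IntegrableOn (fun τ => stableDensityAt α θ x τ * mWrightAt β τ t) (Ioi 0) ∧
        K x t = ∫ τ in Ioi (0 : ℝ), stableDensityAt α θ x τ * mWrightAt β τ t :=
      fun K hK t ht x hx =>
        ⟨integrableOn_stableDensityAt_mul_mWrightAt hα hα2 hθ hθ1 hβ hβ' ht hx,
          hK.eq_of_ne hβ (by linarith) hK₀ ht hx⟩
    refine ⟨⟨_, hK₀⟩, hK, fun K P N hKd hP hN t ht x hx => ?_⟩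
    obtain ⟨hi, hKx⟩ := hK K hKd t ht x hx
    -- Arbitrary Green densities are replaced by the explicit ones through uniqueness; for N this
    -- needs τ ≠ 0, which holds on (0,∞).
    have hPN : EqOn (fun τ => 2⁻¹ * (stableDensityAt α θ x τ * mWrightAt β τ t))
        (fun τ => P x τ * N τ t) (Ioi 0) := by
      intro τ hτ
      have hτ : 0 < τ := hτ
      dsimp only
      rw [hP.eq_of_ne one_pos one_le_two (isGreenDensity_stableDensityAt hα hα2 hθ hθ1) hτ hx,
        hN.eq_of_ne (by positivity) (by linarith) (isGreenDensity_mWrightAt_abs hβ hβ') ht hτ.ne',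
        abs_of_pos hτ]
      ring
    refine ⟨IntegrableOn.congr_fun (hi.const_mul 2⁻¹) hPN measurableSet_Ioi, ?_⟩
    rw [← setIntegral_congr_fun measurableSet_Ioi hPN, integral_const_mul, hKx]
    ring
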